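/- **Corollary 5.2.** We work in first-order logic; models are nonempty, and a *universal consequence* of a theory is a sentence $\forall x_1\dots\forall x_r\,\psi$ with $\psi$ quantifier-free that holds in all models of the theory. A set of sentences in a finite language is *decidable* if the set of Gödel numbers of its members is computable. Consider the following properties of an operation on an ordered structure. For a unary operation $K$: (A1e) $K$ is extensive, $x\le Kx$; (A1c) contractive, $Kx\le x$; (A2) idempotent, $KKx=Kx$; (A2e) idempotent and extensive; (A2c) idempotent and contractive; (A3) involutive, $KKx=x$; (B1) isotone; (B1e) isotone and extensive; (B1c) isotone and contractive; (B2) isotone and idempotent; (B3) a closure operation (isotone, extensive and idempotent); (B4) an interior operation (isotone, contractive and idempotent); (B5) antitone. For an $n$-ary operation $F$, where $n\ge 1$, $i,j\ge 0$ and $i+j\le n$: (C1) $F$ is isotone on each of the first $i$ components and antitone on each of the last $j$ components; (C2) as (C1), and moreover $x_1\le F(x_1,\dots,x_n),\dots,x_h\le F(x_1,\dots,x_n)$, for some given $h\le i$; and, for lattice-ordered structures, (C3) as (C1), and moreover $t(x_1,\dots,x_i)\le F(x_1,\dots,x_n)$, for some given lattice term $t$. Let $T$ be the theory of Boolean algebras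 (in the language $\le,\vee,\wedge,',0,1$), and let $T^+$ be the extension of $T$ in the language with a further finite set of new operation symbols, and with further axioms asserting that each new operation satisfies some condition chosen among (A1e)–(C3), possibly different conditions for different operations. Then the set of universal consequences of $T^+$ is decidable. The same applies when $T$ is - the theory of distributive lattices (in the language $\le,\vee,\wedge$); - more generally, any universal theory $T$ in a finite language with binary operation symbols $\vee,\wedge$ such that $T$ implies the axioms of lattices for $\vee,\wedge$ (the order being $x\le y\Leftrightarrow x\wedge y=x$); it is decidable whether a given finite structure is a model of $T$; and $T$ is locally finite with a computable bound, that is, there is a computable function $g:\mathbb N\to\mathbb N$ such that, for every $m$, every model of $T$ generated by $m$ elements is finite of cardinality at most $g(m)$; and, excluding condition (C3), when $T$ is the theory of partially ordered sets (language $\le$), of join semilattices (language $\le,\vee$), or of meet semilattices (language $\le,\wedge$). -/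

import Mathlib

open FirstOrder FirstOrder.Language

namespace OrderedOps

/-! ### Finite languages, numberings of their symbols, and decidability -/

/-- A listing of the (finitely many) function and relation symbols of a finite language. -/
structure SymbolNumbering (L : FirstOrder.Language.{0, 0}) where
  numFun : ℕ
  numRel : ℕ
  funs : (Σ n, L.Functions n) ≃ Fin numFun
  rels : (Σ n, L.Relations n) ≃ Fin numRel

section Coding

variable {L : FirstOrder.Language.{0, 0}}

/-- The code number of a term, given code numbers of its variables. -/
def SymbolNumbering.termCode (ν : SymbolNumbering L) {α : Type} (v : α → ℕ) : L.Term α → ℕ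
  | .var a => Nat.pair 0 (v a)
  | .func (l := l) f ts =>
      Nat.pair 1 (Nat.pair (ν.funs ⟨l, f⟩ : ℕ)
        (Encodable.encode (List.ofFn fun i => ν.termCode v (ts i))))

/-- The code number of the `i`-th quantified variable is `i`. -/
def varCode {n : ℕ} : Empty ⊕ Fin n → ℕ :=
  Sum.elim Empty.elim (fun i => (i : ℕ))

/-- The code number (Gödel number) of a formula without parameters. -/
def SymbolNumbering.formulaCode (ν : SymbolNumbering L) : ∀ {n : ℕ}, L.BoundedFormula Empty n → ℕ
  | _, .falsum => Nat.pair 0 0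
  | _, .equal t₁ t₂ => Nat.pair 1 (Nat.pair (ν.termCode varCode t₁) (ν.termCode varCode t₂))
  | _, .rel (l := l) R ts =>
      Nat.pair 2 (Nat.pair (ν.rels ⟨l, R⟩ : ℕ)
        (Encodable.encode (List.ofFn fun i => ν.termCode varCode (ts i))))
  | _, .imp φ ψ => Nat.pair 3 (Nat.pair (ν.formulaCode φ) (ν.formulaCode ψ))
  | _, .all φ => Nat.pair 4 (ν.formulaCode φ)

/-- The language of `T` is finite, and the set of universal sentences that are true in all models
of `T` is decidable: the set of their code numbers is computable. The symbols may be numbered in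
any way. -/
def UniversalConsequencesDecidable (T : L.Theory) : Prop :=
  Nonempty (SymbolNumbering L) ∧
  ∀ ν : SymbolNumbering L, ComputablePred fun c : ℕ =>
    ∃ φ : L.Sentence, BoundedFormula.IsUniversal φ ∧ T ⊨ᵇ φ ∧ ν.formulaCode φ = c

open Classical in
/-- The code of an `L`-structure on `{0, …, n - 1}`: its size `n`, the value tables of the
operations and the 0-1 tables of the relations, each table being listed along the standard
enumeration of `k`-tuples by numbers below `n ^ k`. -/
noncomputable def SymbolNumbering.structureCode (ν : SymbolNumbering L) (n : ℕ)
    (S : L.Structure (Fin n)) :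
    ℕ × List (List ℕ) × List (List ℕ) :=
  (n,
    List.ofFn fun s : Fin ν.numFun =>
      List.ofFn fun t : Fin (n ^ (ν.funs.symm s).1) =>
        ((S.funMap (ν.funs.symm s).2 (finFunctionFinEquiv.symm t) : Fin n) : ℕ),
    List.ofFn fun s : Fin ν.numRel =>
      List.ofFn fun t : Fin (n ^ (ν.rels.symm s).1) =>
        if S.RelMap (ν.rels.symm s).2 (finFunctionFinEquiv.symm t) then 1 else 0)

/-- It is decidable whether a given finite structure is a model of `T`. -/
def SymbolNumbering.FiniteModelsDecidable (ν : SymbolNumbering L) (T : L.Theory) : Prop :=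
  ComputablePred fun c : ℕ × List (List ℕ) × List (List ℕ) =>
    ∃ (n : ℕ) (S : L.Structure (Fin n)),
      (letI := S; Fin n ⊨ T) ∧ ν.structureCode n S = c

/-- `T` is locally finite with bound `g`: every model of `T` that is generated by `m` elements is
finite, with at most `g m` elements. -/
def LocallyFiniteWithBound (T : L.Theory) (g : ℕ → ℕ) : Prop :=
  ∀ (m : ℕ) (M : Type) [L.Structure M] [M ⊨ T] (v : Fin m → M),
    Substructure.closure L (Set.range v) = ⊤ → Finite M ∧ Nat.card M ≤ g m

end Coding

/-! ### Properties of additional operations, as sets of first-order sentences -/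

/-- A way to write `s ≤ t` in a language. -/
def LeFormula (L : FirstOrder.Language.{0, 0}) : Type :=
  ∀ n : ℕ, L.Term (Empty ⊕ Fin n) → L.Term (Empty ⊕ Fin n) → L.BoundedFormula Empty n

/-- `s ≤ t` expressed by a binary relation symbol. -/
def relLe {L : FirstOrder.Language.{0, 0}} (R : L.Relations 2) : LeFormula L :=
  fun _ s t => R.boundedFormula₂ s t

/-- `s ≤ t` expressed by `s ∧ t = s`, for a binary function symbol `∧`. -/
def infLe {L : FirstOrder.Language.{0, 0}} (inf : L.Functions 2) : LeFormula L :=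
  fun _ s t => inf.apply₂ s t =' s

/-- Properties of an `n`-ary operation on an ordered structure. -/
inductive OpCond : ℕ → Type
  | extensive : OpCond 1
  | contractive : OpCond 1
  | idempotent : OpCond 1
  | idempotentExtensive : OpCond 1
  | idempotentContractive : OpCond 1
  | involutive : OpCond 1
  | isotone : OpCond 1
  | isotoneExtensive : OpCond 1
  | isotoneContractive : OpCond 1
  | isotoneIdempotent : OpCond 1
  | closure : OpCond 1
  | interior : OpCond 1
  | antitone : OpCond 1
  /-- Isotone on the first `i` components and antitone on the last `j` components. -/
  | mixed (n i j : ℕ) (hn : 0 < n) (hij : i + j ≤ n) : OpCond n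
  /-- As `mixed`, and moreover above each of the first `h` arguments, where `h ≤ i`. -/
  | mixedAbove (n i j h : ℕ) (hn : 0 < n) (hij : i + j ≤ n) (hh : h ≤ i) : OpCond n

/-- Lattice terms in `i` variables. -/
inductive LatTerm (i : ℕ) : Type
  | var (a : Fin i) : LatTerm i
  | sup (s t : LatTerm i) : LatTerm i
  | inf (s t : LatTerm i) : LatTerm i

/-- Properties of an `n`-ary operation on a lattice-ordered structure. -/
inductive LatOpCond : ℕ → Type
  | basic {n : ℕ} (c : OpCond n) : LatOpCond n
  /-- Isotone on the first `i` components, antitone on the last `j` components, and moreover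
  above the value of the lattice term `t` at the first `i` arguments. -/
  | mixedAboveTerm (n i j : ℕ) (hn : 0 < n) (hij : i + j ≤ n) (t : LatTerm i) : LatOpCond n

section Axioms

variable {L : FirstOrder.Language.{0, 0}} (le : LeFormula L)

/-- `x ≤ K x`. -/
def extensiveAx (K : L.Functions 1) : L.Sentence :=
  ∀' (le 1 (&0) (K.apply₁ (&0)))

/-- `K x ≤ x`. -/
def contractiveAx (K : L.Functions 1) : L.Sentence :=
  ∀' (le 1 (K.apply₁ (&0)) (&0))

/-- `K (K x) = K x`. -/
def idempotentAx (K : L.Functions 1) : L.Sentence :=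
  ∀' (K.apply₁ (K.apply₁ (&0)) =' K.apply₁ (&0))

/-- `K (K x) = x`. -/
def involutiveAx (K : L.Functions 1) : L.Sentence :=
  ∀' (K.apply₁ (K.apply₁ (&0)) =' (&0))

/-- `x ≤ y → K x ≤ K y`. -/
def isotoneAx (K : L.Functions 1) : L.Sentence :=
  ∀' ∀' (le 2 (&0) (&1) ⟹ le 2 (K.apply₁ (&0)) (K.apply₁ (&1)))

/-- `x ≤ y → K y ≤ K x`. -/
def antitoneAx (K : L.Functions 1) : L.Sentence :=
  ∀' ∀' (le 2 (&0) (&1) ⟹ le 2 (K.apply₁ (&1)) (K.apply₁ (&0)))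

/-- The terms `x₀, …, xₙ₋₁` in the variables `x₀, …, xₙ₋₁, xₙ`. -/
def argTerms (n : ℕ) : Fin n → L.Term (Empty ⊕ Fin (n + 1)) :=
  fun k => &(Fin.castSucc k)

/-- The terms `x₀, …, xₙ₋₁` in the variables `x₀, …, xₙ₋₁, xₙ`, with `x_h` replaced by `xₙ`. -/
def argTermsUpdate (n : ℕ) (h : Fin n) : Fin n → L.Term (Empty ⊕ Fin (n + 1)) :=
  Function.update (argTerms n) h (&(Fin.last n))

/-- `x_h ≤ y → F (…, x_h, …) ≤ F (…, y, …)`, the other arguments being kept fixed. -/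
def isotoneOnAx {n : ℕ} (F : L.Functions n) (h : Fin n) : L.Sentence :=
  (le (n + 1) (&(Fin.castSucc h)) (&(Fin.last n)) ⟹
    le (n + 1) (Term.func F (argTerms n)) (Term.func F (argTermsUpdate n h))).alls

/-- `x_h ≤ y → F (…, y, …) ≤ F (…, x_h, …)`, the other arguments being kept fixed. -/
def antitoneOnAx {n : ℕ} (F : L.Functions n) (h : Fin n) : L.Sentence :=
  (le (n + 1) (&(Fin.castSucc h)) (&(Fin.last n)) ⟹
    le (n + 1) (Term.func F (argTermsUpdate n h)) (Term.func F (argTerms n))).alls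

/-- `x_h ≤ F (x₀, …, xₙ₋₁)`. -/
def aboveArgAx {n : ℕ} (F : L.Functions n) (h : Fin n) : L.Sentence :=
  (le n (&h) (Term.func F fun k => &k)).alls

/-- The term of `L` that corresponds to a lattice term, with given terms for the variables. -/
def LatTerm.toTerm {i : ℕ} {α : Type} (sup inf : L.Functions 2) (x : Fin i → L.Term α) :
    LatTerm i → L.Term α
  | .var a => x a
  | .sup s t => sup.apply₂ (s.toTerm sup inf x) (t.toTerm sup inf x)
  | .inf s t => inf.apply₂ (s.toTerm sup inf x) (t.toTerm sup inf x)

/-- `t (x₀, …, xᵢ₋₁) ≤ F (x₀, …, xₙ₋₁)`. -/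
def aboveTermAx (sup inf : L.Functions 2) {n i : ℕ} (hi : i ≤ n) (F : L.Functions n)
    (t : LatTerm i) : L.Sentence :=
  (le n (t.toTerm sup inf fun a => &(Fin.castLE hi a)) (Term.func F fun k => &k)).alls

/-- `F` is isotone on the first `i` components and antitone on the last `j` components. -/
def mixedAx {n : ℕ} (F : L.Functions n) (i j : ℕ) : L.Theory :=
  {σ | ∃ h : Fin n, (h : ℕ) < i ∧ σ = isotoneOnAx le F h} ∪
  {σ | ∃ h : Fin n, n ≤ (h : ℕ) + j ∧ σ = antitoneOnAx le F h}

/-- The axioms asserting that the operation `F` has a given property. -/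
def OpCond.axioms : ∀ {n : ℕ}, OpCond n → L.Functions n → L.Theory
  | _, .extensive, K => {extensiveAx le K}
  | _, .contractive, K => {contractiveAx le K}
  | _, .idempotent, K => {idempotentAx K}
  | _, .idempotentExtensive, K => {idempotentAx K, extensiveAx le K}
  | _, .idempotentContractive, K => {idempotentAx K, contractiveAx le K}
  | _, .involutive, K => {involutiveAx K}
  | _, .isotone, K => {isotoneAx le K}
  | _, .isotoneExtensive, K => {isotoneAx le K, extensiveAx le K}
  | _, .isotoneContractive, K => {isotoneAx le K, contractiveAx le K}
  | _, .isotoneIdempotent, K => {isotoneAx le K, idempotentAx K}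
  | _, .closure, K => {isotoneAx le K, extensiveAx le K, idempotentAx K}
  | _, .interior, K => {isotoneAx le K, contractiveAx le K, idempotentAx K}
  | _, .antitone, K => {antitoneAx le K}
  | _, .mixed _ i j _ _, F => mixedAx le F i j
  | n, .mixedAbove _ i j h _ _ _, F =>
      mixedAx le F i j ∪ {σ | ∃ k : Fin n, (k : ℕ) < h ∧ σ = aboveArgAx le F k}

/-- The axioms asserting that the operation `F` has a given property, in a language with symbols
for the lattice operations. -/
def LatOpCond.axioms (sup inf : L.Functions 2) :
    ∀ {n : ℕ}, LatOpCond n → L.Functions n → L.Theory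
  | _, .basic c, F => c.axioms le F
  | _, .mixedAboveTerm _ i j _ hij t, F =>
      mixedAx le F i j ∪ {aboveTermAx le sup inf (le_trans (Nat.le_add_right i j) hij) F t}

end Axioms

/-! ### Adding finitely many operations to a theory -/

/-- The language with `q` operation symbols, of arities `ar 0, …, ar (q - 1)`. -/
def opLang {q : ℕ} (ar : Fin q → ℕ) : FirstOrder.Language.{0, 0} :=
  ⟨fun n => {k : Fin q // ar k = n}, fun _ => Empty⟩

section Expansion

variable {L : FirstOrder.Language.{0, 0}} {q : ℕ} {ar : Fin q → ℕ}

/-- The `k`-th added operation symbol. -/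
def opSymbol (L : FirstOrder.Language.{0, 0}) (ar : Fin q → ℕ) (k : Fin q) :
    (L.sum (opLang ar)).Functions (ar k) :=
  Sum.inr ⟨k, rfl⟩

/-- The extension of `T` by operations, the `k`-th one having property `c k`. -/
def withOps (T : L.Theory) (le : LeFormula (L.sum (opLang ar))) (c : ∀ k, OpCond (ar k)) :
    (L.sum (opLang ar)).Theory :=
  (LHom.sumInl : L →ᴸ L.sum (opLang ar)).onTheory T ∪
    ⋃ k, (c k).axioms le (opSymbol L ar k)

/-- The extension of `T` by operations, the `k`-th one having property `c k`, in a language with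
symbols `sup` and `inf` for the lattice operations. -/
def withLatOps (T : L.Theory) (sup inf : L.Functions 2) (le : LeFormula (L.sum (opLang ar)))
    (c : ∀ k, LatOpCond (ar k)) : (L.sum (opLang ar)).Theory :=
  (LHom.sumInl : L →ᴸ L.sum (opLang ar)).onTheory T ∪
    ⋃ k, (c k).axioms le (Sum.inl sup) (Sum.inl inf) (opSymbol L ar k)

end Expansion

/-! ### Axioms of semilattices, lattices and Boolean algebras -/

section Theories

variable {L : FirstOrder.Language.{0, 0}}

/-- `f` is commutative, associative and idempotent. -/
def semilatticeAxioms (f : L.Functions 2) : L.Theory :=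
  {∀' ∀' (f.apply₂ (&0) (&1) =' f.apply₂ (&1) (&0)),
   ∀' ∀' ∀' (f.apply₂ (f.apply₂ (&0) (&1)) (&2) =' f.apply₂ (&0) (f.apply₂ (&1) (&2))),
   ∀' (f.apply₂ (&0) (&0) =' (&0))}

/-- `sup` and `inf` are semilattice operations satisfying the absorption laws. -/
def latticeAxioms (sup inf : L.Functions 2) : L.Theory :=
  semilatticeAxioms sup ∪ semilatticeAxioms inf ∪
  {∀' ∀' (sup.apply₂ (&0) (inf.apply₂ (&0) (&1)) =' (&0)),
   ∀' ∀' (inf.apply₂ (&0) (sup.apply₂ (&0) (&1)) =' (&0))}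

/-- `x ≤ y ↔ x ∧ y = x`. -/
def infOrderAx (R : L.Relations 2) (inf : L.Functions 2) : L.Sentence :=
  ∀' ∀' (R.boundedFormula₂ (&0) (&1) ⇔ (inf.apply₂ (&0) (&1) =' (&0)))

/-- `x ≤ y ↔ x ∨ y = y`. -/
def supOrderAx (R : L.Relations 2) (sup : L.Functions 2) : L.Sentence :=
  ∀' ∀' (R.boundedFormula₂ (&0) (&1) ⇔ (sup.apply₂ (&0) (&1) =' (&1)))

/-- `x ∧ (y ∨ z) = (x ∧ y) ∨ (x ∧ z)`. -/
def distribAx (sup inf : L.Functions 2) : L.Sentence :=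
  ∀' ∀' ∀' (inf.apply₂ (&0) (sup.apply₂ (&1) (&2)) ='
    sup.apply₂ (inf.apply₂ (&0) (&1)) (inf.apply₂ (&0) (&2)))

/-- `bot` and `top` are neutral for `sup` and `inf`, and `compl` is a complementation. -/
def complementAxioms (sup inf : L.Functions 2) (compl : L.Functions 1) (bot top : L.Functions 0) :
    L.Theory :=
  {∀' (sup.apply₂ (&0) (Constants.term bot) =' (&0)),
   ∀' (inf.apply₂ (&0) (Constants.term top) =' (&0)),
   ∀' (sup.apply₂ (&0) (compl.apply₁ (&0)) =' (Constants.term top)),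
   ∀' (inf.apply₂ (&0) (compl.apply₁ (&0)) =' (Constants.term bot))}

end Theories

/-- A single binary operation symbol. -/
inductive SemilatticeFun : ℕ → Type
  | op : SemilatticeFun 2

/-- The operation symbols of lattices. -/
inductive LatticeFun : ℕ → Type
  | sup : LatticeFun 2
  | inf : LatticeFun 2

/-- The operation symbols of Boolean algebras. -/
inductive BooleanFun : ℕ → Type
  | sup : BooleanFun 2
  | inf : BooleanFun 2
  | compl : BooleanFun 1
  | bot : BooleanFun 0
  | top : BooleanFun 0

/-- The language of ordered semilattices: `≤` and one binary operation. -/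
def semilatticeLang : FirstOrder.Language.{0, 0} := ⟨SemilatticeFun, orderRel⟩

/-- The language of lattices: `≤`, `∨`, `∧`. -/
def latticeLang : FirstOrder.Language.{0, 0} := ⟨LatticeFun, orderRel⟩

/-- The language of Boolean algebras: `≤`, `∨`, `∧`, complement, `0`, `1`. -/
def booleanLang : FirstOrder.Language.{0, 0} := ⟨BooleanFun, orderRel⟩

/-- Partially ordered sets. -/
def posetTheory : Language.order.Theory := Language.order.partialOrderTheory

/-- Join semilattices. -/
def joinSemilatticeTheory : semilatticeLang.Theory :=
  semilatticeAxioms (L := semilatticeLang) SemilatticeFun.op ∪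
    {supOrderAx (L := semilatticeLang) orderRel.le SemilatticeFun.op}

/-- Meet semilattices. -/
def meetSemilatticeTheory : semilatticeLang.Theory :=
  semilatticeAxioms (L := semilatticeLang) SemilatticeFun.op ∪
    {infOrderAx (L := semilatticeLang) orderRel.le SemilatticeFun.op}

/-- Distributive lattices. -/
def distribLatticeTheory : latticeLang.Theory :=
  latticeAxioms (L := latticeLang) LatticeFun.sup LatticeFun.inf ∪
    {distribAx (L := latticeLang) LatticeFun.sup LatticeFun.inf,
     infOrderAx (L := latticeLang) orderRel.le LatticeFun.inf}

/-- Boolean algebras. -/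
def booleanTheory : booleanLang.Theory :=
  latticeAxioms (L := booleanLang) BooleanFun.sup BooleanFun.inf ∪
    {distribAx (L := booleanLang) BooleanFun.sup BooleanFun.inf,
     infOrderAx (L := booleanLang) orderRel.le BooleanFun.inf} ∪
    complementAxioms (L := booleanLang) BooleanFun.sup BooleanFun.inf BooleanFun.compl
      BooleanFun.bot BooleanFun.top

end OrderedOps

namespace OrderedOps

/-! ### Computable predicates and course-of-values recursion -/

section Computability

open Primrec

/-! If a universal sentence `∀ x, ψ` fails in a model `M` at a tuple `a`, the failure only involves
the entries of `a` and the values of the terms occurring in `ψ`. Their number is bounded in terms of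
the code of `ψ` and the length of `a`. So it suffices to carry every finite subset of a model of the
extended theory into a finite model of computably bounded size, by an injective map that respects
the relations in both directions and the operations wherever argument and value stay in the domain.
The universal consequences are then the universal sentences true in all nonempty models up to a
computable size. These models can be listed by codes, recognised and tested:
`universalConsequences_computable` and `universalConsequences_computable_of_partialEmbedding`.

The finite model is built in two stages. The new operations are first forgotten, and the finite
subset is placed in a finite complete lattice `N` that is a model of `T`. For theories of lattices,
`N` is the substructure generated by the subset: it is a model because `T` is universal, finite by
local finiteness, and complete because a finite nonempty lattice is complete. For posets, `N`
consists of the lower sets of the subset. For join (meet) semilattices, it consists of the upper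
(lower) sets of the finite subsemilattice that the subset generates.

Each new operation then becomes a partial operation on the embedded part and is extended to all of
`N` with its property preserved: `OpCond.exists_extension` and `LatOpCond.exists_extension`. Each
axiom concerns a single new operation, so the extensions can be chosen independently. Conditions
without monotonicity allow the identity at the undefined places. Monotone conditions are met by
suprema of the prescribed values from below, by infima of prescribed closed elements from above, or
by a combination, which is where completeness of `N` enters. A lower bound by a lattice term needs
an embedding that preserves joins and meets, available in the lattice cases.

For distributive lattices and Boolean algebras, local finiteness with bound `2 ^ 2 ^ m` holds
because a prime ideal is determined by the generators that it contains. -/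

lemma _root_.ComputablePred.and {α : Type*} [Primcodable α] {p q : α → Prop}
    (hp : ComputablePred p) (hq : ComputablePred q) : ComputablePred fun a => p a ∧ q a := by
  classical
  exact (Primrec.and.to_comp.comp hp.decide hq.decide |>.of_eq fun a => by simp).computablePred

lemma _root_.ComputablePred.comp {α β : Type*} [Primcodable α] [Primcodable β] {p : β → Prop}
    (hp : ComputablePred p) {f : α → β} (hf : Computable f) : ComputablePred fun a => p (f a) := by
  classical
  exact (hp.decide.comp hf).computablePred

lemma _root_.ComputablePred.imp {α : Type*} [Primcodable α] {p q : α → Prop}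
    (hp : ComputablePred p) (hq : ComputablePred q) : ComputablePred fun a => p a → q a :=
  (hp.and hq.not).not.of_eq fun a => by tauto

/-- Bounded search for predicates that are merely computable. The bound on model sizes and the
recognition of finite models are not assumed primitive recursive. -/
lemma _root_.ComputablePred.forall_le {α : Type*} [Primcodable α] {p : α → ℕ → Prop}
    (hp : ComputablePred fun x : α × ℕ => p x.1 x.2) {f : α → ℕ} (hf : Computable f) :
    ComputablePred fun a => ∀ n ≤ f a, p a n := by
  classical
  have h : Computable fun a => (Nat.rec true
      (fun n b => b && decide (p a n)) (f a + 1) : Bool) :=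
    Computable.nat_rec (Computable.succ.comp hf) (Computable.const true)
      (Primrec.and.to_comp.comp (Computable.snd.comp Computable.snd)
        (hp.decide.comp (Computable.pair Computable.fst
          (Computable.fst.comp Computable.snd)))).to₂
  refine (h.of_eq fun a => ?_).computablePred
  have (m : ℕ) : (Nat.rec true (fun n b => b && decide (p a n)) m : Bool) =
      decide (∀ n < m, p a n) := by
    induction m with
    | zero => simp
    | succ m ih =>
      simp only [ih, Nat.forall_lt_succ_right]
      simp
  exact (this (f a + 1)).trans (by simp)

lemma _root_.ComputablePred.exists_le {α : Type*} [Primcodable α] {p : α → ℕ → Prop}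
    (hp : ComputablePred fun x : α × ℕ => p x.1 x.2) {f : α → ℕ} (hf : Computable f) :
    ComputablePred fun a => ∃ n ≤ f a, p a n :=
  (ComputablePred.forall_le (p := fun a n => ¬ p a n) hp.not hf).not.of_eq fun a => by simp

lemma primrecPred_forall_mem {α β : Type*} [Primcodable α] [Primcodable β] {p : α → β → Prop}
    (hp : PrimrecPred fun x : α × β => p x.1 x.2) {f : α → List β} (hf : Primrec f) :
    PrimrecPred fun a => ∀ b ∈ f a, p a b := by
  have h : PrimrecRel fun (b : β) (a : α) => p a b :=
    hp.comp (Primrec.pair Primrec.snd Primrec.fst)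
  exact (h.forall_mem_list.comp hf Primrec.id)

lemma primrecPred_forall_le {α : Type*} [Primcodable α] {p : α → ℕ → Prop}
    (hp : PrimrecPred fun x : α × ℕ => p x.1 x.2) {f : α → ℕ} (hf : Primrec f) :
    PrimrecPred fun a => ∀ n ≤ f a, p a n :=
  (primrecPred_forall_mem hp (Primrec.list_range.comp (Primrec.succ.comp hf))).of_eq
    fun a => by simp

variable {α σ : Type*}

/-- The values at `0, …, n - 1` of the function defined by course-of-values recursion. -/
def histRec (g : α → List σ → σ) (a : α) : ℕ → List σ
  | 0 => []
  | n + 1 => histRec g a n ++ [g a (histRec g a n)]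

/-- Course-of-values recursion: the step function `g` gets the list of all previous values. -/
def strongRec (g : α → List σ → σ) (a : α) (n : ℕ) : σ := g a (histRec g a n)

lemma histRec_eq (g : α → List σ → σ) (a : α) (n : ℕ) :
    histRec g a n = (List.range n).map (strongRec g a) := by
  induction n with
  | zero => rfl
  | succ n ih =>
    rw [List.range_succ, List.map_append, ← ih]
    rfl

lemma histRec_length (g : α → List σ → σ) (a : α) (n : ℕ) : (histRec g a n).length = n := by
  simp [histRec_eq]

/-- A recursive call is a lookup in the history. It is legitimate only below `n`, so codes of
subexpressions must be smaller than the code of the expression. -/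
lemma histRec_getD (g : α → List σ → σ) (a : α) {n i : ℕ} (h : i < n) (d : σ) :
    (histRec g a n).getD i d = strongRec g a i := by
  simp [histRec_eq, h]

lemma primrec_strongRec [Primcodable α] [Primcodable σ] {g : α → List σ → σ} (hg : Primrec₂ g) :
    Primrec₂ (strongRec g) := by
  have h : Primrec₂ (histRec g) :=
    (Primrec.nat_rec (f := fun _ : α => ([] : List σ))
      (g := fun (a : α) (p : ℕ × List σ) => p.2 ++ [g a p.2]) (Primrec.const [])
      (Primrec.list_concat.comp (Primrec.snd.comp Primrec.snd)
        (hg.comp Primrec.fst (Primrec.snd.comp Primrec.snd))).to₂).of_eq fun a n => by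
      induction n with
      | zero => rfl
      | succ n ih => simp only [histRec, ← ih]
  exact hg.comp Primrec.fst h

end Computability

/-! ### Evaluation of coded terms and formulas in coded structures -/

/-- Codes of finite structures. -/
abbrev StructCode : Type := ℕ × List (List ℕ) × List (List ℕ)

/-- The number with the given digits, the first digit being the least significant one. -/
def ofDigitList (n : ℕ) (l : List ℕ) : ℕ := l.foldr (fun x a => x + n * a) 0

/-- The list with a given code number. -/
def argList (c : ℕ) : List ℕ := Denumerable.ofNat (List ℕ) c

section Steps

open Primrec

lemma primrec_ofDigitList : Primrec₂ ofDigitList :=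
  (Primrec.list_foldr (f := fun p : ℕ × List ℕ => p.2) (g := fun _ => 0)
    (h := fun (p : ℕ × List ℕ) (q : ℕ × ℕ) => q.1 + p.1 * q.2) Primrec.snd (Primrec.const 0)
    (Primrec.nat_add.comp (fst.comp snd)
      (Primrec.nat_mul.comp (fst.comp fst) (snd.comp snd))).to₂).to₂

lemma primrec_argList : Primrec argList := Primrec.ofNat (List ℕ)

lemma primrec_tag : Primrec fun n : ℕ => n.unpair.1 := fst.comp Primrec.unpair
lemma primrec_body : Primrec fun n : ℕ => n.unpair.2 := snd.comp Primrec.unpair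

/-- One step in the evaluation of a coded term. -/
def valTermStep (p : StructCode × List ℕ) (hist : List ℕ) : ℕ :=
  -- The history lists the values at all smaller numbers, so its length is the code being evaluated.
  -- Tag `0` is a variable and every other tag is read as an application; the values at non-codes
  -- are irrelevant.
  if hist.length.unpair.1 = 0 then p.2.getD hist.length.unpair.2 0
  else (p.1.2.1.getD hist.length.unpair.2.unpair.1 []).getD
    (ofDigitList p.1.1
      ((argList hist.length.unpair.2.unpair.2).map fun c => hist.getD c 0)) 0

lemma primrec_valTermStep : Primrec₂ valTermStep := by
  have hl : Primrec fun x : (StructCode × List ℕ) × List ℕ => x.2.length :=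
    Primrec.list_length.comp snd
  have hb := primrec_body.comp hl
  refine Primrec.ite (Primrec.eq.comp (primrec_tag.comp hl) (Primrec.const 0))
    ((Primrec.list_getD 0).comp (snd.comp fst) hb)
    ((Primrec.list_getD 0).comp ((Primrec.list_getD []).comp
      (fst.comp (snd.comp (fst.comp fst))) (primrec_tag.comp hb))
      (primrec_ofDigitList.comp (fst.comp (fst.comp fst))
        (Primrec.list_map (primrec_argList.comp (primrec_body.comp hb)) ?_)))
  exact ((Primrec.list_getD 0).comp (snd.comp fst) snd).to₂

/-- The value of a coded term in a coded structure, under an assignment. -/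
def valTerm : StructCode × List ℕ → ℕ → ℕ := strongRec valTermStep

lemma primrec_valTerm : Primrec₂ valTerm := primrec_strongRec primrec_valTermStep

/-- One step in the evaluation of a coded quantifier-free formula. -/
def valFormStep (p : StructCode × List ℕ) (hist : List Bool) : Bool :=
  if hist.length.unpair.1 = 0 then false
  else if hist.length.unpair.1 = 1 then
    decide (valTerm p hist.length.unpair.2.unpair.1 = valTerm p hist.length.unpair.2.unpair.2)
  else if hist.length.unpair.1 = 2 then
    decide ((p.1.2.2.getD hist.length.unpair.2.unpair.1 []).getD
      (ofDigitList p.1.1 ((argList hist.length.unpair.2.unpair.2).map (valTerm p))) 0 = 1)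
  else !hist.getD hist.length.unpair.2.unpair.1 false ||
    hist.getD hist.length.unpair.2.unpair.2 false

lemma primrec_valFormStep : Primrec₂ valFormStep := by
  have hl : Primrec fun x : (StructCode × List ℕ) × List Bool => x.2.length :=
    Primrec.list_length.comp snd
  have hb := primrec_body.comp hl
  have ht (i : ℕ) : PrimrecPred fun x : (StructCode × List ℕ) × List Bool =>
      x.2.length.unpair.1 = i :=
    Primrec.eq.comp (primrec_tag.comp hl) (Primrec.const i)
  have hv : Primrec₂ valTerm := primrec_valTerm
  refine Primrec.ite (ht 0) (Primrec.const false) (Primrec.ite (ht 1) ?_ (Primrec.ite (ht 2) ?_ ?_))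
  · exact (Primrec.eq.comp (hv.comp fst (primrec_tag.comp hb))
      (hv.comp fst (primrec_body.comp hb))).decide
  · refine (Primrec.eq.comp ((Primrec.list_getD 0).comp ((Primrec.list_getD []).comp
      (snd.comp (snd.comp (fst.comp fst))) (primrec_tag.comp hb))
      (primrec_ofDigitList.comp (fst.comp (fst.comp fst))
        (Primrec.list_map (primrec_argList.comp (primrec_body.comp hb)) ?_)))
      (Primrec.const 1)).decide
    exact (hv.comp (fst.comp fst) snd).to₂
  · exact Primrec.or.comp
      (Primrec.not.comp ((Primrec.list_getD false).comp snd (primrec_tag.comp hb)))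
      ((Primrec.list_getD false).comp snd (primrec_body.comp hb))

/-- The truth value of a coded quantifier-free formula in a coded structure, under an
assignment. -/
def valForm : StructCode × List ℕ → ℕ → Bool := strongRec valFormStep

lemma primrec_valForm : Primrec₂ valForm := primrec_strongRec primrec_valFormStep

/-- One step in the recognition of codes of terms in `r` variables, where `ar` lists the arities
of the operation symbols. -/
def wfTermStep (ar : List ℕ) (r : ℕ) (hist : List Bool) : Bool :=
  if hist.length.unpair.1 = 0 then decide (hist.length.unpair.2 < r)
  else decide (hist.length.unpair.1 = 1 ∧ hist.length.unpair.2.unpair.1 < ar.length ∧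
    (argList hist.length.unpair.2.unpair.2).length = ar.getD hist.length.unpair.2.unpair.1 0 ∧
    ∀ c ∈ argList hist.length.unpair.2.unpair.2, hist.getD c false = true)

lemma primrec_wfTermStep (ar : List ℕ) : Primrec₂ (wfTermStep ar) := by
  have hl : Primrec fun x : ℕ × List Bool => x.2.length := Primrec.list_length.comp snd
  have hb := primrec_body.comp hl
  have ht (i : ℕ) : PrimrecPred fun x : ℕ × List Bool => x.2.length.unpair.1 = i :=
    Primrec.eq.comp (primrec_tag.comp hl) (Primrec.const i)
  have ha := primrec_argList.comp (primrec_body.comp hb)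
  refine Primrec.ite (ht 0) (Primrec.nat_lt.comp hb fst).decide (PrimrecPred.decide ?_)
  refine (ht 1).and (.and (Primrec.nat_lt.comp (primrec_tag.comp hb) (Primrec.const _))
    (.and (Primrec.eq.comp (Primrec.list_length.comp ha)
      ((Primrec.list_getD 0).comp (Primrec.const _) (primrec_tag.comp hb)))
      (primrecPred_forall_mem ?_ ha)))
  exact Primrec.eq.comp ((Primrec.list_getD false).comp (snd.comp fst) snd) (Primrec.const true)

/-- Recognition of codes of terms. -/
def wfTerm (ar : List ℕ) : ℕ → ℕ → Bool := strongRec (wfTermStep ar)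

lemma primrec_wfTerm (ar : List ℕ) : Primrec₂ (wfTerm ar) :=
  primrec_strongRec (primrec_wfTermStep ar)

/-- One step in the recognition of codes of quantifier-free formulas in `r` variables, where `ar`
and `arR` list the arities of the operation and relation symbols. -/
def wfFormStep (ar arR : List ℕ) (r : ℕ) (hist : List Bool) : Bool :=
  -- Recognition has to be exact: falsum has only the code `Nat.pair 0 0`, and the tag `4` of a
  -- quantifier is rejected.
  if hist.length.unpair.1 = 0 then decide (hist.length.unpair.2 = 0)
  else if hist.length.unpair.1 = 1 then
    wfTerm ar r hist.length.unpair.2.unpair.1 && wfTerm ar r hist.length.unpair.2.unpair.2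
  else if hist.length.unpair.1 = 2 then
    decide (hist.length.unpair.2.unpair.1 < arR.length ∧
    (argList hist.length.unpair.2.unpair.2).length = arR.getD hist.length.unpair.2.unpair.1 0 ∧
    ∀ c ∈ argList hist.length.unpair.2.unpair.2, wfTerm ar r c = true)
  else if hist.length.unpair.1 = 3 then
    hist.getD hist.length.unpair.2.unpair.1 false && hist.getD hist.length.unpair.2.unpair.2 false
  else false

lemma primrec_wfFormStep (ar arR : List ℕ) : Primrec₂ (wfFormStep ar arR) := by
  have hl : Primrec fun x : ℕ × List Bool => x.2.length := Primrec.list_length.comp snd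
  have hb := primrec_body.comp hl
  have ht (i : ℕ) : PrimrecPred fun x : ℕ × List Bool => x.2.length.unpair.1 = i :=
    Primrec.eq.comp (primrec_tag.comp hl) (Primrec.const i)
  have ha := primrec_argList.comp (primrec_body.comp hb)
  have hv := primrec_wfTerm ar
  refine Primrec.ite (ht 0) (Primrec.eq.comp hb (Primrec.const 0)).decide
    (Primrec.ite (ht 1) ?_ (Primrec.ite (ht 2) (PrimrecPred.decide ?_)
      (Primrec.ite (ht 3) ?_ (Primrec.const false))))
  · exact Primrec.and.comp (hv.comp fst (primrec_tag.comp hb)) (hv.comp fst (primrec_body.comp hb))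
  · refine .and (Primrec.nat_lt.comp (primrec_tag.comp hb) (Primrec.const _))
      (.and (Primrec.eq.comp (Primrec.list_length.comp ha)
        ((Primrec.list_getD 0).comp (Primrec.const _) (primrec_tag.comp hb)))
        (primrecPred_forall_mem ?_ ha))
    exact Primrec.eq.comp (hv.comp (fst.comp fst) snd) (Primrec.const true)
  · exact Primrec.and.comp ((Primrec.list_getD false).comp snd (primrec_tag.comp hb))
      ((Primrec.list_getD false).comp snd (primrec_body.comp hb))

/-- Recognition of codes of quantifier-free formulas. -/
def wfForm (ar arR : List ℕ) : ℕ → ℕ → Bool := strongRec (wfFormStep ar arR)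

lemma primrec_wfForm (ar arR : List ℕ) : Primrec₂ (wfForm ar arR) :=
  primrec_strongRec (primrec_wfFormStep ar arR)

end Steps

/-! ### Correctness of the evaluation and recognition of codes -/

section Correctness

open BoundedFormula

lemma argList_encode (l : List ℕ) : argList (Encodable.encode l) = l :=
  Denumerable.ofNat_encode l

lemma encode_argList (c : ℕ) : Encodable.encode (argList c) = c :=
  Denumerable.encode_ofNat c

/-- The code of a nonempty list is the successor of a pairing of its head and the code of its tail.
This strict inequality makes the course-of-values recursion over argument lists well founded. -/
lemma mem_lt_encode {l : List ℕ} {c : ℕ} (h : c ∈ l) : c < Encodable.encode l := by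
  induction l with
  | nil => simp at h
  | cons a l ih =>
    rw [Encodable.encode_list_cons, Nat.lt_succ_iff]
    have := Nat.add_le_pair (Encodable.encode a) (Encodable.encode l)
    rcases List.mem_cons.1 h with rfl | h
    · rw [Encodable.encode_nat] at *; omega
    · have := ih h; omega

lemma mem_argList_lt {e c : ℕ} (h : c ∈ argList e) : c < e := by
  simpa [encode_argList] using mem_lt_encode h

lemma lt_pair_right {a b c : ℕ} (ha : 0 < a) (h : c ≤ b) : c < Nat.pair a b := by
  have := Nat.add_le_pair a b
  omega

lemma lt_pair_of_mem_argList {a s e c : ℕ} (h : c ∈ argList e) :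
    c < Nat.pair a (Nat.pair s e) :=
  (mem_argList_lt h).trans_le ((Nat.right_le_pair _ _).trans (Nat.right_le_pair _ _))

/-- The index computed from an argument list is the one under which `structureCode` stores the
value. -/
lemma ofDigitList_ofFn {n k : ℕ} (x : Fin k → Fin n) :
    ofDigitList n (List.ofFn fun i => (x i : ℕ)) = finFunctionFinEquiv x := by
  rw [finFunctionFinEquiv_apply]
  induction k with
  | zero => simp [ofDigitList]
  | succ k ih =>
    rw [List.ofFn_succ, Fin.sum_univ_succ]
    have := ih (fun i => x i.succ)
    simp only [ofDigitList] at this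
    simp only [ofDigitList, List.foldr_cons, this, Finset.mul_sum]
    simp [pow_succ]
    exact Finset.sum_congr rfl fun i _ => by ring

lemma valTerm_var (p : StructCode × List ℕ) (v : ℕ) :
    valTerm p (Nat.pair 0 v) = p.2.getD v 0 := by
  rw [valTerm, strongRec, valTermStep, histRec_length]
  simp

lemma valTerm_func (p : StructCode × List ℕ) (s e : ℕ) :
    valTerm p (Nat.pair 1 (Nat.pair s e)) =
      (p.1.2.1.getD s []).getD (ofDigitList p.1.1 ((argList e).map (valTerm p))) 0 := by
  rw [valTerm, strongRec, valTermStep, histRec_length]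
  simp only [Nat.unpair_pair, one_ne_zero, if_false]
  congr 2
  refine List.map_congr_left fun c hc => ?_
  rw [histRec_getD _ _ (lt_pair_of_mem_argList hc)]

lemma wfTerm_pair (ar : List ℕ) (r i z : ℕ) :
    wfTerm ar r (Nat.pair i z) = true ↔ (i = 0 ∧ z < r) ∨ (i = 1 ∧ z.unpair.1 < ar.length ∧
      (argList z.unpair.2).length = ar.getD z.unpair.1 0 ∧
      ∀ c ∈ argList z.unpair.2, wfTerm ar r c = true) := by
  rw [wfTerm, strongRec, wfTermStep, histRec_length]
  simp only [Nat.unpair_pair]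
  by_cases hi : i = 0
  · simp [hi]
  · simp only [hi, if_false, false_and, false_or, decide_eq_true_eq]
    refine and_congr_right fun h1 => and_congr_right fun _ => and_congr_right fun _ =>
      forall₂_congr fun c hc => ?_
    rw [histRec_getD]
    have := lt_pair_of_mem_argList (a := i) (s := z.unpair.1) hc
    rwa [Nat.pair_unpair] at this

lemma valForm_falsum (p : StructCode × List ℕ) (z : ℕ) : valForm p (Nat.pair 0 z) = false := by
  rw [valForm, strongRec, valFormStep, histRec_length]
  simp

lemma valForm_equal (p : StructCode × List ℕ) (s t : ℕ) :
    valForm p (Nat.pair 1 (Nat.pair s t)) = decide (valTerm p s = valTerm p t) := by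
  rw [valForm, strongRec, valFormStep, histRec_length]
  simp

lemma valForm_rel (p : StructCode × List ℕ) (s e : ℕ) :
    valForm p (Nat.pair 2 (Nat.pair s e)) = decide
      ((p.1.2.2.getD s []).getD (ofDigitList p.1.1 ((argList e).map (valTerm p))) 0 = 1) := by
  rw [valForm, strongRec, valFormStep, histRec_length]
  simp

lemma valForm_imp (p : StructCode × List ℕ) (s t : ℕ) :
    valForm p (Nat.pair 3 (Nat.pair s t)) = (!valForm p s || valForm p t) := by
  rw [valForm, strongRec, valFormStep, histRec_length,
    histRec_getD _ _ (lt_pair_right (by simp) (by simpa using Nat.left_le_pair s t)),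
    histRec_getD _ _ (lt_pair_right (by simp) (by simpa using Nat.right_le_pair s t))]
  simp

lemma wfForm_pair (ar arR : List ℕ) (r i z : ℕ) :
    wfForm ar arR r (Nat.pair i z) = true ↔ (i = 0 ∧ z = 0) ∨
      (i = 1 ∧ wfTerm ar r z.unpair.1 = true ∧ wfTerm ar r z.unpair.2 = true) ∨
      (i = 2 ∧ z.unpair.1 < arR.length ∧ (argList z.unpair.2).length = arR.getD z.unpair.1 0 ∧
        ∀ c ∈ argList z.unpair.2, wfTerm ar r c = true) ∨
      (i = 3 ∧ wfForm ar arR r z.unpair.1 = true ∧ wfForm ar arR r z.unpair.2 = true) := by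
  rw [wfForm, strongRec, wfFormStep, histRec_length]
  simp only [Nat.unpair_pair]
  by_cases h0 : i = 0
  · simp [h0]
  by_cases h1 : i = 1
  · simp [h1]
  by_cases h2 : i = 2
  · simp [h2]
  by_cases h3 : i = 3
  · subst h3
    rw [histRec_getD _ _ (lt_pair_right (by simp) (Nat.unpair_left_le z)),
      histRec_getD _ _ (lt_pair_right (by simp) (Nat.unpair_right_le z))]
    simp
  · simp [h0, h1, h2, h3]

variable {L : FirstOrder.Language.{0, 0}} (ν : SymbolNumbering L)

/-- The arities of the operation symbols. -/
def SymbolNumbering.funArities : List ℕ := List.ofFn fun s => (ν.funs.symm s).1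

/-- The arities of the relation symbols. -/
def SymbolNumbering.relArities : List ℕ := List.ofFn fun s => (ν.rels.symm s).1

/-- The value table of an operation. -/
def funTable (n : ℕ) (S : L.Structure (Fin n)) (f : Σ k, L.Functions k) : List ℕ :=
  List.ofFn fun t : Fin (n ^ f.1) => ((S.funMap f.2 (finFunctionFinEquiv.symm t) : Fin n) : ℕ)

open Classical in
/-- The 0-1 table of a relation. -/
noncomputable def relTable (n : ℕ) (S : L.Structure (Fin n)) (R : Σ k, L.Relations k) : List ℕ :=
  List.ofFn fun t : Fin (n ^ R.1) => if S.RelMap R.2 (finFunctionFinEquiv.symm t) then 1 else 0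

lemma ofFn_getD {α : Type*} {k : ℕ} (f : Fin k → α) (i : Fin k) (d : α) :
    (List.ofFn f).getD i d = f i := by
  simp

lemma structureCode_eq (n : ℕ) (S : L.Structure (Fin n)) : ν.structureCode n S =
    (n, List.ofFn fun s => funTable n S (ν.funs.symm s),
      List.ofFn fun s => relTable n S (ν.rels.symm s)) := rfl

lemma structureCode_fun (n : ℕ) (S : L.Structure (Fin n)) (f : Σ k, L.Functions k) :
    (ν.structureCode n S).2.1.getD (ν.funs f) [] = funTable n S f := by
  simp [structureCode_eq]

lemma structureCode_rel (n : ℕ) (S : L.Structure (Fin n)) (R : Σ k, L.Relations k) :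
    (ν.structureCode n S).2.2.getD (ν.rels R) [] = relTable n S R := by
  simp [structureCode_eq]

lemma funTable_getD (n : ℕ) (S : L.Structure (Fin n)) {k : ℕ} (f : L.Functions k)
    (x : Fin k → Fin n) :
    (funTable n S ⟨k, f⟩).getD (ofDigitList n (List.ofFn fun i => (x i : ℕ))) 0 =
      S.funMap f x := by
  rw [ofDigitList_ofFn, funTable, ofFn_getD, Equiv.symm_apply_apply]

open Classical in
lemma relTable_getD (n : ℕ) (S : L.Structure (Fin n)) {k : ℕ} (R : L.Relations k)
    (x : Fin k → Fin n) :
    (relTable n S ⟨k, R⟩).getD (ofDigitList n (List.ofFn fun i => (x i : ℕ))) 0 =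
      if S.RelMap R x then 1 else 0 := by
  rw [ofDigitList_ofFn, relTable, ofFn_getD, Equiv.symm_apply_apply]

lemma valTerm_termCode (n : ℕ) [S : L.Structure (Fin n)] {r : ℕ} (v : Empty → Fin n)
    (a : Fin r → Fin n) (t : L.Term (Empty ⊕ Fin r)) :
    valTerm (ν.structureCode n S, List.ofFn fun i => (a i : ℕ)) (ν.termCode varCode t) =
      (t.realize (Sum.elim v a) : Fin n) := by
  induction t with
  | var x =>
    rcases x with x | i
    · exact x.elim
    · rw [SymbolNumbering.termCode, valTerm_var]
      simp [varCode]
  | func f ts ih =>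
    rw [SymbolNumbering.termCode, valTerm_func, argList_encode, structureCode_fun,
      List.map_ofFn]
    simp only [Function.comp_def, ih]
    exact funTable_getD n S f fun i => (ts i).realize (Sum.elim v a)

open Classical in
lemma valForm_formulaCode (n : ℕ) [S : L.Structure (Fin n)] {r : ℕ} (v : Empty → Fin n)
    (a : Fin r → Fin n) {φ : L.BoundedFormula Empty r} (h : φ.IsQF) :
    valForm (ν.structureCode n S, List.ofFn fun i => (a i : ℕ)) (ν.formulaCode φ) =
      decide (φ.Realize v a) := by
  induction h with
  | falsum => exact (valForm_falsum _ _).trans (by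
    rw [eq_comm, decide_eq_false_iff_not]; exact fun h => h)
  | of_isAtomic h =>
    cases h with
    | equal t₁ t₂ =>
      refine (valForm_equal _ _ _).trans ?_
      rw [valTerm_termCode ν n v, valTerm_termCode ν n v]
      simp [Fin.ext_iff]
    | rel R ts =>
      refine (valForm_rel _ _ _).trans ?_
      rw [argList_encode, structureCode_rel, List.map_ofFn]
      simp only [Function.comp_def, valTerm_termCode ν n v]
      have := relTable_getD n S R fun i => (ts i).realize (Sum.elim v a)
      rw [structureCode_eq]
      dsimp only
      rw [this]
      by_cases hR : S.RelMap R fun i => (ts i).realize (Sum.elim v a) <;> simp [hR]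
  | imp _ _ ih₁ ih₂ =>
    refine (valForm_imp _ _ _).trans ?_
    rw [ih₁, ih₂]
    simp [BoundedFormula.realize_imp, imp_iff_not_or]

lemma funArities_length : ν.funArities.length = ν.numFun := by simp [SymbolNumbering.funArities]

lemma relArities_length : ν.relArities.length = ν.numRel := by simp [SymbolNumbering.relArities]

lemma funArities_getD (s : Fin ν.numFun) : ν.funArities.getD s 0 = (ν.funs.symm s).1 := by
  simp [SymbolNumbering.funArities]

lemma relArities_getD (s : Fin ν.numRel) : ν.relArities.getD s 0 = (ν.rels.symm s).1 := by
  simp [SymbolNumbering.relArities]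

lemma wfTerm_termCode {r : ℕ} (t : L.Term (Empty ⊕ Fin r)) :
    wfTerm ν.funArities r (ν.termCode varCode t) = true := by
  induction t with
  | var x =>
    rcases x with x | i
    · exact x.elim
    · rw [SymbolNumbering.termCode, wfTerm_pair]
      simp [varCode]
  | func f ts ih =>
    rw [SymbolNumbering.termCode, wfTerm_pair]
    refine Or.inr ⟨rfl, ?_⟩
    simp only [Nat.unpair_pair, argList_encode, List.length_ofFn, funArities_getD,
      funArities_length]
    refine ⟨Fin.is_lt _, by simp, fun c hc => ?_⟩
    obtain ⟨i, rfl⟩ := (List.mem_ofFn' _ _).1 hc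
    exact ih i

lemma exists_args {α : Type} {P : ℕ → α → Prop} {l : List ℕ} {k : ℕ} (hl : l.length = k)
    (h : ∀ c ∈ l, ∃ t, P c t) : ∃ (c : Fin k → ℕ) (t : Fin k → α), l = List.ofFn c ∧
      ∀ i, P (c i) (t i) := by
  subst hl
  choose t ht using fun i : Fin l.length => h (l.get i) (List.get_mem l i)
  exact ⟨l.get, t, by simp, ht⟩

/-- Decoding by strong induction on the code. Together with `wfTerm_termCode` it shows that the
accepted numbers are precisely the codes of terms. -/
lemma exists_termCode {r : ℕ} (d : ℕ) (h : wfTerm ν.funArities r d = true) :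
    ∃ t : L.Term (Empty ⊕ Fin r), ν.termCode varCode t = d := by
  induction d using Nat.strong_induction_on with
  | _ d ih =>
    rw [← Nat.pair_unpair d, wfTerm_pair] at h
    rcases h with ⟨h0, h1⟩ | ⟨h0, h1, h2, h3⟩
    · exact ⟨.var (Sum.inr ⟨_, h1⟩), by
        rw [SymbolNumbering.termCode, varCode, Sum.elim_inr, ← h0, Nat.pair_unpair]⟩
    · rw [funArities_length] at h1
      rw [funArities_getD ν ⟨_, h1⟩] at h2
      obtain ⟨e, t, he, ht⟩ := exists_args h2 fun c hc => ih c (by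
        have := mem_argList_lt hc
        have hz := Nat.unpair_add_le d
        have hz' := Nat.unpair_add_le d.unpair.2
        omega) (h3 c hc)
      refine ⟨.func (ν.funs.symm ⟨_, h1⟩).2 t, ?_⟩
      rw [SymbolNumbering.termCode]
      simp only [ht, ← he, encode_argList, Sigma.eta, Equiv.apply_symm_apply, Nat.pair_unpair]
      rw [← h0, Nat.pair_unpair]

lemma wfForm_formulaCode {r : ℕ} {φ : L.BoundedFormula Empty r} (h : φ.IsQF) :
    wfForm ν.funArities ν.relArities r (ν.formulaCode φ) = true := by
  induction h with
  | falsum => exact (wfForm_pair _ _ _ _ _).2 (by simp)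
  | of_isAtomic h =>
    cases h with
    | equal t₁ t₂ =>
      exact (wfForm_pair _ _ _ _ _).2 (by simp [wfTerm_termCode])
    | rel R ts =>
      refine (wfForm_pair _ _ _ _ _).2 (Or.inr (Or.inr (Or.inl ⟨rfl, ?_⟩)))
      simp only [Nat.unpair_pair, argList_encode, List.length_ofFn, relArities_getD,
        relArities_length]
      refine ⟨Fin.is_lt _, by simp, fun c hc => ?_⟩
      obtain ⟨i, rfl⟩ := (List.mem_ofFn' _ _).1 hc
      exact wfTerm_termCode ν _
  | imp _ _ ih₁ ih₂ => exact (wfForm_pair _ _ _ _ _).2 (by simp [ih₁, ih₂])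

lemma exists_formulaCode {r : ℕ} (c : ℕ) (h : wfForm ν.funArities ν.relArities r c = true) :
    ∃ φ : L.BoundedFormula Empty r, φ.IsQF ∧ ν.formulaCode φ = c := by
  induction c using Nat.strong_induction_on with
  | _ c ih =>
    rw [← Nat.pair_unpair c, wfForm_pair] at h
    have hz := Nat.unpair_add_le c
    have hz' := Nat.unpair_add_le c.unpair.2
    rcases h with ⟨h0, h1⟩ | ⟨h0, h1, h2⟩ | ⟨h0, h1, h2, h3⟩ | ⟨h0, h1, h2⟩
    · refine ⟨.falsum, .falsum, ?_⟩
      rw [← Nat.pair_unpair c, h0, h1]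
      rfl
    · obtain ⟨t₁, ht₁⟩ := exists_termCode ν _ h1
      obtain ⟨t₂, ht₂⟩ := exists_termCode ν _ h2
      refine ⟨.equal t₁ t₂, .of_isAtomic (.equal _ _), ?_⟩
      rw [SymbolNumbering.formulaCode, ht₁, ht₂, Nat.pair_unpair, ← h0, Nat.pair_unpair]
    · rw [relArities_length] at h1
      rw [relArities_getD ν ⟨_, h1⟩] at h2
      obtain ⟨d, t, hd, ht⟩ := exists_args h2 fun c hc => exists_termCode ν c (h3 c hc)
      refine ⟨.rel (ν.rels.symm ⟨_, h1⟩).2 t, .of_isAtomic (.rel _ _), ?_⟩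
      rw [SymbolNumbering.formulaCode]
      simp only [ht, ← hd, encode_argList, Sigma.eta, Equiv.apply_symm_apply, Nat.pair_unpair]
      rw [← h0, Nat.pair_unpair]
    · obtain ⟨φ, hφ, hφc⟩ := ih _ (by omega) h1
      obtain ⟨ψ, hψ, hψc⟩ := ih _ (by omega) h2
      refine ⟨φ.imp ψ, hφ.imp hψ, ?_⟩
      rw [SymbolNumbering.formulaCode, hφc, hψc, Nat.pair_unpair, ← h0, Nat.pair_unpair]

end Correctness

/-! ### Bounds for codes, so that searches over lists become bounded searches -/

section BoundedCodes

open Primrec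

lemma pair_le_pair {a b c d : ℕ} (h₁ : a ≤ c) (h₂ : b ≤ d) : Nat.pair a b ≤ Nat.pair c d := by
  have h₃ : Nat.pair a b ≤ Nat.pair c b := by
    rcases h₁.eq_or_lt with rfl | h
    exacts [le_rfl, (Nat.pair_lt_pair_left b h).le]
  have h₄ : Nat.pair c b ≤ Nat.pair c d := by
    rcases h₂.eq_or_lt with rfl | h
    exacts [le_rfl, (Nat.pair_lt_pair_right c h).le]
  exact h₃.trans h₄

/-- An upper bound for the codes of lists of length at most `r` with entries coded by numbers up
to `b`. -/
def listBound (r b : ℕ) : ℕ := Encodable.encode ((List.range r).map fun _ => b)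

lemma primrec_listBound : Primrec₂ listBound :=
  Primrec.encode.comp (Primrec.list_map (Primrec.list_range.comp fst) (snd.comp fst).to₂)

/-- Pairing is monotone in both arguments, so raising every entry to `b` and padding the list to
length `r` can only increase the code. -/
lemma encode_le_listBound {α : Type*} [Encodable α] {l : List α} {r b : ℕ} (hl : l.length ≤ r)
    (hb : ∀ a ∈ l, Encodable.encode a ≤ b) : Encodable.encode l ≤ listBound r b := by
  rw [listBound, List.map_const', List.length_range]
  induction l generalizing r with
  | nil => simp
  | cons a l ih =>
    obtain _ | r := r
    · simp at hl
    · rw [List.replicate_succ, Encodable.encode_list_cons, Encodable.encode_list_cons]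
      exact Nat.succ_le_succ (pair_le_pair (hb a (by simp))
        (ih (by simpa using hl) fun a ha => hb a (by simp [ha])))

/-- A coded formula in `r` variables is true in a coded structure under all assignments. -/
def HoldsAll (S : StructCode) (r d : ℕ) : Prop :=
  -- Every assignment has a code below `listBound r S.1`; the other numbers in this range are
  -- filtered out by the length and size conditions.
  ∀ x ≤ listBound r S.1, (argList x).length = r ∧ (∀ b ∈ argList x, b < S.1) →
    valForm (S, argList x) d = true

lemma primrec_holdsAll : PrimrecPred fun p : StructCode × ℕ × ℕ => HoldsAll p.1 p.2.1 p.2.2 := by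
  have ha : Primrec fun q : (StructCode × ℕ × ℕ) × ℕ => argList q.2 := primrec_argList.comp snd
  have h₁ : PrimrecPred fun q : (StructCode × ℕ × ℕ) × ℕ => (argList q.2).length = q.1.2.1 :=
    Primrec.eq.comp (Primrec.list_length.comp ha) (fst.comp (snd.comp fst))
  have h₂ : PrimrecPred fun q : (StructCode × ℕ × ℕ) × ℕ => ∀ b ∈ argList q.2, b < q.1.1.1 :=
    primrecPred_forall_mem (p := fun (q : (StructCode × ℕ × ℕ) × ℕ) b => b < q.1.1.1)
      (Primrec.nat_lt.comp snd (fst.comp (fst.comp (fst.comp fst)))) ha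
  have h₃ : PrimrecPred fun q : (StructCode × ℕ × ℕ) × ℕ =>
      valForm (q.1.1, argList q.2) q.1.2.2 = true :=
    Primrec.eq.comp (primrec_valForm.comp (Primrec.pair (fst.comp fst) ha)
      (snd.comp (snd.comp fst))) (Primrec.const true)
  have h : PrimrecPred fun q : (StructCode × ℕ × ℕ) × ℕ =>
      ((argList q.2).length = q.1.2.1 ∧ ∀ b ∈ argList q.2, b < q.1.1.1) →
        valForm (q.1.1, argList q.2) q.1.2.2 = true :=
    ((h₁.and h₂).not.or h₃).of_eq fun q => imp_iff_not_or.symm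
  exact primrecPred_forall_le (p := fun (p : StructCode × ℕ × ℕ) (x : ℕ) =>
    ((argList x).length = p.2.1 ∧ ∀ b ∈ argList x, b < p.1.1) →
    valForm (p.1, argList x) p.2.2 = true) h
    (primrec_listBound.comp (fst.comp snd) (fst.comp fst))

/-- A list of tables of the right sizes for symbols of arities `ar`, with entries below `b`. -/
def ValidTables (ar : List ℕ) (n b : ℕ) (l : List (List ℕ)) : Prop :=
  l.length = ar.length ∧ ∀ s ∈ List.range ar.length,
    (l.getD s []).length = n ^ ar.getD s 0 ∧ ∀ x ∈ l.getD s [], x < b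

lemma primrec_pow : Primrec₂ fun m n : ℕ => m ^ n :=
  Primrec₂.unpaired'.1 Nat.Primrec.pow

lemma primrec_validTables (ar : List ℕ) :
    PrimrecPred fun p : ℕ × ℕ × List (List ℕ) => ValidTables ar p.1 p.2.1 p.2.2 := by
  refine .and (Primrec.eq.comp (Primrec.list_length.comp (snd.comp snd)) (Primrec.const _))
    (primrecPred_forall_mem (p := fun (p : ℕ × ℕ × List (List ℕ)) s =>
      (p.2.2.getD s []).length = p.1 ^ ar.getD s 0 ∧ ∀ x ∈ p.2.2.getD s [], x < p.2.1) ?_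
      (Primrec.const _))
  have hl : Primrec fun q : (ℕ × ℕ × List (List ℕ)) × ℕ => q.1.2.2.getD q.2 [] :=
    (Primrec.list_getD []).comp (snd.comp (snd.comp fst)) snd
  exact .and (Primrec.eq.comp (Primrec.list_length.comp hl) (primrec_pow.comp (fst.comp fst)
      ((Primrec.list_getD 0).comp (Primrec.const _) snd)))
    (primrecPred_forall_mem (p := fun (q : (ℕ × ℕ × List (List ℕ)) × ℕ) x => x < q.1.2.1)
      (Primrec.nat_lt.comp snd (fst.comp (snd.comp (fst.comp fst)))) hl)

lemma ValidTables.encode_le {ar : List ℕ} {n b A : ℕ} {l : List (List ℕ)}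
    (h : ValidTables ar n b l) (hn : 0 < n) (hA : ar.sum ≤ A) :
    Encodable.encode l ≤ listBound ar.length (listBound (n ^ A) b) := by
  refine encode_le_listBound h.1.le fun t ht => ?_
  obtain ⟨s, hs, rfl⟩ := List.mem_iff_getElem.1 ht
  obtain ⟨h₁, h₂⟩ := h.2 s (by simpa [← h.1] using hs)
  have hs' : s < ar.length := h.1 ▸ hs
  simp only [List.getD_eq_getElem?_getD, List.getElem?_eq_getElem hs, Option.getD_some,
    List.getElem?_eq_getElem hs'] at h₁ h₂
  refine encode_le_listBound (h₁.le.trans (Nat.pow_le_pow_right hn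
    ((List.le_sum_of_mem (List.getElem_mem hs')).trans hA))) fun x hx => ?_
  exact (h₂ x hx).le

end BoundedCodes

/-! ### Codes of finite structures -/

section Structures

variable {L : FirstOrder.Language.{0, 0}} (ν : SymbolNumbering L)

lemma ofFn_eq_of_getD {α : Type*} {k : ℕ} {f : Fin k → α} {l : List α} (hl : l.length = k) {d : α}
    (h : ∀ i : Fin k, l.getD i d = f i) : List.ofFn f = l := by
  subst hl
  refine List.ext_getElem (by simp) fun i h₁ h₂ => ?_
  rw [List.getElem_ofFn, ← h, List.getD_eq_getElem _ _ h₂]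

lemma validTables_funs (n : ℕ) (S : L.Structure (Fin n)) :
    ValidTables ν.funArities n n (ν.structureCode n S).2.1 := by
  refine ⟨by simp [structureCode_eq, funArities_length], fun s hs => ?_⟩
  rw [funArities_length, List.mem_range] at hs
  have h₁ := structureCode_fun ν n S (ν.funs.symm ⟨s, hs⟩)
  have h₂ := funArities_getD ν ⟨s, hs⟩
  rw [Equiv.apply_symm_apply] at h₁
  rw [h₁, h₂]
  refine ⟨by simp [funTable], fun x hx => ?_⟩
  obtain ⟨i, rfl⟩ := (List.mem_ofFn' _ _).1 hx
  exact Fin.is_lt _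

lemma validTables_rels (n : ℕ) (S : L.Structure (Fin n)) :
    ValidTables ν.relArities n 2 (ν.structureCode n S).2.2 := by
  classical
  refine ⟨by simp [structureCode_eq, relArities_length], fun s hs => ?_⟩
  rw [relArities_length, List.mem_range] at hs
  have h₁ := structureCode_rel ν n S (ν.rels.symm ⟨s, hs⟩)
  have h₂ := relArities_getD ν ⟨s, hs⟩
  rw [Equiv.apply_symm_apply] at h₁
  rw [h₁, h₂]
  refine ⟨by simp [relTable], fun x hx => ?_⟩
  obtain ⟨i, rfl⟩ := (List.mem_ofFn' _ _).1 hx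
  dsimp only
  split_ifs <;> simp

/-- Tables of the right lengths with entries in the right range can be read back as operations and
relations, so being a code is a primitive recursive condition. -/
lemma exists_structureCode_iff (w : StructCode) :
    (∃ n, ∃ S : L.Structure (Fin n), ν.structureCode n S = w) ↔
      ValidTables ν.funArities w.1 w.1 w.2.1 ∧ ValidTables ν.relArities w.1 2 w.2.2 := by
  classical
  constructor
  · rintro ⟨n, S, rfl⟩
    exact ⟨validTables_funs ν n S, validTables_rels ν n S⟩
  rintro ⟨⟨h₁, h₂⟩, ⟨h₃, h₄⟩⟩
  obtain ⟨n, F, R⟩ := w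
  simp only [funArities_length, relArities_length, List.mem_range] at h₁ h₂ h₃ h₄
  have hF (f : Σ k, L.Functions k) : (F.getD (ν.funs f) []).length = n ^ f.1 ∧
      ∀ x ∈ F.getD (ν.funs f) [], x < n := by
    have := h₂ (ν.funs f) (Fin.is_lt _)
    rwa [funArities_getD, Equiv.symm_apply_apply] at this
  have hR (f : Σ k, L.Relations k) : (R.getD (ν.rels f) []).length = n ^ f.1 ∧
      ∀ x ∈ R.getD (ν.rels f) [], x < 2 := by
    have := h₄ (ν.rels f) (Fin.is_lt _)
    rwa [relArities_getD, Equiv.symm_apply_apply] at this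
  have hlt (k : ℕ) (f : L.Functions k) (x : Fin k → Fin n) :
      (F.getD (ν.funs ⟨k, f⟩) []).getD (finFunctionFinEquiv x) 0 < n := by
    refine (hF ⟨k, f⟩).2 _ ?_
    have : (finFunctionFinEquiv x : ℕ) < (F.getD (ν.funs ⟨k, f⟩) []).length := by
      rw [(hF ⟨k, f⟩).1]
      exact Fin.is_lt _
    rw [List.getD_eq_getElem _ _ this]
    exact List.getElem_mem this
  let S : L.Structure (Fin n) :=
    { funMap := fun {k} f x => ⟨(F.getD (ν.funs ⟨k, f⟩) []).getD (finFunctionFinEquiv x) 0,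
        hlt k f x⟩
      RelMap := fun {k} r x => (R.getD (ν.rels ⟨k, r⟩) []).getD (finFunctionFinEquiv x) 0 = 1 }
  refine ⟨n, S, ?_⟩
  rw [structureCode_eq]
  refine Prod.ext rfl (Prod.ext ?_ ?_)
  · refine ofFn_eq_of_getD (d := []) h₁ fun s => ?_
    obtain ⟨f, rfl⟩ := ν.funs.surjective s
    rw [Equiv.symm_apply_apply]
    refine (ofFn_eq_of_getD (d := 0) (hF f).1 fun t => ?_).symm
    simp [S, Structure.funMap]
  · refine ofFn_eq_of_getD (d := []) h₃ fun s => ?_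
    obtain ⟨f, rfl⟩ := ν.rels.surjective s
    rw [Equiv.symm_apply_apply]
    refine (ofFn_eq_of_getD (d := 0) (hR f).1 fun t => ?_).symm
    have ht : (t : ℕ) < (R.getD (ν.rels f) []).length := by
      rw [(hR f).1]
      exact t.is_lt
    have := (hR f).2 _ (List.getElem_mem ht)
    rw [← List.getD_eq_getElem _ 0 ht] at this
    simp only [S, Structure.RelMap, Sigma.eta, Equiv.apply_symm_apply]
    split_ifs with h
    · exact h
    · omega

lemma finiteModelsDecidable_empty : ν.FiniteModelsDecidable (∅ : L.Theory) := by
  have h₁ := (primrec_validTables ν.funArities).comp (Primrec.pair (α := StructCode) Primrec.fst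
    (Primrec.pair Primrec.fst (Primrec.fst.comp Primrec.snd)))
  have h₂ := (primrec_validTables ν.relArities).comp (Primrec.pair (α := StructCode) Primrec.fst
    (Primrec.pair (Primrec.const 2) (Primrec.snd.comp Primrec.snd)))
  refine (h₁.and h₂).computablePred.of_eq fun w => (exists_structureCode_iff ν w).symm.trans ?_
  simp

/-- A structure recognised through its code is thereby the given one, which is needed to recognise
reducts. -/
lemma structureCode_injective {n : ℕ} {S S' : L.Structure (Fin n)}
    (h : ν.structureCode n S = ν.structureCode n S') : S = S' := by
  classical
  refine Structure.ext ?_ ?_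
  · funext k f x
    have := funTable_getD n S f x
    rw [← structureCode_fun ν, h, structureCode_fun ν, funTable_getD] at this
    exact (Fin.ext this).symm
  · funext k f x
    have := relTable_getD n S f x
    rw [← structureCode_rel ν, h, structureCode_rel ν, relTable_getD] at this
    refine propext ⟨fun hx => ?_, fun hx => ?_⟩
    · by_contra hx'
      simp [hx, hx'] at this
    · by_contra hx'
      simp [hx, hx'] at this

/-- An upper bound for the codes of structures on `{0, …, n - 1}`. -/
def SymbolNumbering.structBound (n : ℕ) : ℕ :=
  Nat.pair n (Nat.pair
    (listBound ν.funArities.length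
      (listBound (n ^ (ν.funArities.sum + ν.relArities.sum)) n))
    (listBound ν.relArities.length
      (listBound (n ^ (ν.funArities.sum + ν.relArities.sum)) 2)))

lemma primrec_structBound : Primrec ν.structBound := by
  have h : Primrec fun n : ℕ => n ^ (ν.funArities.sum + ν.relArities.sum) :=
    primrec_pow.comp Primrec.id (Primrec.const _)
  exact Primrec₂.natPair.comp Primrec.id (Primrec₂.natPair.comp
    (primrec_listBound.comp (Primrec.const _) (primrec_listBound.comp h Primrec.id))
    (primrec_listBound.comp (Primrec.const _) (primrec_listBound.comp h (Primrec.const 2))))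

lemma encode_structureCode_le {n : ℕ} (hn : 0 < n) (S : L.Structure (Fin n)) :
    Encodable.encode (ν.structureCode n S) ≤ ν.structBound n := by
  refine pair_le_pair le_rfl (pair_le_pair ?_ ?_)
  · exact (validTables_funs ν n S).encode_le hn (by omega)
  · exact (validTables_rels ν n S).encode_le hn (by omega)

open Classical in
lemma holdsAll_iff (n : ℕ) [S : L.Structure (Fin n)] {r : ℕ} (v : Empty → Fin n)
    {φ : L.BoundedFormula Empty r} (h : φ.IsQF) :
    HoldsAll (ν.structureCode n S) r (ν.formulaCode φ) ↔ ∀ a : Fin r → Fin n, φ.Realize v a := by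
  constructor
  · intro H a
    have := H (Encodable.encode (List.ofFn fun i => (a i : ℕ)))
      (encode_le_listBound (by simp) fun x hx => by
        obtain ⟨i, rfl⟩ := (List.mem_ofFn' _ _).1 hx
        exact (Fin.is_lt _).le)
    rw [argList_encode, valForm_formulaCode ν n v a h] at this
    refine of_decide_eq_true (this ⟨by simp, fun x hx => ?_⟩)
    obtain ⟨i, rfl⟩ := (List.mem_ofFn' _ _).1 hx
    exact Fin.is_lt _
  · rintro H x - ⟨h₁, h₂⟩
    obtain ⟨c, t, hc, ht⟩ := exists_args (P := fun c (i : Fin n) => (i : ℕ) = c) h₁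
      fun b hb => ⟨⟨b, h₂ b hb⟩, rfl⟩
    obtain rfl : (fun i => (t i : ℕ)) = c := funext ht
    rw [hc, valForm_formulaCode ν n v t h]
    exact decide_eq_true (H t)

end Structures

/-! ### Universal sentences and the decision procedure -/

section UniversalSentences

open BoundedFormula

variable {L : FirstOrder.Language.{0, 0}} (ν : SymbolNumbering L)

lemma formulaCode_alls {n : ℕ} (φ : L.BoundedFormula Empty n) :
    ν.formulaCode φ.alls = (Nat.pair 4)^[n] (ν.formulaCode φ) := by
  induction n with
  | zero => rfl
  | succ n ih => exact (ih _).trans (by rw [Function.iterate_succ_apply]; rfl)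

lemma isUniversal_alls {n : ℕ} {φ : L.BoundedFormula Empty n} (h : φ.IsUniversal) :
    IsUniversal φ.alls := by
  induction n with
  | zero => exact h
  | succ n ih => exact ih h.all

/-- Both the number of quantifiers and the code of the matrix are at most the code of the sentence,
so they can be found by bounded search. -/
lemma le_iterate_pair (r d : ℕ) : d + r ≤ (Nat.pair 4)^[r] d := by
  induction r with
  | zero => rfl
  | succ r ih =>
    rw [Function.iterate_succ_apply']
    have := Nat.add_le_pair 4 ((Nat.pair 4)^[r] d)
    omega

/-- The prefix is peeled off from the outside, so the induction passes through formulas with `k`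
free variables. The matrix has `r` variables in all, and the assignments `b` to be tested are those
extending `a`. -/
lemma exists_matrix_aux {k : ℕ} {φ : L.BoundedFormula Empty k} (h : φ.IsUniversal) :
    ∃ (r : ℕ) (ψ : L.BoundedFormula Empty r) (hr : k ≤ r), ψ.IsQF ∧
      ν.formulaCode φ = (Nat.pair 4)^[r - k] (ν.formulaCode ψ) ∧
      ∀ (M : Type) [L.Structure M] (v : Empty → M) (a : Fin k → M), φ.Realize v a ↔
        ∀ b : Fin r → M, (∀ i, b (Fin.castLE hr i) = a i) → ψ.Realize v b := by
  induction h with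
  | @of_isQF k φ h =>
    refine ⟨k, φ, le_rfl, h, by simp, fun M _ v a => ⟨fun H b hb => ?_, fun H => H a (by simp)⟩⟩
    obtain rfl : b = a := funext fun i => hb i
    exact H
  | @all k φ h ih =>
    obtain ⟨r, ψ, hr, hψ, hc, H⟩ := ih
    refine ⟨r, ψ, (Nat.le_succ k).trans hr, hψ, ?_, fun M _ v a => ?_⟩
    · rw [SymbolNumbering.formulaCode, hc, ← Function.iterate_succ_apply' (Nat.pair 4)]
      congr 1
      omega
    · simp only [realize_all, H]
      constructor
      · intro H' b hb
        refine H' (b ⟨k, hr⟩) b fun i => ?_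
        refine Fin.lastCases ?_ (fun i => ?_) i
        · simp only [Fin.snoc_last]
          rfl
        · simp only [Fin.snoc_castSucc]
          exact hb i
      · intro H' x b hb
        refine H' b fun i => ?_
        have := hb i.castSucc
        rwa [Fin.snoc_castSucc] at this

lemma exists_matrix {φ : L.Sentence} (h : BoundedFormula.IsUniversal φ) :
    ∃ (r : ℕ) (ψ : L.BoundedFormula Empty r), ψ.IsQF ∧
      ν.formulaCode φ = (Nat.pair 4)^[r] (ν.formulaCode ψ) ∧
      ∀ (M : Type) [L.Structure M], M ⊨ φ ↔ ∀ b : Fin r → M, ψ.Realize default b := by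
  obtain ⟨r, ψ, hr, hψ, hc, H⟩ := exists_matrix_aux ν h
  exact ⟨r, ψ, hψ, hc, fun M _ => (H M _ _).trans
    ⟨fun h b => h b fun i => i.elim0, fun h b _ => h b⟩⟩

/-- In a finite structure a universal sentence is checked by evaluating its matrix at finitely many
tuples. -/
lemma finiteModelsDecidable_insert {T : L.Theory} (hT : ν.FiniteModelsDecidable T)
    {φ : L.Sentence} (hφ : BoundedFormula.IsUniversal φ) :
    ν.FiniteModelsDecidable (insert φ T) := by
  obtain ⟨r, ψ, hψ, -, H⟩ := exists_matrix ν hφ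
  refine (ComputablePred.and hT (primrec_holdsAll.comp (Primrec.pair Primrec.id
    (Primrec.const (r, ν.formulaCode ψ)))).computablePred).of_eq fun w => ⟨?_, ?_⟩
  · rintro ⟨⟨n, S, hS, rfl⟩, hw⟩
    let _ := S
    exact ⟨n, S, (Theory.model_insert_iff).2 ⟨(H _).2 ((holdsAll_iff ν n _ hψ).1 hw), hS⟩, rfl⟩
  · rintro ⟨n, S, hS, rfl⟩
    let _ := S
    have hS := (Theory.model_insert_iff).1 hS
    exact ⟨⟨n, S, hS.2, rfl⟩, (holdsAll_iff ν n _ hψ).2 ((H _).1 hS.1)⟩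

lemma finiteModelsDecidable_union {T T' : L.Theory} (hT : ν.FiniteModelsDecidable T)
    (hfin : T'.Finite) (hT' : T'.IsUniversal) : ν.FiniteModelsDecidable (T ∪ T') := by
  replace hT' := hT'.isUniversal_of_mem
  induction T', hfin using Set.Finite.induction_on with
  | empty => rwa [Set.union_empty]
  | @insert φ T' _ _ ih =>
    rw [Set.union_insert]
    exact finiteModelsDecidable_insert ν (ih fun σ hσ => hT' (Set.mem_insert_of_mem _ hσ))
      (hT' (Set.mem_insert _ _))

/-- A theory whose finite models can be recognised, and which has the finite model property for
negations of universal sentences with a computable bound, has a decidable set of universal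
consequences. -/
theorem universalConsequences_computable {T : L.Theory} (hT : ν.FiniteModelsDecidable T)
    {h : ℕ → ℕ} (hh : Computable h)
    (H : ∀ (r : ℕ) (ψ : L.BoundedFormula Empty r), ψ.IsQF → ∀ (M : Type) [L.Structure M]
      [M ⊨ T] [Nonempty M] (a : Fin r → M), ¬ ψ.Realize default a →
      ∃ (N : Type) (_ : L.Structure N) (b : Fin r → N), N ⊨ T ∧ Finite N ∧ Nonempty N ∧
        Nat.card N ≤ h (ν.formulaCode ψ + r) ∧ ¬ ψ.Realize default b) :
    ComputablePred fun c : ℕ =>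
      ∃ φ : L.Sentence, BoundedFormula.IsUniversal φ ∧ T ⊨ᵇ φ ∧ ν.formulaCode φ = c := by
  have hmod : ComputablePred fun x : ℕ => ∃ (n : ℕ) (S : L.Structure (Fin n)),
      (letI := S; Fin n ⊨ T) ∧ ν.structureCode n S = Denumerable.ofNat StructCode x :=
    ComputablePred.comp hT (Primrec.ofNat StructCode).to_comp
  -- Models are nonempty, whereas `FiniteModelsDecidable` also admits structures on `Fin 0`.
  have hpos : ComputablePred fun x : ℕ => 0 < (Denumerable.ofNat StructCode x).1 :=
    (Primrec.nat_lt.comp (Primrec.const 0)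
      (Primrec.fst.comp (Primrec.ofNat StructCode))).computablePred
  have hcond : ComputablePred fun p : (ℕ × ℕ) × ℕ =>
      (Nat.pair 4)^[p.1.2] p.2 = p.1.1 ∧ wfForm ν.funArities ν.relArities p.1.2 p.2 = true := by
    refine (PrimrecPred.and (Primrec.eq.comp (Primrec.nat_iterate (Primrec.snd.comp Primrec.fst)
      Primrec.snd ?_) (Primrec.fst.comp Primrec.fst)) (Primrec.eq.comp
      ((primrec_wfForm _ _).comp (Primrec.snd.comp Primrec.fst) Primrec.snd)
      (Primrec.const true))).computablePred
    exact (Primrec₂.natPair.comp (Primrec.const 4) Primrec.snd).to₂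
  have hholds : ComputablePred fun p : (((ℕ × ℕ) × ℕ) × ℕ) × ℕ =>
      HoldsAll (Denumerable.ofNat StructCode p.2) p.1.1.1.2 p.1.1.2 :=
    (primrec_holdsAll.comp (Primrec.pair ((Primrec.ofNat StructCode).comp Primrec.snd)
      (Primrec.pair
        (Primrec.snd.comp (Primrec.fst.comp (Primrec.fst.comp Primrec.fst)))
        (Primrec.snd.comp (Primrec.fst.comp Primrec.fst))))).computablePred
  -- The procedure: split `c` into `r` quantifiers and a quantifier-free matrix `d`, and test `d` in
  -- all nonempty models with codes up to the bound. The structure coded by `x` need not have `n`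
  -- elements; testing extra models is harmless.
  have key : ComputablePred fun c : ℕ => ∃ r ≤ c, ∃ d ≤ c,
      ((Nat.pair 4)^[r] d = c ∧ wfForm ν.funArities ν.relArities r d = true) ∧
      ∀ n ≤ h (d + r), ∀ x ≤ ν.structBound n,
        ((∃ (n : ℕ) (S : L.Structure (Fin n)),
          (letI := S; Fin n ⊨ T) ∧ ν.structureCode n S = Denumerable.ofNat StructCode x) ∧
          0 < (Denumerable.ofNat StructCode x).1) →
        HoldsAll (Denumerable.ofNat StructCode x) r d := by
    refine ComputablePred.exists_le (p := fun c r => ∃ d ≤ c, _) ?_ Computable.id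
    refine ComputablePred.exists_le (p := fun (c : ℕ × ℕ) d => _ ∧ _) ?_ Computable.fst
    refine hcond.and ?_
    refine ComputablePred.forall_le (p := fun (c : (ℕ × ℕ) × ℕ) n => ∀ x ≤ ν.structBound n, _) ?_
      (hh.comp (Primrec.nat_add.to_comp.comp Computable.snd
        (Computable.snd.comp Computable.fst)))
    refine ComputablePred.forall_le (p := fun (c : ((ℕ × ℕ) × ℕ) × ℕ) x => _ → _) ?_
      ((primrec_structBound ν).to_comp.comp Computable.snd)
    exact ((hmod.comp Computable.snd).and (hpos.comp Computable.snd)).imp hholds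
  refine key.of_eq fun c => ⟨?_, ?_⟩
  · rintro ⟨r, -, d, -, ⟨hc, hwf⟩, hall⟩
    obtain ⟨ψ, hψ, rfl⟩ := exists_formulaCode ν d hwf
    refine ⟨ψ.alls, isUniversal_alls hψ.isUniversal, ?_, by rw [formulaCode_alls, hc]⟩
    rw [Theory.models_sentence_iff]
    intro M
    refine realize_alls.2 fun a => ?_
    by_contra ha
    obtain ⟨N, _, b, hN, _, _, hcard, hb⟩ := H r ψ hψ M a ha
    -- The finite countermodel is copied to `Fin (Nat.card N)`, where it has a code within the
    -- bounds and so has passed the test.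
    have e : N ≃ Fin (Nat.card N) := Finite.equivFin N
    let _ := e.inducedStructure (L := L)
    let e' : N ≃[L] Fin (Nat.card N) := e.inducedStructureEquiv
    have hm : Fin (Nat.card N) ⊨ T := StrongHomClass.theory_model e'
    have := hall _ hcard _ (encode_structureCode_le ν Nat.card_pos (inferInstance))
    rw [Denumerable.ofNat_encode] at this
    have := (holdsAll_iff ν _ default hψ).1
      (this ⟨⟨_, _, hm, rfl⟩, by simp [structureCode_eq, Nat.card_pos]⟩) (e' ∘ b)
    refine hb ?_
    rw [← StrongHomClass.realize_boundedFormula e' ψ]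
    rwa [Subsingleton.elim (e' ∘ default) default]
  · rintro ⟨φ, hφ, hT, rfl⟩
    obtain ⟨r, ψ, hψ, hc, hr⟩ := exists_matrix ν hφ
    have := le_iterate_pair r (ν.formulaCode ψ)
    refine ⟨r, by omega, ν.formulaCode ψ, by omega, ⟨hc.symm, wfForm_formulaCode ν hψ⟩, ?_⟩
    rintro n - x - ⟨⟨n', S, hS, hx⟩, hpos⟩
    rw [← hx] at hpos ⊢
    let _ := S
    have := hS
    have : Nonempty (Fin n') := ⟨⟨0, hpos⟩⟩
    refine (holdsAll_iff ν n' default hψ).2 ((hr (Fin n')).1 ?_)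
    exact (Theory.models_sentence_iff.1 hT) (Theory.ModelType.of T (Fin n'))

end UniversalSentences

/-! ### Partial embeddings and preservation of quantifier-free formulas -/

section PartialEmbeddings

variable {L : FirstOrder.Language.{0, 0}} {M N : Type} [L.Structure M] [L.Structure N]

/-- A map from a subset of a structure to a structure that is compatible with the relations, and
with the operations as far as these do not lead out of the subset. -/
structure IsPartialEmbedding (L : FirstOrder.Language.{0, 0}) {M N : Type} [L.Structure M]
    [L.Structure N] (A : Set M) (e : A → N) : Prop where
  injective : Function.Injective e
  map_fun : ∀ {k : ℕ} (f : L.Functions k) (x : Fin k → A) (b : A),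
    Structure.funMap f (fun i => (x i : M)) = b → Structure.funMap f (fun i => e (x i)) = e b
  map_rel : ∀ {k : ℕ} (R : L.Relations k) (x : Fin k → A),
    Structure.RelMap R (fun i => e (x i)) ↔ Structure.RelMap R (fun i => (x i : M))

open Classical in
/-- The values of all subterms of a term. -/
noncomputable def termVals {α : Type} (v : α → M) : L.Term α → Finset M
  | .var a => {v a}
  | .func f ts => insert (Structure.funMap f fun i => (ts i).realize v)
      (Finset.univ.biUnion fun i => termVals v (ts i))

open Classical in
/-- The values of all terms in a quantifier-free formula. -/
noncomputable def formVals : ∀ {n : ℕ}, L.BoundedFormula Empty n → (Fin n → M) → Finset M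
  | _, .falsum, _ => ∅
  | _, .equal s t, a => termVals (Sum.elim default a) s ∪ termVals (Sum.elim default a) t
  | _, .rel _ ts, a => Finset.univ.biUnion fun i => termVals (Sum.elim default a) (ts i)
  | _, .imp φ ψ, a => formVals φ a ∪ formVals ψ a
  | _, .all _, _ => ∅

/-- Each `cons` adds at least its entry plus one to the code. The extra ones absorb the `+ 1` in the
bound for terms. -/
lemma sum_le_encode_ofFn {k : ℕ} (c : Fin k → ℕ) :
    ∑ i, (c i + 1) ≤ Encodable.encode (List.ofFn c) := by
  induction k with
  | zero => simp
  | succ k ih =>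
    rw [Fin.sum_univ_succ, List.ofFn_succ, Encodable.encode_list_cons]
    have h₁ := ih fun i => c i.succ
    have h₂ := Nat.add_le_pair (Encodable.encode (c 0))
      (Encodable.encode (List.ofFn fun i : Fin k => c i.succ))
    rw [Encodable.encode_nat] at *
    omega

-- Codes grow at least as fast as the number of subterms. The `+ 1` is needed because the variable
-- numbered `0` has code `0`.
open Classical in
lemma card_termVals_le (ν : SymbolNumbering L) {n : ℕ} (a : Fin n → M)
    (t : L.Term (Empty ⊕ Fin n)) :
    (termVals (Sum.elim default a) t).card ≤ ν.termCode varCode t + 1 := by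
  induction t with
  | var x => simp [termVals]
  | func f ts ih =>
    rw [termVals, SymbolNumbering.termCode]
    refine (Finset.card_insert_le _ _).trans (Nat.succ_le_succ ?_)
    refine (Finset.card_biUnion_le).trans ((Finset.sum_le_sum fun i _ => ih i).trans ?_)
    exact (sum_le_encode_ofFn _).trans
      ((Nat.right_le_pair _ _).trans (Nat.right_le_pair _ _))

open Classical in
lemma card_formVals_le (ν : SymbolNumbering L) {n : ℕ} (a : Fin n → M)
    (φ : L.BoundedFormula Empty n) : (formVals φ a).card ≤ ν.formulaCode φ + 1 := by
  induction φ with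
  | falsum => simp [formVals]
  | equal s t =>
    rw [formVals, SymbolNumbering.formulaCode]
    have h₁ := card_termVals_le ν a s
    have h₂ := card_termVals_le ν a t
    have h₃ := Nat.add_le_pair (ν.termCode varCode s) (ν.termCode varCode t)
    have h₄ := Nat.add_le_pair 1 (Nat.pair (ν.termCode varCode s) (ν.termCode varCode t))
    refine (Finset.card_union_le _ _).trans ?_
    omega
  | rel R ts =>
    rw [formVals, SymbolNumbering.formulaCode]
    refine (Finset.card_biUnion_le).trans
      ((Finset.sum_le_sum fun i _ => card_termVals_le ν a (ts i)).trans ?_)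
    exact (sum_le_encode_ofFn _).trans
      ((Nat.right_le_pair _ _).trans ((Nat.right_le_pair _ _).trans (Nat.le_succ _)))
  | imp φ ψ ih₁ ih₂ =>
    rw [formVals, SymbolNumbering.formulaCode]
    have h₁ := ih₁ a
    have h₂ := ih₂ a
    have h₃ := Nat.add_le_pair (ν.formulaCode φ) (ν.formulaCode ψ)
    have h₄ := Nat.add_le_pair 3 (Nat.pair (ν.formulaCode φ) (ν.formulaCode ψ))
    refine (Finset.card_union_le _ _).trans ?_
    omega
  | all => simp [formVals]

namespace IsPartialEmbedding

variable {A : Set M} {e : A → N}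

/-- All intermediate values lie in `A`, so at each stage of the evaluation the operation is applied
inside the part where `e` respects it. -/
lemma realize_term (he : IsPartialEmbedding L A e) {α : Type} (v : α → A) (t : L.Term α)
    (ht : ↑(termVals (fun i => (v i : M)) t) ⊆ A) :
    ∃ h : t.realize (fun i => (v i : M)) ∈ A, t.realize (fun i => e (v i)) = e ⟨_, h⟩ := by
  induction t with
  | var x => exact ⟨(v x).2, rfl⟩
  | func f ts ih =>
    simp only [termVals, Finset.coe_insert, Finset.coe_biUnion, Set.insert_subset_iff] at ht
    have H (i) := ih i fun x hx => ht.2 (Set.mem_biUnion (x := i) (by simp) hx)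
    refine ⟨ht.1, ?_⟩
    rw [Term.realize_func]
    have h₁ : (fun i => (ts i).realize fun i => e (v i)) = fun i => e ⟨_, (H i).1⟩ :=
      funext fun i => (H i).2
    rw [h₁]
    exact he.map_fun f _ _ rfl

open Classical in
lemma realize_boundedFormula (he : IsPartialEmbedding L A e) {n : ℕ} (a : Fin n → A)
    {φ : L.BoundedFormula Empty n} (hφ : φ.IsQF)
    (hA : ↑(formVals φ fun i => (a i : M)) ⊆ A) :
    φ.Realize default (fun i => e (a i)) ↔ φ.Realize default (fun i => (a i : M)) := by
  have hM : (Sum.elim default fun i => (a i : M)) =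
      fun i : Empty ⊕ Fin n => ((Sum.elim Empty.elim a i : A) : M) := by
    funext i
    rcases i with i | i
    exacts [i.elim, rfl]
  have hN : (Sum.elim default fun i => e (a i)) =
      fun i : Empty ⊕ Fin n => e (Sum.elim Empty.elim a i) := by
    funext i
    rcases i with i | i
    exacts [i.elim, rfl]
  induction hφ with
  | falsum => exact Iff.rfl
  | of_isAtomic h =>
    cases h with
    | equal s t =>
      have hA : ↑(termVals (Sum.elim default fun i => (a i : M)) s ∪
        termVals (Sum.elim default fun i => (a i : M)) t) ⊆ A := hA
      rw [Finset.coe_union, Set.union_subset_iff, hM] at hA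
      obtain ⟨h₁, h₂⟩ := he.realize_term _ s hA.1
      obtain ⟨h₃, h₄⟩ := he.realize_term _ t hA.2
      change (s.realize (Sum.elim default fun i => e (a i)) =
        t.realize (Sum.elim default fun i => e (a i))) ↔
        s.realize (Sum.elim default fun i => (a i : M)) =
          t.realize (Sum.elim default fun i => (a i : M))
      rw [hM, hN, h₂, h₄, he.injective.eq_iff, Subtype.mk.injEq]
    | rel R ts =>
      have hA : ↑(Finset.univ.biUnion fun i =>
        termVals (Sum.elim default fun i => (a i : M)) (ts i)) ⊆ A := hA
      rw [Finset.coe_biUnion, hM] at hA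
      have H (i) := he.realize_term _ (ts i) fun x hx => hA (Set.mem_biUnion (x := i) (by simp) hx)
      have h₁ : (fun i => (ts i).realize fun i => e (Sum.elim Empty.elim a i)) =
        fun i => e ⟨_, (H i).1⟩ := funext fun i => (H i).2
      change Structure.RelMap R (fun i => (ts i).realize (Sum.elim default fun i => e (a i))) ↔
        Structure.RelMap R fun i => (ts i).realize (Sum.elim default fun i => (a i : M))
      rw [hM, hN, h₁, he.map_rel]
  | imp _ _ ih₁ ih₂ =>
    simp only [formVals, Finset.coe_union, Set.union_subset_iff] at hA
    simp only [BoundedFormula.realize_imp, ih₁ hA.1, ih₂ hA.2]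

end IsPartialEmbedding

lemma exists_range_superset {X : Type} [Nonempty X] (s : Finset X) {m : ℕ} (h : s.card ≤ m) :
    ∃ v : Fin m → X, ↑s ⊆ Set.range v := by
  classical
  refine ⟨fun i => if hi : (i : ℕ) < s.card then (s.equivFin.symm ⟨i, hi⟩ : X) else
    Classical.arbitrary X, fun x hx => ?_⟩
  refine ⟨⟨s.equivFin ⟨x, hx⟩, (Fin.is_lt _).trans_le h⟩, ?_⟩
  simp

/-- Decidability of the universal consequences from a computable bound for the sizes of models that
partially embed the subsets of models with a given number of elements. -/
theorem universalConsequences_computable_of_partialEmbedding {T : L.Theory}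
    (ν : SymbolNumbering L) (hT : ν.FiniteModelsDecidable T) {h : ℕ → ℕ} (hh : Computable h)
    (H : ∀ (M : Type) [L.Structure M] [M ⊨ T] [Nonempty M] (m : ℕ) (v : Fin m → M), 0 < m →
      ∃ (N : Type) (_ : L.Structure N), N ⊨ T ∧ Finite N ∧ Nat.card N ≤ h m ∧
      ∃ (A : Set M) (e : A → N), Set.range v ⊆ A ∧ IsPartialEmbedding L A e) :
    ComputablePred fun c : ℕ =>
      ∃ φ : L.Sentence, BoundedFormula.IsUniversal φ ∧ T ⊨ᵇ φ ∧ ν.formulaCode φ = c := by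
  classical
  refine universalConsequences_computable ν hT (hh.comp Computable.succ) ?_
  intro r ψ hψ M _ _ _ a ha
  -- There are at most `ν.formulaCode ψ + 1` term values and `r` assigned elements. The sum is
  -- positive, so `v 0` exists and witnesses that `N` is nonempty.
  obtain ⟨v, hv⟩ := exists_range_superset (formVals ψ a ∪ Finset.univ.image a)
    (m := ν.formulaCode ψ + r + 1) (by
      refine (Finset.card_union_le _ _).trans ?_
      have h₁ := card_formVals_le ν a ψ
      have h₂ := Finset.card_image_le (s := Finset.univ) (f := a)
      simp at h₂
      omega)
  obtain ⟨N, _, hN, hfin, hcard, A, e, hA, he⟩ := H M (ν.formulaCode ψ + r + 1) v (Nat.succ_pos _)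
  have hsub := hv.trans hA
  rw [Finset.coe_union, Set.union_subset_iff] at hsub
  have ha' (i : Fin r) : a i ∈ A := hsub.2 (by simp)
  refine ⟨N, _, fun i => e ⟨a i, ha' i⟩, hN, hfin, ⟨e ⟨v 0, hA ⟨0, rfl⟩⟩⟩, hcard, ?_⟩
  rwa [he.realize_boundedFormula (fun i => ⟨a i, ha' i⟩) hψ hsub.1]

end PartialEmbeddings

/-! ### Languages with added operation symbols: reducts and expansions -/

section Sums

variable {L L' : FirstOrder.Language.{0, 0}}

/-- From the code of a structure for a sum of languages to the code of a reduct. -/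
noncomputable def reductCode (ν : SymbolNumbering L) (ν' : SymbolNumbering (L.sum L'))
    (w : StructCode) : StructCode :=
  (w.1,
    (List.ofFn fun s => (ν'.funs ⟨_, Sum.inl (ν.funs.symm s).2⟩ : ℕ)).map
      fun i => w.2.1.getD i [],
    (List.ofFn fun s => (ν'.rels ⟨_, Sum.inl (ν.rels.symm s).2⟩ : ℕ)).map
      fun i => w.2.2.getD i [])

lemma primrec_reductCode (ν : SymbolNumbering L) (ν' : SymbolNumbering (L.sum L')) :
    Primrec (reductCode ν ν') :=
  Primrec.pair Primrec.fst (Primrec.pair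
    (Primrec.list_map (Primrec.const _) ((Primrec.list_getD []).comp
      (Primrec.fst.comp (Primrec.snd.comp Primrec.fst)) Primrec.snd).to₂)
    (Primrec.list_map (Primrec.const _) ((Primrec.list_getD []).comp
      (Primrec.snd.comp (Primrec.snd.comp Primrec.fst)) Primrec.snd).to₂))

lemma reductCode_structureCode (ν : SymbolNumbering L) (ν' : SymbolNumbering (L.sum L')) (n : ℕ)
    (S : (L.sum L').Structure (Fin n)) :
    reductCode ν ν' (ν'.structureCode n S) =
      ν.structureCode n ((LHom.sumInl : L →ᴸ L.sum L').reduct (Fin n)) := by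
  refine Prod.ext rfl (Prod.ext ?_ ?_)
  · simp only [reductCode, List.map_ofFn, Function.comp_def, structureCode_fun]
    rfl
  · simp only [reductCode, List.map_ofFn, Function.comp_def, structureCode_rel]
    rfl

/-- A code is accepted if it codes a structure for the large language and the tables of the old
symbols, rearranged by `reductCode`, code a model of `T`. -/
lemma finiteModelsDecidable_onTheory {ν : SymbolNumbering L} {T : L.Theory}
    (hT : ν.FiniteModelsDecidable T) (ν' : SymbolNumbering (L.sum L')) :
    ν'.FiniteModelsDecidable ((LHom.sumInl : L →ᴸ L.sum L').onTheory T) := by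
  refine ((finiteModelsDecidable_empty ν').and
    (ComputablePred.comp hT (primrec_reductCode ν ν').to_comp)).of_eq fun w => ⟨?_, ?_⟩
  · rintro ⟨⟨n, S, -, rfl⟩, n', S', hS', h⟩
    rw [reductCode_structureCode] at h
    obtain rfl : n' = n := congrArg Prod.fst h
    obtain rfl := structureCode_injective ν h
    refine ⟨n', S, ?_, rfl⟩
    let _ := (LHom.sumInl : L →ᴸ L.sum L').reduct (Fin n')
    exact (LHom.onTheory_model _ T).2 hS'
  · rintro ⟨n, S, hS, rfl⟩
    let _ := S
    refine ⟨⟨n, S, by simp, rfl⟩, n, (LHom.sumInl : L →ᴸ L.sum L').reduct (Fin n), ?_,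
      (reductCode_structureCode ν ν' n S).symm⟩
    let _ := (LHom.sumInl : L →ᴸ L.sum L').reduct (Fin n)
    exact (LHom.onTheory_model _ T).1 hS

variable {q : ℕ} {ar : Fin q → ℕ}

lemma nonempty_symbolNumbering_sum (ν : SymbolNumbering L) (ar : Fin q → ℕ) :
    Nonempty (SymbolNumbering (L.sum (opLang ar))) := by
  refine ⟨⟨ν.numFun + q, ν.numRel + 0, ?_, ?_⟩⟩
  · exact (Equiv.sigmaSumDistrib _ _).trans
      ((Equiv.sumCongr ν.funs (Equiv.sigmaFiberEquiv ar)).trans finSumFinEquiv)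
  · have : IsEmpty (Σ _ : ℕ, Empty) := ⟨fun x => x.2.elim⟩
    exact (Equiv.sigmaSumDistrib _ _).trans
      ((Equiv.sumCongr ν.rels (Equiv.equivOfIsEmpty (Σ _ : ℕ, Empty) (Fin 0))).trans
        finSumFinEquiv)

/-- The structure given by operations. -/
@[reducible]
def opStructure {N : Type} (F : ∀ k, (Fin (ar k) → N) → N) : (opLang ar).Structure N where
  funMap f x := F f.1 (x ∘ Fin.cast f.2)
  RelMap R _ := R.elim

/-- The expansion of a structure by operations. -/
@[reducible]
def expansion {N : Type} [L.Structure N] (F : ∀ k, (Fin (ar k) → N) → N) :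
    (L.sum (opLang ar)).Structure N :=
  letI := opStructure F
  inferInstance

/-- Decidability for a theory extended by finitely many universal axioms on new operations. -/
theorem universalConsequencesDecidable_of_extension {ν : SymbolNumbering L} {T : L.Theory}
    (hT : ν.FiniteModelsDecidable T) {Ax : (L.sum (opLang ar)).Theory} (hfin : Ax.Finite)
    (huniv : Ax.IsUniversal) {h : ℕ → ℕ} (hh : Computable h)
    (H : ∀ (M : Type) [(L.sum (opLang ar)).Structure M] [Nonempty M],
      letI : L.Structure M := (LHom.sumInl : L →ᴸ L.sum (opLang ar)).reduct M
      M ⊨ T → M ⊨ Ax → ∀ (m : ℕ) (v : Fin m → M), 0 < m →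
      ∃ (N : Type) (_ : L.Structure N), N ⊨ T ∧ Finite N ∧ Nat.card N ≤ h m ∧
      ∃ (A : Set M) (e : A → N), Set.range v ⊆ A ∧ IsPartialEmbedding L A e ∧
      ∃ F : ∀ k, (Fin (ar k) → N) → N,
        (∀ k (x : Fin (ar k) → A) (b : A),
          Structure.funMap (opSymbol L ar k) (fun i => (x i : M)) = b →
            F k (fun i => e (x i)) = e b) ∧
        (letI := expansion (L := L) F; N ⊨ Ax)) :
    UniversalConsequencesDecidable ((LHom.sumInl : L →ᴸ L.sum (opLang ar)).onTheory T ∪ Ax) := by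
  refine ⟨nonempty_symbolNumbering_sum ν ar, fun ν' => ?_⟩
  refine universalConsequences_computable_of_partialEmbedding ν'
    (finiteModelsDecidable_union ν' (finiteModelsDecidable_onTheory hT ν') hfin huniv) hh ?_
  intro M _ hM _ m v hm
  let _ : L.Structure M := (LHom.sumInl : L →ᴸ L.sum (opLang ar)).reduct M
  rw [Theory.model_union_iff] at hM
  obtain ⟨N, _, hN, hfin, hcard, A, e, hA, he, F, hF, hAx⟩ :=
    H M ((LHom.onTheory_model _ T).1 hM.1) hM.2 m v hm
  refine ⟨N, expansion (L := L) F, ?_, hfin, hcard, A, e, hA, ?_⟩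
  · let _ := opStructure F
    exact Theory.model_union_iff.2 ⟨(LHom.onTheory_model _ T).2 hN, hAx⟩
  · let _ := expansion (L := L) F
    refine ⟨he.injective, fun f x b hb => ?_, fun R x => ?_⟩
    · rcases f with f | ⟨k, rfl⟩
      · exact he.map_fun f x b hb
      · exact hF k x b hb
    · rcases R with R | R
      · exact he.map_rel R x
      · exact R.elim

end Sums

/-! ### The properties of operations in order-theoretic form -/

section Conditions

variable {M : Type*}

/-- `F` is isotone on the first `i` components and antitone on the last `j` components. -/
def MixedHolds [LE M] {n : ℕ} (F : (Fin n → M) → M) (i j : ℕ) : Prop :=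
  (∀ h : Fin n, (h : ℕ) < i → ∀ x y, x h ≤ y → F x ≤ F (Function.update x h y)) ∧
  ∀ h : Fin n, n ≤ (h : ℕ) + j → ∀ x y, x h ≤ y → F (Function.update x h y) ≤ F x

/-- The operation `F` has a given property. -/
def OpCond.Holds [LE M] : ∀ {n : ℕ}, OpCond n → ((Fin n → M) → M) → Prop
  | _, .extensive, F => ∀ x, x ≤ F ![x]
  | _, .contractive, F => ∀ x, F ![x] ≤ x
  | _, .idempotent, F => ∀ x, F ![F ![x] ] = F ![x]
  | _, .idempotentExtensive, F => (∀ x, F ![F ![x] ] = F ![x]) ∧ ∀ x, x ≤ F ![x]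
  | _, .idempotentContractive, F => (∀ x, F ![F ![x] ] = F ![x]) ∧ ∀ x, F ![x] ≤ x
  | _, .involutive, F => ∀ x, F ![F ![x] ] = x
  | _, .isotone, F => ∀ x y, x ≤ y → F ![x] ≤ F ![y]
  | _, .isotoneExtensive, F => (∀ x y, x ≤ y → F ![x] ≤ F ![y]) ∧ ∀ x, x ≤ F ![x]
  | _, .isotoneContractive, F => (∀ x y, x ≤ y → F ![x] ≤ F ![y]) ∧ ∀ x, F ![x] ≤ x
  | _, .isotoneIdempotent, F => (∀ x y, x ≤ y → F ![x] ≤ F ![y]) ∧ ∀ x, F ![F ![x] ] = F ![x]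
  | _, .closure, F =>
      (∀ x y, x ≤ y → F ![x] ≤ F ![y]) ∧ (∀ x, x ≤ F ![x]) ∧ ∀ x, F ![F ![x] ] = F ![x]
  | _, .interior, F =>
      (∀ x y, x ≤ y → F ![x] ≤ F ![y]) ∧ (∀ x, F ![x] ≤ x) ∧ ∀ x, F ![F ![x] ] = F ![x]
  | _, .antitone, F => ∀ x y, x ≤ y → F ![y] ≤ F ![x]
  | _, .mixed _ i j _ _, F => MixedHolds F i j
  | n, .mixedAbove _ i j h _ _ _, F =>
      MixedHolds F i j ∧ ∀ k : Fin n, (k : ℕ) < h → ∀ x, x k ≤ F x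

/-- The value of a lattice term. -/
def LatTerm.eval [Lattice M] {i : ℕ} (x : Fin i → M) : LatTerm i → M
  | .var a => x a
  | .sup s t => s.eval x ⊔ t.eval x
  | .inf s t => s.eval x ⊓ t.eval x

/-- The operation `F` on a lattice has a given property. -/
def LatOpCond.Holds [Lattice M] : ∀ {n : ℕ}, LatOpCond n → ((Fin n → M) → M) → Prop
  | _, .basic c, F => c.Holds F
  | _, .mixedAboveTerm _ i j _ hij t, F => MixedHolds F i j ∧
      ∀ x, t.eval (fun a => x (Fin.castLE (le_trans (Nat.le_add_right i j) hij) a)) ≤ F x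

/-- The order on tuples for which operations that are isotone on the first `i` components and
antitone on the last `j` components are isotone. -/
def MixedLE [LE M] {n : ℕ} (i j : ℕ) (x y : Fin n → M) : Prop :=
  ∀ k : Fin n, ((k : ℕ) < i → x k ≤ y k) ∧ (n ≤ (k : ℕ) + j → y k ≤ x k) ∧
    (i ≤ (k : ℕ) → (k : ℕ) + j < n → x k = y k)

lemma MixedLE.refl [Preorder M] {n i j : ℕ} (x : Fin n → M) : MixedLE i j x x :=
  fun _ => ⟨fun _ => le_rfl, fun _ => le_rfl, fun _ _ => rfl⟩

lemma MixedLE.trans [Preorder M] {n i j : ℕ} {x y z : Fin n → M} (h₁ : MixedLE i j x y)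
    (h₂ : MixedLE i j y z) : MixedLE i j x z :=
  fun k => ⟨fun h => ((h₁ k).1 h).trans ((h₂ k).1 h),
    fun h => ((h₂ k).2.1 h).trans ((h₁ k).2.1 h),
    fun h h' => ((h₁ k).2.2 h h').trans ((h₂ k).2.2 h h')⟩

lemma MixedLE.update_isotone [Preorder M] {n i j : ℕ} (hij : i + j ≤ n) {x : Fin n → M}
    {h : Fin n} {y : M} (hi : (h : ℕ) < i) (hy : x h ≤ y) :
    MixedLE i j x (Function.update x h y) := by
  intro k
  by_cases hk : k = h
  · subst hk
    simp only [Function.update_self]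
    exact ⟨fun _ => hy, fun h => by omega, fun h => by omega⟩
  · simp [Function.update_of_ne hk]

lemma MixedLE.update_antitone [Preorder M] {n i j : ℕ} (hij : i + j ≤ n) {x : Fin n → M}
    {h : Fin n} {y : M} (hj : n ≤ (h : ℕ) + j) (hy : x h ≤ y) :
    MixedLE i j (Function.update x h y) x := by
  intro k
  by_cases hk : k = h
  · subst hk
    simp only [Function.update_self]
    exact ⟨fun _ => by omega, fun h => hy, fun h => by omega⟩
  · simp [Function.update_of_ne hk]

lemma MixedHolds.of_mono [Preorder M] {n i j : ℕ} (hij : i + j ≤ n) {F : (Fin n → M) → M}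
    (H : ∀ x y, MixedLE i j x y → F x ≤ F y) : MixedHolds F i j :=
  ⟨fun _ hi _ _ hy => H _ _ (.update_isotone hij hi hy),
    fun _ hj _ _ hy => H _ _ (.update_antitone hij hj hy)⟩

/-- The axioms change one argument at a time; passing from `x` to `y` coordinate by coordinate gives
monotonicity for the order on tuples. -/
lemma MixedHolds.mono [Preorder M] {n i j : ℕ} {F : (Fin n → M) → M} (H : MixedHolds F i j)
    {x y : Fin n → M} (h : MixedLE i j x y) : F x ≤ F y := by
  -- The hybrid tuple has its first `t` entries from `y` and the others from `x`. In an antitone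
  -- coordinate the step is read backwards, raising `y p` to `x p`; in a coordinate with no
  -- condition nothing changes.
  have key (t : ℕ) (ht : t ≤ n) : F x ≤ F fun k => if (k : ℕ) < t then y k else x k := by
    induction t with
    | zero => simp
    | succ t ih =>
      refine (ih (by omega)).trans ?_
      set z := fun k : Fin n => if (k : ℕ) < t then y k else x k
      set z' := fun k : Fin n => if (k : ℕ) < t + 1 then y k else x k
      let p : Fin n := ⟨t, ht⟩
      have hz : z p = x p := by simp [z, p]
      have hz' : z' p = y p := by simp [z', p]
      have e₁ : Function.update z p (y p) = z' := by
        funext k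
        by_cases hk : k = p
        · rw [hk, Function.update_self, hz']
        · have : (k : ℕ) ≠ t := fun h => hk (Fin.ext h)
          have : (k : ℕ) < t + 1 ↔ (k : ℕ) < t := by omega
          simp only [Function.update_of_ne hk, z, z', this]
      have e₂ : Function.update z' p (x p) = z := by
        rw [← e₁, Function.update_idem, ← hz, Function.update_eq_self]
      by_cases h₁ : t < i
      · rw [← e₁]
        exact H.1 p h₁ z (y p) (hz ▸ (h p).1 h₁)
      by_cases h₂ : n ≤ t + j
      · rw [← e₂]
        exact H.2 p h₂ z' (x p) (hz' ▸ (h p).2.1 h₂)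
      · have : z = z' := by
          rw [← e₁, ← (h p).2.2 (by simpa [p] using h₁) (by simpa [p] using h₂), ← hz,
            Function.update_eq_self]
        rw [this]
  simpa using key n le_rfl

end Conditions

/-! ### Extending partial operations to complete lattices -/

section Extensions

variable {M N : Type*} {A : Set M} {e : A → N}

/-- A partial unary operation can be extended by the identity. -/
lemma exists_extension_id (he : Function.Injective e) (K : M → M) :
    ∃ K' : N → N, (∀ a b : A, K a = b → K' (e a) = e b) ∧
      ∀ y, (∃ a b : A, e a = y ∧ K a = b ∧ K' y = e b) ∨ K' y = y := by
  classical
  refine ⟨fun y => if h : ∃ a b : A, e a = y ∧ K a = b then e h.choose_spec.choose else y, ?_, ?_⟩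
  · intro a b hab
    have h : ∃ a' b' : A, e a' = e a ∧ K a' = b' := ⟨a, b, rfl, hab⟩
    simp only [dif_pos h]
    obtain ⟨h₁, h₂⟩ := h.choose_spec.choose_spec
    have h₃ : K h.choose = b := (congrArg (fun a : A => K a) (he h₁)).trans hab
    exact congrArg e (Subtype.ext (h₂.symm.trans h₃))
  · intro y
    by_cases h : ∃ a b : A, e a = y ∧ K a = b
    · obtain ⟨h₁, h₂⟩ := h.choose_spec.choose_spec
      exact Or.inl ⟨_, _, h₁, h₂, dif_pos h⟩
    · exact Or.inr (dif_neg h)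


/-- The least isotone extension of a partial operation. -/
def lowerExt [CompleteLattice N] (e : A → N) (K : M → M) (y : N) : N :=
  sSup {z | ∃ a b : A, K a = b ∧ e a ≤ y ∧ z = e b}

/-- The least closed element above a given one, for a partial idempotent operation. -/
def closureExt [CompleteLattice N] (e : A → N) (K : M → M) (y : N) : N :=
  sInf {z | ∃ a b : A, K a = b ∧ y ≤ e b ∧ z = e b}

/-- The least antitone extension of a partial operation. -/
def antitoneExt [CompleteLattice N] (e : A → N) (K : M → M) (y : N) : N :=
  sSup {z | ∃ a b : A, K a = b ∧ y ≤ e a ∧ z = e b}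

lemma lowerExt_mono [CompleteLattice N] (K : M → M) : Monotone (lowerExt e K) := fun _ _ h =>
  sSup_le_sSup fun _ ⟨a, b, h₁, h₂, h₃⟩ => ⟨a, b, h₁, h₂.trans h, h₃⟩

lemma closureExt_mono [CompleteLattice N] (K : M → M) : Monotone (closureExt e K) := fun _ _ h =>
  sInf_le_sInf fun _ ⟨a, b, h₁, h₂, h₃⟩ => ⟨a, b, h₁, h.trans h₂, h₃⟩

lemma antitoneExt_anti [CompleteLattice N] (K : M → M) : Antitone (antitoneExt e K) := fun _ _ h =>
  sSup_le_sSup fun _ ⟨a, b, h₁, h₂, h₃⟩ => ⟨a, b, h₁, h.trans h₂, h₃⟩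

lemma le_closureExt [CompleteLattice N] (K : M → M) (y : N) : y ≤ closureExt e K y :=
  le_sInf fun _ ⟨_, _, _, h₂, h₃⟩ => h₃ ▸ h₂

lemma closureExt_idem [CompleteLattice N] (K : M → M) (y : N) :
    closureExt e K (closureExt e K y) = closureExt e K y :=
  le_antisymm (sInf_le_sInf fun _ ⟨a, b, h₁, h₂, h₃⟩ =>
    ⟨a, b, h₁, sInf_le ⟨a, b, h₁, h₂, rfl⟩, h₃⟩) (le_closureExt K _)

lemma lowerExt_apply [PartialOrder M] [CompleteLattice N] (he : ∀ a b, e a ≤ e b ↔ (a : M) ≤ b)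
    {K : M → M} (hK : Monotone K) {a b : A} (hab : K a = b) : lowerExt e K (e a) = e b := by
  refine le_antisymm (sSup_le ?_) (le_sSup ⟨a, b, hab, le_rfl, rfl⟩)
  rintro _ ⟨a', b', h, h', rfl⟩
  rw [he] at h' ⊢
  rw [← h, ← hab]
  exact hK h'

lemma antitoneExt_apply [PartialOrder M] [CompleteLattice N] (he : ∀ a b, e a ≤ e b ↔ (a : M) ≤ b)
    {K : M → M} (hK : Antitone K) {a b : A} (hab : K a = b) :
    antitoneExt e K (e a) = e b := by
  refine le_antisymm (sSup_le ?_) (le_sSup ⟨a, b, hab, le_rfl, rfl⟩)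
  rintro _ ⟨a', b', h, h', rfl⟩
  rw [he] at h' ⊢
  rw [← h, ← hab]
  exact hK h'

lemma lowerExt_le [PartialOrder M] [CompleteLattice N] (he : ∀ a b, e a ≤ e b ↔ (a : M) ≤ b)
    {K : M → M} (hK : ∀ x, K x ≤ x) (y : N) : lowerExt e K y ≤ y := by
  refine sSup_le ?_
  rintro _ ⟨a, b, h, h', rfl⟩
  exact le_trans ((he _ _).2 (h ▸ hK a)) h'

/-- A value `e b` that contributes at `y` lies below `z`, and `K b = b`, so it contributes at `z` as
well. -/
lemma lowerExt_le_lowerExt [CompleteLattice N] {K : M → M} (hK : ∀ x, K (K x) = K x) {y z : N} (hz : lowerExt e K y ≤ z) :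
    lowerExt e K y ≤ lowerExt e K z := by
  refine sSup_le ?_
  rintro _ ⟨a, b, h, h', rfl⟩
  have h₁ : e b ≤ lowerExt e K y := le_sSup ⟨a, b, h, h', rfl⟩
  exact le_sSup ⟨b, b, by rw [← h, hK], h₁.trans hz, rfl⟩

/-- If `a ≤ b'` with `b'` a value of `K`, then `K a ≤ K b' = b'`, so `b` is the least candidate. The
hypothesis `hle` makes `b` a candidate in the first place. -/
lemma closureExt_apply [PartialOrder M] [CompleteLattice N] (he : ∀ a b, e a ≤ e b ↔ (a : M) ≤ b)
    {K : M → M} (hK : Monotone K) (hK' : ∀ x, K (K x) = K x) {a b : A} (hab : K a = b)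
    (hle : (a : M) ≤ b) : closureExt e K (e a) = e b := by
  refine le_antisymm (sInf_le ⟨a, b, hab, (he _ _).2 hle, rfl⟩) (le_sInf ?_)
  rintro _ ⟨a', b', h, h', rfl⟩
  rw [he] at h' ⊢
  rw [← hab, ← h, ← hK' a']
  exact hK (h ▸ h')

/-- If `a` lies below a fixed point `d` of `K`, then so does `K a`. Hence `lowerExt` does not lead
above an infimum of images of such fixed points. -/
lemma lowerExt_closureExt_le [PartialOrder M] [CompleteLattice N] (he : ∀ a b, e a ≤ e b ↔ (a : M) ≤ b)
    {K : M → M} (hK : Monotone K) (hK' : ∀ x, K (K x) = K x) (y : N) :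
    lowerExt e K (closureExt e K y) ≤ closureExt e K y := by
  refine sSup_le ?_
  rintro _ ⟨a, b, h, h', rfl⟩
  refine le_sInf ?_
  rintro _ ⟨c, d, h₁, h₂, rfl⟩
  have h₃ : e a ≤ e d := h'.trans (sInf_le ⟨c, d, h₁, h₂, rfl⟩)
  rw [he] at h₃ ⊢
  have := hK h₃
  rwa [h, ← h₁, hK', h₁] at this

/-- The least extension of a partial operation that is isotone on the first `i` components and
antitone on the last `j` components. -/
def mixedExt [CompleteLattice N] (e : A → N) {n : ℕ} (F : (Fin n → M) → M) (i j : ℕ)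
    (y : Fin n → N) : N :=
  sSup {z | ∃ (x : Fin n → A) (b : A), F (fun k => (x k : M)) = b ∧
    MixedLE i j (fun k => e (x k)) y ∧ z = e b}

lemma mixedExt_mono [CompleteLattice N] {n i j : ℕ} (F : (Fin n → M) → M) {y z : Fin n → N}
    (h : MixedLE i j y z) : mixedExt e F i j y ≤ mixedExt e F i j z :=
  sSup_le_sSup fun _ ⟨x, b, h₁, h₂, h₃⟩ => ⟨x, b, h₁, h₂.trans h, h₃⟩

lemma mixedExt_apply [PartialOrder M] [CompleteLattice N] (he : ∀ a b, e a ≤ e b ↔ (a : M) ≤ b)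
    {n i j : ℕ} {F : (Fin n → M) → M} (hF : MixedHolds F i j) {x : Fin n → A} {b : A}
    (hb : F (fun k => (x k : M)) = b) : mixedExt e F i j (fun k => e (x k)) = e b := by
  refine le_antisymm (sSup_le ?_) (le_sSup ⟨x, b, hb, .refl _, rfl⟩)
  rintro _ ⟨x', b', h, h', rfl⟩
  rw [he, ← h, ← hb]
  refine hF.mono fun k => ?_
  obtain ⟨h₁, h₂, h₃⟩ := h' k
  refine ⟨fun h => (he _ _).1 (h₁ h), fun h => (he _ _).1 (h₂ h), fun h h' => ?_⟩
  have := h₃ h h'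
  exact le_antisymm ((he _ _).1 this.le) ((he _ _).1 this.ge)

/-- A partial operation on a partially ordered set with a property as in `OpCond` can be extended to
an operation on a complete lattice with the same property. -/
theorem OpCond.exists_extension [PartialOrder M] [CompleteLattice N]
    (he : ∀ a b, e a ≤ e b ↔ (a : M) ≤ b) {n : ℕ} (c : OpCond n) {F : (Fin n → M) → M}
    (hF : c.Holds F) :
    ∃ F' : (Fin n → N) → N, (∀ (x : Fin n → A) (b : A), F (fun i => (x i : M)) = b →
      F' (fun i => e (x i)) = e b) ∧ c.Holds F' := by
  have hinj : Function.Injective e := fun a b h =>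
    Subtype.ext (le_antisymm ((he _ _).1 h.le) ((he _ _).1 h.ge))
  -- Unary conditions concern functions on one-element tuples; this reduces them to functions `N →
  -- N`.
  have unary (F : (Fin 1 → M) → M) (P : ((Fin 1 → N) → N) → Prop)
      (h : ∃ K' : N → N, (∀ a b : A, F ![(a : M)] = b → K' (e a) = e b) ∧ P fun y => K' (y 0)) :
      ∃ F' : (Fin 1 → N) → N, (∀ (x : Fin 1 → A) (b : A), F (fun i => (x i : M)) = b →
        F' (fun i => e (x i)) = e b) ∧ P F' := by
    obtain ⟨K', h₁, h₂⟩ := h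
    refine ⟨fun y => K' (y 0), fun x b hb => h₁ _ _ ?_, h₂⟩
    rw [← hb]
    congr 1
    funext i
    rw [Subsingleton.elim i 0]
    rfl
  cases c with
  | extensive =>
    obtain ⟨K', h₁, h₂⟩ := exists_extension_id hinj fun x => F ![x]
    refine unary F _ ⟨K', h₁, fun y => ?_⟩
    obtain ⟨a, b, rfl, h, h'⟩ | h := h₂ y
    · exact ((he _ _).2 (h ▸ hF a)).trans_eq h'.symm
    · exact h.ge
  | contractive =>
    obtain ⟨K', h₁, h₂⟩ := exists_extension_id hinj fun x => F ![x]
    refine unary F _ ⟨K', h₁, fun y => ?_⟩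
    obtain ⟨a, b, rfl, h, h'⟩ | h := h₂ y
    · exact h'.trans_le ((he _ _).2 (h ▸ hF a))
    · exact h.le
  | idempotent =>
    obtain ⟨K', h₁, h₂⟩ := exists_extension_id hinj fun x => F ![x]
    refine unary F _ ⟨K', h₁, fun y => ?_⟩
    change K' (K' y) = K' y
    obtain ⟨a, b, rfl, h, h'⟩ | h := h₂ y
    -- Since `b` is a value of `K`, it is fixed by `K`, and the prescribed value at `e b` is `e b`.
    · rw [h', h₁ b b (by rw [← h]; exact hF a)]
    · rw [h, h]
  | idempotentExtensive =>
    obtain ⟨K', h₁, h₂⟩ := exists_extension_id hinj fun x => F ![x]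
    refine unary F _ ⟨K', h₁, fun y => ?_, fun y => ?_⟩
    · change K' (K' y) = K' y
      obtain ⟨a, b, rfl, h, h'⟩ | h := h₂ y
      · rw [h', h₁ b b (by rw [← h]; exact hF.1 a)]
      · rw [h, h]
    · obtain ⟨a, b, rfl, h, h'⟩ | h := h₂ y
      · exact ((he _ _).2 (h ▸ hF.2 a)).trans_eq h'.symm
      · exact h.ge
  | idempotentContractive =>
    obtain ⟨K', h₁, h₂⟩ := exists_extension_id hinj fun x => F ![x]
    refine unary F _ ⟨K', h₁, fun y => ?_, fun y => ?_⟩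
    · change K' (K' y) = K' y
      obtain ⟨a, b, rfl, h, h'⟩ | h := h₂ y
      · rw [h', h₁ b b (by rw [← h]; exact hF.1 a)]
      · rw [h, h]
    · obtain ⟨a, b, rfl, h, h'⟩ | h := h₂ y
      · exact h'.trans_le ((he _ _).2 (h ▸ hF.2 a))
      · exact h.le
  | involutive =>
    obtain ⟨K', h₁, h₂⟩ := exists_extension_id hinj fun x => F ![x]
    refine unary F _ ⟨K', h₁, fun y => ?_⟩
    change K' (K' y) = y
    obtain ⟨a, b, rfl, h, h'⟩ | h := h₂ y
    · rw [h', h₁ b a (by rw [← h]; exact hF a)]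
    · rw [h, h]
  | isotone =>
    have hmono : Monotone fun x => F ![x] := fun x y h => hF x y h
    exact unary F _ ⟨lowerExt e fun x => F ![x], fun a b => lowerExt_apply he hmono,
      fun x y h => lowerExt_mono _ h⟩
  | isotoneExtensive =>
    have hmono : Monotone fun x => F ![x] := fun x y h => hF.1 x y h
    -- Joining with `y` forces extensivity, and changes nothing at prescribed places because `a ≤ K
    -- a` there.
    refine unary F _ ⟨fun y => y ⊔ lowerExt e (fun x => F ![x]) y, fun a b h => ?_,
      fun x y h => sup_le_sup h (lowerExt_mono _ h), fun x => le_sup_left⟩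
    dsimp only
    rw [lowerExt_apply he hmono h, sup_eq_right, he, ← h]
    exact hF.2 a
  | isotoneContractive =>
    have hmono : Monotone fun x => F ![x] := fun x y h => hF.1 x y h
    exact unary F _ ⟨lowerExt e fun x => F ![x], fun a b => lowerExt_apply he hmono,
      fun x y h => lowerExt_mono _ h, lowerExt_le he hF.2⟩
  | isotoneIdempotent =>
    have hmono : Monotone fun x => F ![x] := fun x y h => hF.1 x y h
    -- The isotone extension alone need not be idempotent: its suprema are therefore rounded up to
    -- infima of prescribed fixed points. These infima are not exceeded by a further `lowerExt`,
    -- which gives one inequality of idempotence; `lowerExt_le_lowerExt` gives the other.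
    refine unary F _ ⟨fun y => closureExt e (fun x => F ![x]) (lowerExt e (fun x => F ![x]) y),
      fun a b h => ?_, fun x y h => closureExt_mono _ (lowerExt_mono _ h), fun y => ?_⟩
    · dsimp only
      rw [lowerExt_apply he hmono h]
      exact closureExt_apply he hmono hF.2 (by rw [← h]; exact hF.2 a) le_rfl
    · change closureExt e (fun x => F ![x]) (lowerExt e (fun x => F ![x])
        (closureExt e (fun x => F ![x]) (lowerExt e (fun x => F ![x]) y))) =
        closureExt e (fun x => F ![x]) (lowerExt e (fun x => F ![x]) y)
      refine le_antisymm ?_ ?_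
      · refine (closureExt_mono _ (lowerExt_closureExt_le he hmono hF.2 _)).trans ?_
        exact (closureExt_idem _ _).le
      · exact closureExt_mono _ (lowerExt_le_lowerExt hF.2 (le_closureExt _ _))
  | closure =>
    have hmono : Monotone fun x => F ![x] := fun x y h => hF.1 x y h
    -- For an extensive `K` the prescribed value at `e a` is itself a closed element above `e a`, so
    -- rounding up suffices by itself.
    exact unary F _ ⟨closureExt e fun x => F ![x],
      fun a b h => closureExt_apply he hmono hF.2.2 h (h ▸ hF.2.1 a),
      fun x y h => closureExt_mono _ h, le_closureExt _, closureExt_idem _⟩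
  | interior =>
    have hmono : Monotone fun x => F ![x] := fun x y h => hF.1 x y h
    have hle := lowerExt_le he hF.2.1
    exact unary F _ ⟨lowerExt e fun x => F ![x], fun a b => lowerExt_apply he hmono,
      fun x y h => lowerExt_mono _ h, hle,
      fun y => le_antisymm (hle _) (lowerExt_le_lowerExt hF.2.2 le_rfl)⟩
  | antitone =>
    have hanti : Antitone fun x => F ![x] := fun x y h => hF x y h
    exact unary F _ ⟨antitoneExt e fun x => F ![x], fun a b => antitoneExt_apply he hanti,
      fun x y h => antitoneExt_anti _ h⟩
  | mixed n i j hn hij =>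
    exact ⟨mixedExt e F i j, fun x b => mixedExt_apply he hF,
      MixedHolds.of_mono hij fun x y h => mixedExt_mono F h⟩
  | mixedAbove n i j p hn hij hp =>
    -- The added supremum only involves arguments with index below `p ≤ i`, so it respects the order
    -- on tuples.
    refine ⟨fun y => (⨆ (k : Fin n) (_ : (k : ℕ) < p), y k) ⊔ mixedExt e F i j y,
      fun x b h => ?_, MixedHolds.of_mono hij fun x y h => sup_le_sup ?_ (mixedExt_mono F h),
      fun k hk y => le_sup_of_le_left (le_iSup₂_of_le k hk le_rfl)⟩
    · dsimp only
      rw [mixedExt_apply he hF.1 h, sup_eq_right]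
      refine iSup₂_le fun k hk => (he _ _).2 ?_
      rw [← h]
      exact hF.2 k hk fun i => (x i : M)
    · exact iSup₂_mono fun k hk => (h k).1 (by omega)

lemma LatTerm.eval_mono [Lattice N] {i : ℕ} (t : LatTerm i) {x y : Fin i → N}
    (h : ∀ a, x a ≤ y a) : t.eval x ≤ t.eval y := by
  induction t with
  | var a => exact h a
  | sup s t ih₁ ih₂ => exact sup_le_sup ih₁ ih₂
  | inf s t ih₁ ih₂ => exact inf_le_inf ih₁ ih₂

/-- The domain is closed under joins and meets and `e` preserves them, so the lower bound given by
`t` has the same meaning in `M` and `N`. An order embedding alone would not do. -/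
lemma LatTerm.exists_eval [Lattice M] [Lattice N]
    (hsup : ∀ a b : A, ∃ c : A, (c : M) = (a : M) ⊔ (b : M) ∧ e c = e a ⊔ e b)
    (hinf : ∀ a b : A, ∃ c : A, (c : M) = (a : M) ⊓ (b : M) ∧ e c = e a ⊓ e b) {i : ℕ} (t : LatTerm i)
    (x : Fin i → A) :
    ∃ c : A, (c : M) = t.eval (fun k => (x k : M)) ∧ e c = t.eval fun k => e (x k) := by
  induction t with
  | var a => exact ⟨x a, rfl, rfl⟩
  | sup s t ih₁ ih₂ =>
    obtain ⟨c, h₁, h₂⟩ := ih₁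
    obtain ⟨d, h₃, h₄⟩ := ih₂
    obtain ⟨f, h₅, h₆⟩ := hsup c d
    exact ⟨f, by rw [h₅, h₁, h₃]; rfl, by rw [h₆, h₂, h₄]; rfl⟩
  | inf s t ih₁ ih₂ =>
    obtain ⟨c, h₁, h₂⟩ := ih₁
    obtain ⟨d, h₃, h₄⟩ := ih₂
    obtain ⟨f, h₅, h₆⟩ := hinf c d
    exact ⟨f, by rw [h₅, h₁, h₃]; rfl, by rw [h₆, h₂, h₄]; rfl⟩

/-- A partial operation on a lattice with a property as in `LatOpCond` can be extended to
an operation on a complete lattice with the same property. -/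
theorem LatOpCond.exists_extension [Lattice M] [CompleteLattice N]
    (he : ∀ a b, e a ≤ e b ↔ (a : M) ≤ b)
    (hsup : ∀ a b : A, ∃ c : A, (c : M) = (a : M) ⊔ (b : M) ∧ e c = e a ⊔ e b)
    (hinf : ∀ a b : A, ∃ c : A, (c : M) = (a : M) ⊓ (b : M) ∧ e c = e a ⊓ e b)
    {n : ℕ} (c : LatOpCond n) {F : (Fin n → M) → M} (hF : c.Holds F) :
    ∃ F' : (Fin n → N) → N, (∀ (x : Fin n → A) (b : A), F (fun i => (x i : M)) = b →
      F' (fun i => e (x i)) = e b) ∧ c.Holds F' := by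
  cases c with
  | basic c => exact c.exists_extension he hF
  | mixedAboveTerm i j hn hij t =>
    have hi : i ≤ n := le_trans (Nat.le_add_right i j) hij
    refine ⟨fun y => t.eval (fun a => y (Fin.castLE hi a)) ⊔ mixedExt e F i j y,
      fun x b h => ?_, MixedHolds.of_mono hij fun x y h => sup_le_sup ?_ (mixedExt_mono F h),
      fun y => le_sup_left⟩
    · dsimp only
      rw [mixedExt_apply he hF.1 h, sup_eq_right]
      obtain ⟨d, h₁, h₂⟩ := t.exists_eval hsup hinf fun a => x (Fin.castLE hi a)
      rw [← h₂, he, h₁, ← h]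
      exact hF.2 fun i => (x i : M)
    · exact t.eval_mono fun a => (h _).1 (by simp)

end Extensions

/-! ### Translating the axioms into order-theoretic conditions -/

section Realization

variable {L : FirstOrder.Language.{0, 0}} {M : Type} [L.Structure M]

lemma snoc_one (x : M) : (Fin.snoc default x : Fin 1 → M) = ![x] := by
  funext i
  fin_cases i
  rfl

lemma snoc_two (x y : M) : (Fin.snoc ![x] y : Fin 2 → M) = ![x, y] := by
  funext i
  fin_cases i <;> rfl

lemma snoc_three (x y z : M) : (Fin.snoc ![x, y] z : Fin 3 → M) = ![x, y, z] := by
  funext i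
  fin_cases i <;> rfl

lemma realize_all_one {φ : L.BoundedFormula Empty 1} :
    M ⊨ (∀' φ : L.Sentence) ↔ ∀ x : M, φ.Realize default ![x] := by
  simp only [Sentence.Realize, Formula.Realize, BoundedFormula.realize_all, snoc_one]

lemma realize_all_two {φ : L.BoundedFormula Empty 2} :
    M ⊨ (∀' ∀' φ : L.Sentence) ↔ ∀ x y : M, φ.Realize default ![x, y] := by
  simp only [realize_all_one, BoundedFormula.realize_all, snoc_two]

lemma realize_all_three {φ : L.BoundedFormula Empty 3} :
    M ⊨ (∀' ∀' ∀' φ : L.Sentence) ↔ ∀ x y z : M, φ.Realize default ![x, y, z] := by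
  simp only [realize_all_two, BoundedFormula.realize_all, snoc_three]

lemma realize_alls_iff {n : ℕ} {φ : L.BoundedFormula Empty n} :
    M ⊨ (φ.alls : L.Sentence) ↔ ∀ x : Fin n → M, φ.Realize default x :=
  BoundedFormula.realize_alls

/-- The formula `le` expresses the order of `M`. -/
def LeSpec (le : LeFormula L) (M : Type) [L.Structure M] [LE M] : Prop :=
  ∀ (n : ℕ) (s t : L.Term (Empty ⊕ Fin n)) (x : Fin n → M), (le n s t).Realize default x ↔
    s.realize (Sum.elim default x) ≤ t.realize (Sum.elim default x)

lemma realize_argTerms {n : ℕ} (x : Fin (n + 1) → M) :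
    (fun k => (argTerms (L := L) n k).realize (Sum.elim default x)) = Fin.init x := rfl

lemma realize_argTermsUpdate {n : ℕ} (h : Fin n) (x : Fin (n + 1) → M) :
    (fun k => (argTermsUpdate (L := L) n h k).realize (Sum.elim default x)) =
      Function.update (Fin.init x) h (x (Fin.last n)) := by
  funext k
  by_cases hk : k = h
  · subst hk
    simp [argTermsUpdate]
  · simp [argTermsUpdate, Function.update_of_ne hk, argTerms, Fin.init]

/-- In the one-coordinate axioms the last variable is the replacement value and the others form the
argument tuple. -/
lemma forall_fin_succ_iff {n : ℕ} {P : (Fin n → M) → M → Prop} :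
    (∀ x : Fin (n + 1) → M, P (Fin.init x) (x (Fin.last n))) ↔ ∀ x y, P x y :=
  ⟨fun H x y => by simpa using H (Fin.snoc x y), fun H x => H _ _⟩

variable {le : LeFormula L}

lemma realize_isotoneOnAx [LE M] (hle : LeSpec le M) {n : ℕ} (F : L.Functions n) (h : Fin n) :
    M ⊨ isotoneOnAx le F h ↔ ∀ (x : Fin n → M) (y : M), x h ≤ y →
      Structure.funMap F x ≤ Structure.funMap F (Function.update x h y) := by
  rw [isotoneOnAx, realize_alls_iff, ← forall_fin_succ_iff]
  refine forall_congr' fun x => ?_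
  rw [BoundedFormula.realize_imp, hle, hle]
  simp only [Term.realize_func, realize_argTerms, realize_argTermsUpdate]
  rfl

lemma realize_antitoneOnAx [LE M] (hle : LeSpec le M) {n : ℕ} (F : L.Functions n) (h : Fin n) :
    M ⊨ antitoneOnAx le F h ↔ ∀ (x : Fin n → M) (y : M), x h ≤ y →
      Structure.funMap F (Function.update x h y) ≤ Structure.funMap F x := by
  rw [antitoneOnAx, realize_alls_iff, ← forall_fin_succ_iff]
  refine forall_congr' fun x => ?_
  rw [BoundedFormula.realize_imp, hle, hle]
  simp only [Term.realize_func, realize_argTerms, realize_argTermsUpdate]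
  rfl

lemma realize_aboveArgAx [LE M] (hle : LeSpec le M) {n : ℕ} (F : L.Functions n) (h : Fin n) :
    M ⊨ aboveArgAx le F h ↔ ∀ x : Fin n → M, x h ≤ Structure.funMap F x := by
  rw [aboveArgAx, realize_alls_iff]
  exact forall_congr' fun x => hle _ _ _ _

lemma models_mixedAx [LE M] (hle : LeSpec le M) {n : ℕ} (F : L.Functions n) (i j : ℕ) :
    M ⊨ mixedAx le F i j ↔ MixedHolds (fun x : Fin n → M => Structure.funMap F x) i j := by
  rw [mixedAx, Theory.model_union_iff, Theory.model_iff, Theory.model_iff]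
  refine and_congr ⟨fun H h hi => ?_, ?_⟩ ⟨fun H h hi => ?_, ?_⟩
  · exact (realize_isotoneOnAx hle F h).1 (H _ ⟨h, hi, rfl⟩)
  · rintro H _ ⟨h, hi, rfl⟩
    exact (realize_isotoneOnAx hle F h).2 (H h hi)
  · exact (realize_antitoneOnAx hle F h).1 (H _ ⟨h, hi, rfl⟩)
  · rintro H _ ⟨h, hi, rfl⟩
    exact (realize_antitoneOnAx hle F h).2 (H h hi)

lemma realize_extensiveAx [LE M] (hle : LeSpec le M) (K : L.Functions 1) :
    M ⊨ extensiveAx le K ↔ ∀ x : M, x ≤ Structure.funMap K ![x] := by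
  rw [extensiveAx, realize_all_one]
  exact forall_congr' fun x => (hle _ _ _ _).trans (by simp)

lemma realize_contractiveAx [LE M] (hle : LeSpec le M) (K : L.Functions 1) :
    M ⊨ contractiveAx le K ↔ ∀ x : M, Structure.funMap K ![x] ≤ x := by
  rw [contractiveAx, realize_all_one]
  exact forall_congr' fun x => (hle _ _ _ _).trans (by simp)

lemma realize_isotoneAx [LE M] (hle : LeSpec le M) (K : L.Functions 1) :
    M ⊨ isotoneAx le K ↔
      ∀ x y : M, x ≤ y → Structure.funMap K ![x] ≤ Structure.funMap K ![y] := by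
  rw [isotoneAx, realize_all_two]
  refine forall₂_congr fun x y => ?_
  rw [BoundedFormula.realize_imp, hle, hle]
  simp

lemma realize_antitoneAx [LE M] (hle : LeSpec le M) (K : L.Functions 1) :
    M ⊨ antitoneAx le K ↔
      ∀ x y : M, x ≤ y → Structure.funMap K ![y] ≤ Structure.funMap K ![x] := by
  rw [antitoneAx, realize_all_two]
  refine forall₂_congr fun x y => ?_
  rw [BoundedFormula.realize_imp, hle, hle]
  simp

lemma realize_idempotentAx (K : L.Functions 1) :
    M ⊨ idempotentAx K ↔
      ∀ x : M, Structure.funMap K ![Structure.funMap K ![x] ] = Structure.funMap K ![x] := by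
  rw [idempotentAx, realize_all_one]
  simp

lemma realize_involutiveAx (K : L.Functions 1) :
    M ⊨ involutiveAx K ↔ ∀ x : M, Structure.funMap K ![Structure.funMap K ![x] ] = x := by
  rw [involutiveAx, realize_all_one]
  simp

/-- Used in both directions: to read the property off `M`, and to turn the property of the extended
operation into axioms true in `N`. -/
lemma OpCond.models_axioms [LE M] (hle : LeSpec le M) {n : ℕ} (c : OpCond n) (F : L.Functions n) :
    M ⊨ c.axioms le F ↔ c.Holds fun x : Fin n → M => Structure.funMap F x := by
  cases c <;> simp only [OpCond.axioms, OpCond.Holds, Theory.model_singleton_iff,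
    Theory.model_insert_iff, realize_extensiveAx hle, realize_contractiveAx hle,
    realize_isotoneAx hle, realize_antitoneAx hle, realize_idempotentAx, realize_involutiveAx,
    models_mixedAx hle, Theory.model_union_iff]
  refine and_congr_right fun _ => ?_
  simp only [Theory.model_iff, Set.mem_ofPred_eq, forall_exists_index, and_imp]
  refine ⟨fun H k hk => ?_, fun H σ k hk hσ => ?_⟩
  · exact (realize_aboveArgAx hle F k).1 (H _ k hk rfl)
  · exact hσ ▸ (realize_aboveArgAx hle F k).2 (H k hk)

end Realization

section LatticeRealization

variable {L : FirstOrder.Language.{0, 0}} {M : Type} [L.Structure M] [Lattice M]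

lemma LatTerm.realize_toTerm {sup inf : L.Functions 2}
    (hsup : ∀ x y : M, Structure.funMap sup ![x, y] = x ⊔ y)
    (hinf : ∀ x y : M, Structure.funMap inf ![x, y] = x ⊓ y) {i : ℕ} {α : Type}
    (x : Fin i → L.Term α) (v : α → M) (t : LatTerm i) :
    (t.toTerm sup inf x).realize v = t.eval fun a => (x a).realize v := by
  induction t with
  | var a => rfl
  | sup s t ih₁ ih₂ => simp [LatTerm.toTerm, LatTerm.eval, hsup, ih₁, ih₂]
  | inf s t ih₁ ih₂ => simp [LatTerm.toTerm, LatTerm.eval, hinf, ih₁, ih₂]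

lemma LatOpCond.models_axioms {le : LeFormula L} (hle : LeSpec le M) {sup inf : L.Functions 2}
    (hsup : ∀ x y : M, Structure.funMap sup ![x, y] = x ⊔ y)
    (hinf : ∀ x y : M, Structure.funMap inf ![x, y] = x ⊓ y) {n : ℕ} (c : LatOpCond n)
    (F : L.Functions n) :
    M ⊨ c.axioms le sup inf F ↔ c.Holds fun x : Fin n → M => Structure.funMap F x := by
  cases c with
  | basic c => exact c.models_axioms hle F
  | mixedAboveTerm i j hn hij t =>
    simp only [LatOpCond.axioms, LatOpCond.Holds, Theory.model_singleton_iff,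
      models_mixedAx hle, Theory.model_union_iff]
    refine and_congr_right fun _ => ?_
    rw [aboveTermAx, realize_alls_iff]
    refine forall_congr' fun x => (hle _ _ _ _).trans ?_
    rw [LatTerm.realize_toTerm hsup hinf]
    rfl

end LatticeRealization

/-! ### The new axioms are finitely many universal sentences -/

section QuantifierFree

open BoundedFormula

variable {L : FirstOrder.Language.{0, 0}} {le : LeFormula L}

lemma isQF_equal {n : ℕ} (s t : L.Term (Empty ⊕ Fin n)) : (s =' t).IsQF :=
  (IsAtomic.equal s t).isQF

lemma relLe_isQF (R : L.Relations 2) (n : ℕ) (s t : L.Term (Empty ⊕ Fin n)) :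
    (relLe R n s t).IsQF := Relations.isQF _ _

lemma infLe_isQF (inf : L.Functions 2) (n : ℕ) (s t : L.Term (Empty ⊕ Fin n)) :
    (infLe inf n s t).IsQF := isQF_equal _ _

lemma mixedAx_isUniversal (hle : ∀ n s t, (le n s t).IsQF) {n : ℕ} (F : L.Functions n)
    (i j : ℕ) : ∀ σ ∈ mixedAx le F i j, BoundedFormula.IsUniversal σ := by
  rintro σ (⟨h, -, rfl⟩ | ⟨h, -, rfl⟩)
  · exact isUniversal_alls ((hle _ _ _).imp (hle _ _ _)).isUniversal
  · exact isUniversal_alls ((hle _ _ _).imp (hle _ _ _)).isUniversal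

lemma mixedAx_finite {n : ℕ} (F : L.Functions n) (i j : ℕ) : (mixedAx le F i j).Finite := by
  refine ((Set.finite_range fun h => isotoneOnAx le F h).subset ?_).union
    ((Set.finite_range fun h => antitoneOnAx le F h).subset ?_)
  · rintro σ ⟨h, -, rfl⟩
    exact ⟨h, rfl⟩
  · rintro σ ⟨h, -, rfl⟩
    exact ⟨h, rfl⟩

lemma OpCond.axioms_finite {n : ℕ} (c : OpCond n) (F : L.Functions n) :
    (c.axioms le F).Finite := by
  cases c <;> simp only [OpCond.axioms, Set.finite_singleton, Set.finite_insert, Set.finite_union,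
    mixedAx_finite, true_and]
  refine (Set.finite_range fun h => aboveArgAx le F h).subset ?_
  rintro σ ⟨h, -, rfl⟩
  exact ⟨h, rfl⟩

lemma OpCond.axioms_isUniversal (hle : ∀ n s t, (le n s t).IsQF) {n : ℕ} (c : OpCond n)
    (F : L.Functions n) : ∀ σ ∈ c.axioms le F, BoundedFormula.IsUniversal σ := by
  have h₁ (K : L.Functions 1) : BoundedFormula.IsUniversal (extensiveAx le K) :=
    (hle _ _ _).isUniversal.all
  have h₂ (K : L.Functions 1) : BoundedFormula.IsUniversal (contractiveAx le K) :=
    (hle _ _ _).isUniversal.all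
  have h₃ (K : L.Functions 1) : BoundedFormula.IsUniversal (idempotentAx K) :=
    (isQF_equal _ _).isUniversal.all
  have h₄ (K : L.Functions 1) : BoundedFormula.IsUniversal (involutiveAx K) :=
    (isQF_equal _ _).isUniversal.all
  have h₅ (K : L.Functions 1) : BoundedFormula.IsUniversal (isotoneAx le K) :=
    ((hle _ _ _).imp (hle _ _ _)).isUniversal.all.all
  have h₆ (K : L.Functions 1) : BoundedFormula.IsUniversal (antitoneAx le K) :=
    ((hle _ _ _).imp (hle _ _ _)).isUniversal.all.all
  have h₇ := mixedAx_isUniversal hle F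
  cases c <;> simp only [OpCond.axioms, Set.mem_singleton_iff, Set.mem_insert_iff, forall_eq,
    forall_eq_or_imp, h₁, h₂, h₃, h₄, h₅, h₆, and_self]
  · exact h₇ _ _
  · rintro σ (hσ | ⟨h, -, rfl⟩)
    · exact h₇ _ _ σ hσ
    · exact isUniversal_alls (hle _ _ _).isUniversal

lemma LatOpCond.axioms_finite {sup inf : L.Functions 2} {n : ℕ} (c : LatOpCond n)
    (F : L.Functions n) : (c.axioms le sup inf F).Finite := by
  cases c with
  | basic c => exact c.axioms_finite F
  | mixedAboveTerm => exact (mixedAx_finite F _ _).union (Set.finite_singleton _)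

lemma LatOpCond.axioms_isUniversal (hle : ∀ n s t, (le n s t).IsQF) {sup inf : L.Functions 2}
    {n : ℕ} (c : LatOpCond n) (F : L.Functions n) :
    ∀ σ ∈ c.axioms le sup inf F, BoundedFormula.IsUniversal σ := by
  cases c with
  | basic c => exact c.axioms_isUniversal hle F
  | mixedAboveTerm =>
    rintro σ (hσ | rfl)
    · exact mixedAx_isUniversal hle F _ _ σ hσ
    · exact isUniversal_alls (hle _ _ _).isUniversal

end QuantifierFree

/-! ### The two general decidability results for added operations -/

section General

variable {L : FirstOrder.Language.{0, 0}} {q : ℕ} {ar : Fin q → ℕ}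

lemma leSpec_relLe {R : L.Relations 2} {M : Type} [L.Structure M]
    [(L.sum (opLang ar)).Structure M] [(LHom.sumInl : L →ᴸ L.sum (opLang ar)).IsExpansionOn M]
    [LE M] (hR : ∀ x y : M, Structure.RelMap R ![x, y] ↔ x ≤ y) :
    LeSpec (L := L.sum (opLang ar)) (relLe (Sum.inl R)) M := by
  intro n s t x
  refine BoundedFormula.realize_rel₂.trans ?_
  rw [← hR, ← (LHom.sumInl : L →ᴸ L.sum (opLang ar)).map_onRelation]
  rfl

lemma leSpec_infLe {inf : L.Functions 2} {M : Type} [L.Structure M]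
    [(L.sum (opLang ar)).Structure M] [(LHom.sumInl : L →ᴸ L.sum (opLang ar)).IsExpansionOn M]
    [Lattice M] (hinf : ∀ x y : M, Structure.funMap inf ![x, y] = x ⊓ y) :
    LeSpec (L := L.sum (opLang ar)) (infLe (Sum.inl inf)) M := by
  intro n s t x
  have h : (Functions.apply₂ (L := L.sum (opLang ar)) (Sum.inl inf) s t).realize
      (Sum.elim default x) =
        s.realize (Sum.elim default x) ⊓ t.realize (Sum.elim default x) :=
    Term.realize_functions_apply₂.trans
      (((LHom.sumInl : L →ᴸ L.sum (opLang ar)).map_onFunction inf _).trans (hinf _ _))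
  exact (BoundedFormula.realize_bdEqual _ _).trans
    ((iff_of_eq (congrArg (· = _) h)).trans inf_eq_left)

/-- Decidability for extensions of a locally finite universal theory of lattices. -/
theorem withLatOps_decidable {ν : SymbolNumbering L} {T : L.Theory} {sup inf : L.Functions 2}
    {g : ℕ → ℕ} (huniv : T.IsUniversal) (hfmd : ν.FiniteModelsDecidable T) (hg : Computable g)
    (hlf : LocallyFiniteWithBound T g) {le : LeFormula (L.sum (opLang ar))}
    (hqf : ∀ n s t, (le n s t).IsQF)
    (hlat : ∀ (M : Type) [L.Structure M] [M ⊨ T] [Nonempty M], ∃ _ : Lattice M,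
      (∀ x y : M, Structure.funMap sup ![x, y] = x ⊔ y) ∧
      ∀ x y : M, Structure.funMap inf ![x, y] = x ⊓ y)
    (hle : ∀ (M : Type) [L.Structure M] [(L.sum (opLang ar)).Structure M]
      [(LHom.sumInl : L →ᴸ L.sum (opLang ar)).IsExpansionOn M] [M ⊨ T] [Lattice M],
      (∀ x y : M, Structure.funMap inf ![x, y] = x ⊓ y) → LeSpec le M)
    (c : ∀ k, LatOpCond (ar k)) : UniversalConsequencesDecidable (withLatOps T sup inf le c) := by
  refine universalConsequencesDecidable_of_extension hfmd
    (Set.finite_iUnion fun k => (c k).axioms_finite _) ⟨fun σ hσ => ?_⟩ hg ?_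
  · obtain ⟨k, hk⟩ := Set.mem_iUnion.1 hσ
    exact (c k).axioms_isUniversal hqf _ σ hk
  intro M _ _ hT hAx m v hm
  let _ : L.Structure M := (LHom.sumInl : L →ᴸ L.sum (opLang ar)).reduct M
  let S := Substructure.closure L (Set.range v)
  have hvS : Set.range v ⊆ S := Substructure.subset_closure
  -- Universal sentences pass to substructures.
  have hS : S ⊨ T := inferInstance
  obtain ⟨hfin, hcard⟩ := hlf m S (fun i => ⟨v i, hvS ⟨i, rfl⟩⟩) (by
    rw [eq_top_iff]
    rintro ⟨x, hx⟩ -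
    induction hx using Substructure.closure_induction' with
    | Hs x hx =>
      obtain ⟨i, rfl⟩ := hx
      exact Substructure.subset_closure ⟨i, rfl⟩
    | Hfun f =>
      intro y hy
      choose h₁ h₂ using hy
      exact ⟨Substructure.fun_mem S f y h₁, Substructure.fun_mem (Substructure.closure L
        (Set.range fun i => (⟨v i, hvS ⟨i, rfl⟩⟩ : S))) f (fun i => (⟨y i, h₁ i⟩ : S)) h₂⟩)
  -- A copy of `S` on a separate type, so that its lattice order comes from the structure alone and
  -- does not compete with the order that `S` inherits from `M`.
  obtain ⟨N, ⟨e₀⟩⟩ : ∃ N : Type, Nonempty (S ≃ N) := ⟨S, ⟨Equiv.refl _⟩⟩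
  let _ : L.Structure N := e₀.inducedStructure
  let e : S ≃[L] N := e₀.inducedStructureEquiv
  have hN : N ⊨ T := StrongHomClass.theory_model e
  have : Nonempty N := ⟨e ⟨v ⟨0, hm⟩, hvS ⟨_, rfl⟩⟩⟩
  have : Finite N := Finite.of_equiv S e₀
  obtain ⟨_, hsupM, hinfM⟩ := hlat M
  obtain ⟨_, hsupN, hinfN⟩ := hlat N
  -- A finite nonempty lattice is complete, so partial operations can be extended.
  let _ : Fintype N := Fintype.ofFinite N
  let _ : BoundedOrder N := Fintype.toBoundedOrder N
  let _ : CompleteLattice N := Fintype.toCompleteLattice N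
  have hcoe (f : L.Functions 2) (a b : S) :
      ((Structure.funMap f ![a, b] : S) : M) = Structure.funMap f ![(a : M), (b : M)] := by
    change Structure.funMap f (fun i => ((![a, b] i : S) : M)) = _
    congr 1
    funext i
    fin_cases i <;> rfl
  have hmap (f : L.Functions 2) (a b : S) :
      e (Structure.funMap f ![a, b]) = Structure.funMap f ![e a, e b] := by
    rw [HomClass.map_fun]
    congr 1
    funext i
    fin_cases i <;> rfl
  have hsup (a b : S) : ∃ c : S, (c : M) = (a : M) ⊔ (b : M) ∧ e c = e a ⊔ e b :=
    ⟨Structure.funMap sup ![a, b], by rw [hcoe, hsupM], by rw [hmap, hsupN]⟩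
  have hinf (a b : S) : ∃ c : S, (c : M) = (a : M) ⊓ (b : M) ∧ e c = e a ⊓ e b :=
    ⟨Structure.funMap inf ![a, b], by rw [hcoe, hinfM], by rw [hmap, hinfN]⟩
  -- The order is expressed by meets, which the isomorphism preserves.
  have he (a b : S) : e a ≤ e b ↔ (a : M) ≤ b := by
    obtain ⟨c, h₁, h₂⟩ := hinf a b
    rw [← inf_eq_left, ← inf_eq_left, ← h₁, ← h₂, e.injective.eq_iff, Subtype.ext_iff]
  have hF (k : Fin q) := (c k).exists_extension (A := (S : Set M)) (e := e) he hsup hinf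
    (((c k).models_axioms (hle M hinfM) (L := L.sum (opLang ar)) (sup := Sum.inl sup)
      (inf := Sum.inl inf) hsupM hinfM (opSymbol L ar k)).1
      (hAx.mono (Set.subset_iUnion_of_subset k subset_rfl)))
  choose F hF₁ hF₂ using hF
  refine ⟨N, inferInstance, hN, inferInstance, (Nat.card_congr e₀).symm.trans_le hcard, S, e, hvS,
    ⟨e.injective, fun f x b hb => ?_, fun R x => e.map_rel R x⟩, F, hF₁, ?_⟩
  · have h : Structure.funMap (M := S) f x = b := Subtype.ext hb
    rw [← h]
    exact (e.map_fun f x).symm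
  let _ := opStructure F
  refine Theory.model_iff _ |>.2 fun σ hσ => ?_
  obtain ⟨k, hk⟩ := Set.mem_iUnion.1 hσ
  have := ((c k).models_axioms (L := L.sum (opLang ar)) (F := opSymbol L ar k) (hle N hinfN)
    (sup := Sum.inl sup) (inf := Sum.inl inf) hsupN hinfN).2 (hF₂ k)
  exact (Theory.model_iff _).1 this σ hk

/-- Decidability for extensions of a theory of partially ordered structures, finite subsets of
which can be embedded in finite complete lattices that are models. -/
theorem withOps_decidable {ν : SymbolNumbering L} {T : L.Theory} {R : L.Relations 2}
    {g : ℕ → ℕ} (hfmd : ν.FiniteModelsDecidable T) (hg : Computable g)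
    (H : ∀ (M : Type) [L.Structure M] [M ⊨ T], ∃ _ : PartialOrder M,
      (∀ x y : M, Structure.RelMap R ![x, y] ↔ x ≤ y) ∧ ∀ (m : ℕ) (v : Fin m → M),
      ∃ (N : Type) (_ : L.Structure N) (_ : CompleteLattice N), N ⊨ T ∧
        (∀ x y : N, Structure.RelMap R ![x, y] ↔ x ≤ y) ∧ Finite N ∧ Nat.card N ≤ g m ∧
        ∃ (A : Set M) (e : A → N), Set.range v ⊆ A ∧ IsPartialEmbedding L A e)
    (c : ∀ k, OpCond (ar k)) :
    UniversalConsequencesDecidable (withOps T (relLe (Sum.inl R)) c) := by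
  refine universalConsequencesDecidable_of_extension hfmd
    (Set.finite_iUnion fun k => (c k).axioms_finite _) ⟨fun σ hσ => ?_⟩ hg ?_
  · obtain ⟨k, hk⟩ := Set.mem_iUnion.1 hσ
    exact (c k).axioms_isUniversal (relLe_isQF _) _ σ hk
  intro M _ _ hT hAx m v hm
  let _ : L.Structure M := (LHom.sumInl : L →ᴸ L.sum (opLang ar)).reduct M
  obtain ⟨_, hRM, H⟩ := H M
  obtain ⟨N, _, _, hN, hRN, hfin, hcard, A, e, hvA, he⟩ := H m v
  -- Compatibility with `R` on pairs is what makes `e` an order embedding.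
  have hle (a b : A) : e a ≤ e b ↔ (a : M) ≤ b := by
    rw [← hRM, ← hRN]
    have h := he.map_rel R ![a, b]
    have h₁ : (fun i => e (![a, b] i)) = ![e a, e b] := by
      funext i
      fin_cases i <;> rfl
    have h₂ : (fun i => ((![a, b] i : A) : M)) = ![(a : M), (b : M)] := by
      funext i
      fin_cases i <;> rfl
    rwa [h₁, h₂] at h
  have hF (k : Fin q) := (c k).exists_extension (A := A) (e := e) hle
    (((c k).models_axioms (leSpec_relLe hRM) (opSymbol L ar k)).1
      (hAx.mono (Set.subset_iUnion_of_subset k subset_rfl)))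
  choose F hF₁ hF₂ using hF
  refine ⟨N, inferInstance, hN, hfin, hcard, A, e, hvA, he, F, hF₁, ?_⟩
  let _ := opStructure F
  refine Theory.model_iff _ |>.2 fun σ hσ => ?_
  obtain ⟨k, hk⟩ := Set.mem_iUnion.1 hσ
  have := ((c k).models_axioms (F := opSymbol L ar k) (leSpec_relLe hRN)).2 (hF₂ k)
  exact (Theory.model_iff _).1 this σ hk

end General

/-! ### The axioms of semilattices, lattices and Boolean algebras in models -/

section Models

variable {L : FirstOrder.Language.{0, 0}} {M : Type} [L.Structure M]

lemma models_semilatticeAxioms (f : L.Functions 2) : M ⊨ semilatticeAxioms f ↔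
    (∀ x y : M, Structure.funMap f ![x, y] = Structure.funMap f ![y, x]) ∧
    (∀ x y z : M, Structure.funMap f ![Structure.funMap f ![x, y], z] =
      Structure.funMap f ![x, Structure.funMap f ![y, z] ]) ∧
    ∀ x : M, Structure.funMap f ![x, x] = x := by
  rw [semilatticeAxioms, Theory.model_insert_iff, Theory.model_insert_iff,
    Theory.model_singleton_iff, realize_all_two, realize_all_three, realize_all_one]
  simp only [BoundedFormula.realize_bdEqual, Term.realize_functions_apply₂]
  rfl

lemma models_latticeAxioms (sup inf : L.Functions 2) : M ⊨ latticeAxioms sup inf ↔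
    (M ⊨ semilatticeAxioms sup ∧ M ⊨ semilatticeAxioms inf) ∧
    (∀ x y : M, Structure.funMap sup ![x, Structure.funMap inf ![x, y] ] = x) ∧
    ∀ x y : M, Structure.funMap inf ![x, Structure.funMap sup ![x, y] ] = x := by
  simp only [latticeAxioms, Theory.model_union_iff, Theory.model_insert_iff,
    Theory.model_singleton_iff, realize_all_two, BoundedFormula.realize_bdEqual,
    Term.realize_functions_apply₂]
  rfl

lemma realize_infOrderAx (R : L.Relations 2) (inf : L.Functions 2) : M ⊨ infOrderAx R inf ↔
    ∀ x y : M, Structure.RelMap R ![x, y] ↔ Structure.funMap inf ![x, y] = x := by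
  simp only [infOrderAx, realize_all_two, BoundedFormula.realize_iff, BoundedFormula.realize_rel₂,
    BoundedFormula.realize_bdEqual, Term.realize_functions_apply₂]
  rfl

lemma realize_supOrderAx (R : L.Relations 2) (sup : L.Functions 2) : M ⊨ supOrderAx R sup ↔
    ∀ x y : M, Structure.RelMap R ![x, y] ↔ Structure.funMap sup ![x, y] = y := by
  simp only [supOrderAx, realize_all_two, BoundedFormula.realize_iff, BoundedFormula.realize_rel₂,
    BoundedFormula.realize_bdEqual, Term.realize_functions_apply₂]
  rfl

lemma realize_distribAx (sup inf : L.Functions 2) : M ⊨ distribAx sup inf ↔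
    ∀ x y z : M, Structure.funMap inf ![x, Structure.funMap sup ![y, z] ] =
      Structure.funMap sup ![Structure.funMap inf ![x, y], Structure.funMap inf ![x, z] ] := by
  simp only [distribAx, realize_all_three, BoundedFormula.realize_bdEqual,
    Term.realize_functions_apply₂]
  rfl

lemma models_complementAxioms (sup inf : L.Functions 2) (compl : L.Functions 1)
    (bot top : L.Functions 0) : M ⊨ complementAxioms sup inf compl bot top ↔
    (∀ x : M, Structure.funMap sup ![x, Structure.funMap bot ![] ] = x) ∧
    (∀ x : M, Structure.funMap inf ![x, Structure.funMap top ![] ] = x) ∧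
    (∀ x : M, Structure.funMap sup ![x, Structure.funMap compl ![x] ] =
      Structure.funMap top ![]) ∧
    ∀ x : M, Structure.funMap inf ![x, Structure.funMap compl ![x] ] =
      Structure.funMap bot ![] := by
  have h (c : L.Functions 0) (x : Fin 1 → M) :
      (Constants.term c : L.Term (Empty ⊕ Fin 1)).realize (Sum.elim default x) =
        Structure.funMap c ![] := by
    rw [Constants.term, Term.realize_func]
    exact congrArg _ (Subsingleton.elim _ _)
  simp only [complementAxioms, Theory.model_insert_iff, Theory.model_singleton_iff,
    realize_all_one, BoundedFormula.realize_bdEqual, Term.realize_functions_apply₁,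
    Term.realize_functions_apply₂, h]
  rfl

lemma exists_lattice {sup inf : L.Functions 2} (h : M ⊨ latticeAxioms sup inf) :
    ∃ _ : Lattice M, (∀ x y : M, Structure.funMap sup ![x, y] = x ⊔ y) ∧
      ∀ x y : M, Structure.funMap inf ![x, y] = x ⊓ y := by
  rw [models_latticeAxioms, models_semilatticeAxioms, models_semilatticeAxioms] at h
  let _ : Max M := ⟨fun x y => Structure.funMap sup ![x, y]⟩
  let _ : Min M := ⟨fun x y => Structure.funMap inf ![x, y]⟩
  exact ⟨Lattice.mk' h.1.1.1 h.1.1.2.1 h.1.2.1 h.1.2.2.1 h.2.1 h.2.2,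
    fun _ _ => rfl, fun _ _ => rfl⟩

end Models

/-! ### The concrete theories are finite and universal, in finite languages -/

section Universal

open BoundedFormula

variable {L : FirstOrder.Language.{0, 0}}

lemma semilatticeAxioms_isUniversal (f : L.Functions 2) : (semilatticeAxioms f).IsUniversal := by
  refine ⟨?_⟩
  rintro σ (rfl | rfl | rfl)
  exacts [(isQF_equal _ _).isUniversal.all.all, (isQF_equal _ _).isUniversal.all.all.all,
    (isQF_equal _ _).isUniversal.all]

lemma isUniversal_union {T T' : L.Theory} (h : T.IsUniversal) (h' : T'.IsUniversal) :
    (T ∪ T').IsUniversal :=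
  ⟨fun _ hσ => hσ.elim (fun h₁ => h.isUniversal_of_mem h₁) fun h₁ => h'.isUniversal_of_mem h₁⟩

lemma latticeAxioms_isUniversal (sup inf : L.Functions 2) :
    (latticeAxioms sup inf).IsUniversal := by
  refine isUniversal_union (isUniversal_union (semilatticeAxioms_isUniversal _)
    (semilatticeAxioms_isUniversal _)) ⟨?_⟩
  rintro σ (rfl | rfl)
  exacts [(isQF_equal _ _).isUniversal.all.all, (isQF_equal _ _).isUniversal.all.all]

lemma isQF_iff {n : ℕ} {φ ψ : L.BoundedFormula Empty n} (hφ : φ.IsQF) (hψ : ψ.IsQF) :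
    (φ.iff ψ).IsQF := (hφ.imp hψ).inf (hψ.imp hφ)

lemma infOrderAx_isUniversal (R : L.Relations 2) (inf : L.Functions 2) :
    BoundedFormula.IsUniversal (infOrderAx R inf) :=
  (isQF_iff (Relations.isQF _ _) (isQF_equal _ _)).isUniversal.all.all

lemma supOrderAx_isUniversal (R : L.Relations 2) (sup : L.Functions 2) :
    BoundedFormula.IsUniversal (supOrderAx R sup) :=
  (isQF_iff (Relations.isQF _ _) (isQF_equal _ _)).isUniversal.all.all

lemma distribAx_isUniversal (sup inf : L.Functions 2) :
    BoundedFormula.IsUniversal (distribAx sup inf) :=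
  (isQF_equal _ _).isUniversal.all.all.all

lemma complementAxioms_isUniversal (sup inf : L.Functions 2) (compl : L.Functions 1)
    (bot top : L.Functions 0) : (complementAxioms sup inf compl bot top).IsUniversal := by
  refine ⟨?_⟩
  rintro σ (rfl | rfl | rfl | rfl) <;> exact (isQF_equal _ _).isUniversal.all

lemma semilatticeAxioms_finite (f : L.Functions 2) : (semilatticeAxioms f).Finite := by
  simp [semilatticeAxioms]

lemma latticeAxioms_finite (sup inf : L.Functions 2) : (latticeAxioms sup inf).Finite := by
  simp [latticeAxioms, semilatticeAxioms_finite]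

lemma distribLatticeTheory_isUniversal : distribLatticeTheory.IsUniversal := by
  refine isUniversal_union (latticeAxioms_isUniversal _ _) ⟨?_⟩
  rintro σ (rfl | rfl)
  exacts [distribAx_isUniversal _ _, infOrderAx_isUniversal _ _]

lemma distribLatticeTheory_finite : distribLatticeTheory.Finite :=
  (latticeAxioms_finite _ _).union ((Set.finite_singleton _).insert _)

lemma booleanTheory_isUniversal : booleanTheory.IsUniversal := by
  refine isUniversal_union (isUniversal_union (latticeAxioms_isUniversal _ _) ⟨?_⟩)
    (complementAxioms_isUniversal _ _ _ _ _)
  rintro σ (rfl | rfl)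
  exacts [distribAx_isUniversal _ _, infOrderAx_isUniversal _ _]

lemma booleanTheory_finite : booleanTheory.Finite :=
  ((latticeAxioms_finite _ _).union ((Set.finite_singleton _).insert _)).union
    ((((Set.finite_singleton _).insert _).insert _).insert _)

lemma joinSemilatticeTheory_isUniversal : joinSemilatticeTheory.IsUniversal := by
  refine isUniversal_union (semilatticeAxioms_isUniversal _) ⟨?_⟩
  rintro σ rfl
  exact supOrderAx_isUniversal _ _

lemma joinSemilatticeTheory_finite : joinSemilatticeTheory.Finite :=
  (semilatticeAxioms_finite _).union (Set.finite_singleton _)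

lemma meetSemilatticeTheory_isUniversal : meetSemilatticeTheory.IsUniversal := by
  refine isUniversal_union (semilatticeAxioms_isUniversal _) ⟨?_⟩
  rintro σ rfl
  exact infOrderAx_isUniversal _ _

lemma meetSemilatticeTheory_finite : meetSemilatticeTheory.Finite :=
  (semilatticeAxioms_finite _).union (Set.finite_singleton _)

lemma posetTheory_finite : posetTheory.Finite := by
  simp [posetTheory, partialOrderTheory, preorderTheory]

lemma finiteModelsDecidable_of_finite {T : L.Theory} (ν : SymbolNumbering L) (h : T.Finite)
    (h' : T.IsUniversal) : ν.FiniteModelsDecidable T := by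
  simpa using finiteModelsDecidable_union ν (finiteModelsDecidable_empty ν) h h'

lemma nonempty_symbolNumbering (h₁ : Finite (Σ n, L.Functions n))
    (h₂ : Finite (Σ n, L.Relations n)) : Nonempty (SymbolNumbering L) :=
  ⟨⟨_, _, Finite.equivFin _, Finite.equivFin _⟩⟩

lemma finite_orderRel : Finite (Σ n, orderRel n) :=
  Finite.of_surjective (fun _ : Unit => ⟨2, .le⟩) fun ⟨_, .le⟩ => ⟨(), rfl⟩

lemma nonempty_symbolNumbering_order : Nonempty (SymbolNumbering Language.order) :=
  nonempty_symbolNumbering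
    (Finite.of_injective (fun x => x.2.elim : _ → Unit) fun x => x.2.elim) finite_orderRel

lemma nonempty_symbolNumbering_semilattice : Nonempty (SymbolNumbering semilatticeLang) :=
  nonempty_symbolNumbering
    (Finite.of_surjective (fun _ : Unit => ⟨2, .op⟩) fun ⟨_, .op⟩ => ⟨(), rfl⟩) finite_orderRel

lemma nonempty_symbolNumbering_lattice : Nonempty (SymbolNumbering latticeLang) := by
  refine nonempty_symbolNumbering (Finite.of_surjective
    (fun i : Fin 2 => (![⟨2, .sup⟩, ⟨2, .inf⟩] : Fin 2 → Σ n, LatticeFun n) i) ?_) finite_orderRel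
  rintro ⟨_, _ | _⟩
  exacts [⟨0, rfl⟩, ⟨1, rfl⟩]

lemma nonempty_symbolNumbering_boolean : Nonempty (SymbolNumbering booleanLang) := by
  refine nonempty_symbolNumbering (Finite.of_surjective
    (fun i : Fin 5 => (![⟨2, .sup⟩, ⟨2, .inf⟩, ⟨1, .compl⟩, ⟨0, .bot⟩, ⟨0, .top⟩] :
      Fin 5 → Σ n, BooleanFun n) i) ?_) finite_orderRel
  rintro ⟨_, _ | _ | _ | _ | _⟩
  exacts [⟨0, rfl⟩, ⟨1, rfl⟩, ⟨2, rfl⟩, ⟨3, rfl⟩, ⟨4, rfl⟩]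

end Universal

/-! ### Local finiteness of distributive lattices and Boolean algebras -/

section LocalFiniteness

open Order

/-- A distributive lattice is finite if the prime ideals are determined by the members of a finite
set that belong to them. -/
lemma finite_of_primeIdeals {M : Type} [DistribLattice M] {m : ℕ} (v : Fin m → M)
    (H : ∀ I J : Ideal M, I.IsPrime → J.IsPrime → (∀ i, v i ∈ I ↔ v i ∈ J) →
      ∀ x, x ∈ I ↔ x ∈ J) : Finite M ∧ Nat.card M ≤ 2 ^ 2 ^ m := by
  -- An element is sent to the traces, on the index set of `v`, of the prime ideals containing it.
  -- Injectivity of this map gives the bound `2 ^ 2 ^ m`.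
  let f : M → Set (Set (Fin m)) := fun x => {s | ∃ I : Ideal M, I.IsPrime ∧ x ∈ I ∧
    s = {i | v i ∈ I}}
  have key (a b : M) (h : f b ⊆ f a) : a ≤ b := by
    by_contra hab
    -- If `a ≤ b` fails, some prime ideal `I` contains `b` but not `a`. Its trace is also that of a
    -- prime ideal containing `a`, which by `H` agrees with `I`: a contradiction.
    obtain ⟨I, hI, hbI, hdis⟩ := DistribLattice.prime_ideal_of_disjoint_filter_ideal
      (F := PFilter.principal a) (I := Ideal.principal b) (by
        rw [Set.disjoint_left]
        intro x hx hx'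
        exact hab ((PFilter.mem_principal.1 hx).trans (Ideal.mem_principal.1 hx')))
    obtain ⟨J, hJ, haJ, hIJ⟩ := h ⟨I, hI, hbI Ideal.mem_principal_self, rfl⟩
    have := (H I J hI hJ (fun i => Set.ext_iff.1 hIJ i) a).2 haJ
    exact Set.disjoint_left.1 hdis (PFilter.mem_principal.2 le_rfl) this
  have hf : Function.Injective f := fun a b h => le_antisymm (key a b h.ge) (key b a h.le)
  refine ⟨Finite.of_injective f hf, (Nat.card_le_card_of_injective f hf).trans_eq ?_⟩
  simp

variable {L : FirstOrder.Language.{0, 0}} {M : Type} [L.Structure M]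

lemma exists_distribLattice {sup inf : L.Functions 2} {R : L.Relations 2}
    (h : M ⊨ (latticeAxioms sup inf ∪ {distribAx sup inf, infOrderAx R inf} : L.Theory)) :
    ∃ _ : DistribLattice M, (∀ x y : M, Structure.funMap sup ![x, y] = x ⊔ y) ∧
      (∀ x y : M, Structure.funMap inf ![x, y] = x ⊓ y) ∧
      ∀ x y : M, Structure.RelMap R ![x, y] ↔ x ≤ y := by
  rw [Theory.model_union_iff, Theory.model_insert_iff, Theory.model_singleton_iff,
    realize_distribAx, realize_infOrderAx] at h
  obtain ⟨h₁, h₂, h₃⟩ := h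
  obtain ⟨_, hsup, hinf⟩ := exists_lattice h₁
  refine ⟨DistribLattice.ofInfSupLe fun a b c => ?_, hsup, hinf, fun x y => ?_⟩
  · simp only [hsup, hinf] at h₂
    exact (h₂ a b c).le
  · rw [h₃, hinf]
    exact inf_eq_left

lemma Ideal_inf_mem_iff {M : Type} [Lattice M] {I : Ideal M} (hI : I.IsPrime) {x y : M} :
    x ⊓ y ∈ I ↔ x ∈ I ∨ y ∈ I :=
  ⟨hI.mem_or_mem, fun h => h.elim (I.lower inf_le_left) (I.lower inf_le_right)⟩

lemma eq_vec_two (x : Fin 2 → M) : x = ![x 0, x 1] := by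
  funext i
  fin_cases i <;> rfl

lemma eq_vec_one (x : Fin 1 → M) : x = ![x 0] := by
  funext i
  fin_cases i
  rfl

/-- A prime ideal contains a join iff it contains both elements, and a meet iff it contains one of
them. By induction on generation, its members are determined by the generators in it. -/
lemma distribLattice_locallyFinite :
    LocallyFiniteWithBound distribLatticeTheory fun m => 2 ^ 2 ^ m := by
  intro m M _ hM v hv
  obtain ⟨_, hsup, hinf, -⟩ := exists_distribLattice hM
  refine finite_of_primeIdeals v fun I J hI hJ hIJ x => ?_
  refine Substructure.closure_induction (L := latticeLang) (s := Set.range v)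
    (p := fun x => x ∈ I ↔ x ∈ J) (hv ▸ Substructure.mem_top x) (by
      rintro _ ⟨i, rfl⟩
      exact hIJ i) ?_
  rintro _ (_ | _) y hy
  · have h₀ : y 0 ∈ I ↔ y 0 ∈ J := hy 0
    have h₁ : y 1 ∈ I ↔ y 1 ∈ J := hy 1
    change Structure.funMap (L := latticeLang) LatticeFun.sup y ∈ I ↔
      Structure.funMap (L := latticeLang) LatticeFun.sup y ∈ J
    rw [eq_vec_two y, hsup, Ideal.sup_mem_iff, Ideal.sup_mem_iff, h₀, h₁]
  · have h₀ : y 0 ∈ I ↔ y 0 ∈ J := hy 0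
    have h₁ : y 1 ∈ I ↔ y 1 ∈ J := hy 1
    change Structure.funMap (L := latticeLang) LatticeFun.inf y ∈ I ↔
      Structure.funMap (L := latticeLang) LatticeFun.inf y ∈ J
    rw [eq_vec_two y, hinf, Ideal_inf_mem_iff hI, Ideal_inf_mem_iff hJ, h₀, h₁]

/-- As for distributive lattices; moreover a prime ideal contains the least element, omits the
greatest, and contains exactly one of an element and its complement. -/
lemma boolean_locallyFinite : LocallyFiniteWithBound booleanTheory fun m => 2 ^ 2 ^ m := by
  intro m M _ hM v hv
  have hM := Theory.model_union_iff.1 hM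
  obtain ⟨_, hsup, hinf, -⟩ := exists_distribLattice hM.1
  obtain ⟨hb, ht, hct, hcb⟩ := (models_complementAxioms _ _ _ _ _).1 hM.2
  simp only [hsup, hinf, sup_eq_left, inf_eq_left] at hb ht hct hcb
  have hbot (I : Ideal M) : Structure.funMap (L := booleanLang) BooleanFun.bot ![] ∈ I := by
    obtain ⟨y, hy⟩ := I.nonempty
    exact I.lower (hb y) hy
  have htop (I : Ideal M) (hI : I.IsPrime) :
      Structure.funMap (L := booleanLang) BooleanFun.top ![] ∉ I := by
    intro h
    exact hI.toIsProper.ne_univ (Set.eq_univ_of_forall fun y => I.lower (ht y) h)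
  have hcompl (I : Ideal M) (hI : I.IsPrime) (x : M) :
      Structure.funMap (L := booleanLang) BooleanFun.compl ![x] ∈ I ↔ x ∉ I := by
    constructor
    · intro h hx
      exact htop I hI (hct x ▸ Ideal.sup_mem hx h)
    · intro hx
      exact (hI.mem_or_mem (hcb x ▸ hbot I)).resolve_left hx
  refine finite_of_primeIdeals v fun I J hI hJ hIJ x => ?_
  refine Substructure.closure_induction (L := booleanLang) (s := Set.range v)
    (p := fun x => x ∈ I ↔ x ∈ J) (hv ▸ Substructure.mem_top x) (by
      rintro _ ⟨i, rfl⟩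
      exact hIJ i) ?_
  rintro _ (_ | _ | _ | _ | _) y hy
  · have h₀ : y 0 ∈ I ↔ y 0 ∈ J := hy 0
    have h₁ : y 1 ∈ I ↔ y 1 ∈ J := hy 1
    change Structure.funMap (L := booleanLang) BooleanFun.sup y ∈ I ↔
      Structure.funMap (L := booleanLang) BooleanFun.sup y ∈ J
    rw [eq_vec_two y, hsup, Ideal.sup_mem_iff, Ideal.sup_mem_iff, h₀, h₁]
  · have h₀ : y 0 ∈ I ↔ y 0 ∈ J := hy 0
    have h₁ : y 1 ∈ I ↔ y 1 ∈ J := hy 1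
    change Structure.funMap (L := booleanLang) BooleanFun.inf y ∈ I ↔
      Structure.funMap (L := booleanLang) BooleanFun.inf y ∈ J
    rw [eq_vec_two y, hinf, Ideal_inf_mem_iff hI, Ideal_inf_mem_iff hJ, h₀, h₁]
  · have h₀ : y 0 ∈ I ↔ y 0 ∈ J := hy 0
    change Structure.funMap (L := booleanLang) BooleanFun.compl y ∈ I ↔
      Structure.funMap (L := booleanLang) BooleanFun.compl y ∈ J
    rw [eq_vec_one y, hcompl I hI, hcompl J hJ, h₀]
  · change Structure.funMap (L := booleanLang) BooleanFun.bot y ∈ I ↔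
      Structure.funMap (L := booleanLang) BooleanFun.bot y ∈ J
    rw [Subsingleton.elim y ![] ]
    exact iff_of_true (hbot I) (hbot J)
  · change Structure.funMap (L := booleanLang) BooleanFun.top y ∈ I ↔
      Structure.funMap (L := booleanLang) BooleanFun.top y ∈ J
    rw [Subsingleton.elim y ![] ]
    exact iff_of_false (htop I hI) (htop J hJ)

lemma computable_two_pow_two_pow : Computable fun m : ℕ => 2 ^ 2 ^ m :=
  (primrec_pow.comp (Primrec.const 2) (primrec_pow.comp (Primrec.const 2) Primrec.id)).to_comp

end LocalFiniteness

/-! ### Embedding finite posets in finite complete lattices -/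

section Posets

lemma card_le_two_pow_two_pow {α β : Type} [Finite α] {m : ℕ} (hα : Nat.card α ≤ 2 ^ m)
    {f : β → Set α} (hf : Function.Injective f) : Finite β ∧ Nat.card β ≤ 2 ^ 2 ^ m := by
  refine ⟨Finite.of_injective f hf, (Nat.card_le_card_of_injective f hf).trans ?_⟩
  have : Fintype α := Fintype.ofFinite α
  rw [Nat.card_eq_fintype_card, Fintype.card_set, ← Nat.card_eq_fintype_card]
  exact Nat.pow_le_pow_right two_pos hα

/-- The finite subposet `Set.range v` embeds in its complete lattice of lower sets by principal
lower sets. The crude estimate `m ≤ 2 ^ m` yields the same bound as in the other cases. -/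
lemma exists_lowerSet_of_poset (M : Type) [Language.order.Structure M] [M ⊨ posetTheory] :
    ∃ _ : PartialOrder M,
      (∀ x y : M, Structure.RelMap (L := Language.order) orderRel.le ![x, y] ↔ x ≤ y) ∧
      ∀ (m : ℕ) (v : Fin m → M),
      ∃ (N : Type) (_ : Language.order.Structure N) (_ : CompleteLattice N), N ⊨ posetTheory ∧
        (∀ x y : N, Structure.RelMap (L := Language.order) orderRel.le ![x, y] ↔ x ≤ y) ∧
        Finite N ∧ Nat.card N ≤ 2 ^ 2 ^ m ∧
        ∃ (A : Set M) (e : A → N), Set.range v ⊆ A ∧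
          IsPartialEmbedding Language.order A e := by
  have : M ⊨ Language.order.partialOrderTheory := ‹M ⊨ posetTheory›
  let _ : PartialOrder M := Language.order.partialOrderOfModels M
  refine ⟨inferInstance, fun _ _ => Iff.rfl, fun m v => ?_⟩
  let _ : Language.order.Structure (LowerSet (Set.range v)) := Language.orderStructure _
  have hcard : Nat.card (Set.range v) ≤ 2 ^ m := by
    refine (Finite.card_range_le v).trans ?_
    rw [Nat.card_fin]
    exact Nat.lt_two_pow_self.le
  obtain ⟨h₁, h₂⟩ := card_le_two_pow_two_pow hcard
    (SetLike.coe_injective : Function.Injective ((↑) : LowerSet (Set.range v) → Set _))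
  refine ⟨LowerSet (Set.range v), inferInstance, inferInstance,
    @model_partialOrder Language.order (LowerSet (Set.range v)) _ _ _ ⟨fun _ => Iff.rfl⟩,
    fun _ _ => Iff.rfl, h₁, h₂, Set.range v, LowerSet.Iic, subset_rfl, LowerSet.Iic_injective,
    fun f => f.elim, ?_⟩
  rintro _ ⟨⟩ x
  change LowerSet.Iic (x 0) ≤ LowerSet.Iic (x 1) ↔ _
  rw [LowerSet.Iic_le, LowerSet.mem_Iic_iff, ← Subtype.coe_le_coe]
  exact iff_of_eq (congrArg (Structure.RelMap (L := Language.order) orderRel.le)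
    (eq_vec_two fun i => (x i : M)).symm)

end Posets

/-! ### Embedding finitely generated semilattices in finite complete lattices -/

section Semilattices

/-- An order with a binary operation, as a structure for the language of semilattices. -/
abbrev semilatticeStructure {N : Type} [LE N] (op : N → N → N) : semilatticeLang.Structure N where
  funMap | .op => fun x => op (x 0) (x 1)
  RelMap | .le => fun x => x 0 ≤ x 1

variable {M : Type} [semilatticeLang.Structure M]

lemma exists_semilatticeSup (h : M ⊨ joinSemilatticeTheory) : ∃ _ : SemilatticeSup M,
    (∀ x y : M, Structure.funMap (L := semilatticeLang) SemilatticeFun.op ![x, y] = x ⊔ y) ∧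
    ∀ x y : M, Structure.RelMap (L := semilatticeLang) orderRel.le ![x, y] ↔ x ≤ y := by
  replace h := Theory.model_union_iff.1 h
  rw [Theory.model_singleton_iff] at h
  obtain ⟨h₁, h₂⟩ := h
  replace h₁ := (models_semilatticeAxioms _).1 h₁
  replace h₂ := (realize_supOrderAx _ _).1 h₂
  let _ : Max M := ⟨fun x y => Structure.funMap (L := semilatticeLang) SemilatticeFun.op ![x, y]⟩
  exact ⟨SemilatticeSup.mk' h₁.1 h₁.2.1 h₁.2.2, fun _ _ => rfl, h₂⟩

lemma exists_semilatticeInf (h : M ⊨ meetSemilatticeTheory) : ∃ _ : SemilatticeInf M,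
    (∀ x y : M, Structure.funMap (L := semilatticeLang) SemilatticeFun.op ![x, y] = x ⊓ y) ∧
    ∀ x y : M, Structure.RelMap (L := semilatticeLang) orderRel.le ![x, y] ↔ x ≤ y := by
  replace h := Theory.model_union_iff.1 h
  rw [Theory.model_singleton_iff] at h
  obtain ⟨h₁, h₂⟩ := h
  replace h₁ := (models_semilatticeAxioms _).1 h₁
  replace h₂ := (realize_infOrderAx _ _).1 h₂
  let _ : Min M := ⟨fun x y => Structure.funMap (L := semilatticeLang) SemilatticeFun.op ![x, y]⟩
  let _ : SemilatticeInf M := SemilatticeInf.mk' h₁.1 h₁.2.1 h₁.2.2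
  exact ⟨inferInstance, fun _ _ => rfl, fun x y => (h₂ x y).trans inf_eq_left⟩

lemma models_joinSemilatticeTheory {N : Type} [SemilatticeSup N] :
    letI := semilatticeStructure (N := N) (· ⊔ ·)
    N ⊨ joinSemilatticeTheory := by
  let _ := semilatticeStructure (N := N) (· ⊔ ·)
  exact Theory.model_union_iff.2 ⟨(models_semilatticeAxioms _).2 ⟨sup_comm, sup_assoc, sup_idem⟩,
    Theory.model_singleton_iff.2 ((realize_supOrderAx _ _).2 fun _ _ => sup_eq_right.symm)⟩

lemma models_meetSemilatticeTheory {N : Type} [SemilatticeInf N] :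
    letI := semilatticeStructure (N := N) (· ⊓ ·)
    N ⊨ meetSemilatticeTheory := by
  let _ := semilatticeStructure (N := N) (· ⊓ ·)
  exact Theory.model_union_iff.2 ⟨(models_semilatticeAxioms _).2 ⟨inf_comm, inf_assoc, inf_idem⟩,
    Theory.model_singleton_iff.2 ((realize_infOrderAx _ _).2 fun _ _ => inf_eq_left.symm)⟩

lemma isPartialEmbedding_semilatticeStructure [PartialOrder M] {N : Type} [PartialOrder N]
    {op : N → N → N} {A : Set M} {e : A → N}
    (hR : ∀ x y : M, Structure.RelMap (L := semilatticeLang) orderRel.le ![x, y] ↔ x ≤ y)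
    (he : ∀ a b : A, e a ≤ e b ↔ a ≤ b)
    (hop : ∀ a b c : A,
      Structure.funMap (L := semilatticeLang) SemilatticeFun.op ![(a : M), (b : M)] = c →
      op (e a) (e b) = e c) :
    letI := semilatticeStructure op
    IsPartialEmbedding semilatticeLang A e := by
  let _ := semilatticeStructure op
  refine ⟨fun a b h => le_antisymm ((he _ _).1 h.le) ((he _ _).1 h.ge), ?_, ?_⟩
  · rintro _ ⟨⟩ x b h
    exact hop (x 0) (x 1) b
      ((congrArg _ (eq_vec_two fun i => (x i : M)).symm).trans h)
  · rintro _ ⟨⟩ x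
    refine (he (x 0) (x 1)).trans ((hR (x 0) (x 1)).symm.trans ?_)
    exact iff_of_eq (congrArg (Structure.RelMap (L := semilatticeLang) orderRel.le)
      (eq_vec_two fun i => (x i : M)).symm)

/-- The generated subsemilattice `S` is finite, and `UpperSet.Ici` embeds it in its upper sets.
These are ordered by reverse inclusion, so joins are intersections, and the upper bounds of `a ⊔ b`
are the common upper bounds of `a` and `b`. Principal lower sets would not preserve joins. -/
lemma exists_upperSet_of_joinSemilattice (M : Type) [semilatticeLang.Structure M]
    [hM : M ⊨ joinSemilatticeTheory] : ∃ _ : PartialOrder M,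
      (∀ x y : M, Structure.RelMap (L := semilatticeLang) orderRel.le ![x, y] ↔ x ≤ y) ∧
      ∀ (m : ℕ) (v : Fin m → M),
      ∃ (N : Type) (_ : semilatticeLang.Structure N) (_ : CompleteLattice N),
        N ⊨ joinSemilatticeTheory ∧
        (∀ x y : N, Structure.RelMap (L := semilatticeLang) orderRel.le ![x, y] ↔ x ≤ y) ∧
        Finite N ∧ Nat.card N ≤ 2 ^ 2 ^ m ∧
        ∃ (A : Set M) (e : A → N), Set.range v ⊆ A ∧ IsPartialEmbedding semilatticeLang A e := by
  obtain ⟨_, hsup, hR⟩ := exists_semilatticeSup hM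
  refine ⟨inferInstance, hR, fun m v => ?_⟩
  let S : Set M := Substructure.closure semilatticeLang (Set.range v)
  -- An element of `S` is the join of the generators below it.
  have hle (x : M) (hx : x ∈ S) : ∀ y, (∀ i, v i ≤ x → v i ≤ y) → x ≤ y := by
    refine Substructure.closure_induction (L := semilatticeLang) (s := Set.range v)
      (p := fun x => ∀ y, (∀ i, v i ≤ x → v i ≤ y) → x ≤ y) hx ?_ ?_
    · rintro _ ⟨i, rfl⟩ y hy
      exact hy i le_rfl
    · rintro _ ⟨⟩ x h y hy
      have h₀ := h 0 y
      have h₁ := h 1 y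
      change ∀ i, v i ≤ Structure.funMap (L := semilatticeLang) SemilatticeFun.op x → _ at hy
      change Structure.funMap (L := semilatticeLang) SemilatticeFun.op x ≤ y
      rw [eq_vec_two x, hsup] at hy ⊢
      exact sup_le (h₀ fun i hi => hy i (hi.trans le_sup_left))
        (h₁ fun i hi => hy i (hi.trans le_sup_right))
  -- Hence `S` has at most `2 ^ m` elements, and its upper sets number at most `2 ^ 2 ^ m`.
  have hinj : Function.Injective fun x : S => {i | v i ≤ x} := fun x y h =>
    le_antisymm (hle x x.2 y (Set.ext_iff.1 h · |>.1)) (hle y y.2 x (Set.ext_iff.1 h · |>.2))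
  have : Finite S := Finite.of_injective _ hinj
  obtain ⟨h₁, h₂⟩ := card_le_two_pow_two_pow (m := m)
    ((Nat.card_le_card_of_injective _ hinj).trans_eq (by simp))
    (SetLike.coe_injective : Function.Injective ((↑) : UpperSet S → Set S))
  refine ⟨UpperSet S, semilatticeStructure (· ⊔ ·), inferInstance, models_joinSemilatticeTheory,
    fun _ _ => Iff.rfl, h₁, h₂, S, UpperSet.Ici, Substructure.subset_closure,
    isPartialEmbedding_semilatticeStructure hR (fun a b => ?_) fun a b c h => ?_⟩
  · exact UpperSet.le_Ici.trans UpperSet.mem_Ici_iff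
  · rw [hsup] at h
    ext x
    simp only [SetLike.mem_coe, UpperSet.mem_sup_iff, UpperSet.mem_Ici_iff, ← Subtype.coe_le_coe,
      ← h, sup_le_iff]

/-- The dual construction: lower sets are ordered by inclusion, so meets are intersections, and
principal lower sets preserve meets. -/
lemma exists_lowerSet_of_meetSemilattice (M : Type) [semilatticeLang.Structure M]
    [hM : M ⊨ meetSemilatticeTheory] : ∃ _ : PartialOrder M,
      (∀ x y : M, Structure.RelMap (L := semilatticeLang) orderRel.le ![x, y] ↔ x ≤ y) ∧
      ∀ (m : ℕ) (v : Fin m → M),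
      ∃ (N : Type) (_ : semilatticeLang.Structure N) (_ : CompleteLattice N),
        N ⊨ meetSemilatticeTheory ∧
        (∀ x y : N, Structure.RelMap (L := semilatticeLang) orderRel.le ![x, y] ↔ x ≤ y) ∧
        Finite N ∧ Nat.card N ≤ 2 ^ 2 ^ m ∧
        ∃ (A : Set M) (e : A → N), Set.range v ⊆ A ∧ IsPartialEmbedding semilatticeLang A e := by
  obtain ⟨_, hinf, hR⟩ := exists_semilatticeInf hM
  refine ⟨inferInstance, hR, fun m v => ?_⟩
  let S : Set M := Substructure.closure semilatticeLang (Set.range v)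
  have hle (x : M) (hx : x ∈ S) : ∀ y, (∀ i, x ≤ v i → y ≤ v i) → y ≤ x := by
    refine Substructure.closure_induction (L := semilatticeLang) (s := Set.range v)
      (p := fun x => ∀ y, (∀ i, x ≤ v i → y ≤ v i) → y ≤ x) hx ?_ ?_
    · rintro _ ⟨i, rfl⟩ y hy
      exact hy i le_rfl
    · rintro _ ⟨⟩ x h y hy
      have h₀ := h 0 y
      have h₁ := h 1 y
      change ∀ i, Structure.funMap (L := semilatticeLang) SemilatticeFun.op x ≤ v i → _ at hy
      change y ≤ Structure.funMap (L := semilatticeLang) SemilatticeFun.op x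
      rw [eq_vec_two x, hinf] at hy ⊢
      exact le_inf (h₀ fun i hi => hy i (inf_le_left.trans hi))
        (h₁ fun i hi => hy i (inf_le_right.trans hi))
  have hinj : Function.Injective fun x : S => {i | x ≤ v i} := fun x y h =>
    le_antisymm (hle y y.2 x (Set.ext_iff.1 h · |>.2)) (hle x x.2 y (Set.ext_iff.1 h · |>.1))
  have : Finite S := Finite.of_injective _ hinj
  obtain ⟨h₁, h₂⟩ := card_le_two_pow_two_pow (m := m)
    ((Nat.card_le_card_of_injective _ hinj).trans_eq (by simp))
    (SetLike.coe_injective : Function.Injective ((↑) : LowerSet S → Set S))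
  refine ⟨LowerSet S, semilatticeStructure (· ⊓ ·), inferInstance, models_meetSemilatticeTheory,
    fun _ _ => Iff.rfl, h₁, h₂, S, LowerSet.Iic, Substructure.subset_closure,
    isPartialEmbedding_semilatticeStructure hR (fun a b => ?_) fun a b c h => ?_⟩
  · exact LowerSet.Iic_le
  · rw [hinf] at h
    ext x
    simp only [SetLike.mem_coe, LowerSet.mem_inf_iff, LowerSet.mem_Iic_iff, ← Subtype.coe_le_coe,
      ← h, le_inf_iff]

end Semilattices

/-! ### Finitely axiomatized theories of lattices with an order symbol -/

section Lattices

variable {L : FirstOrder.Language.{0, 0}} {q : ℕ} {ar : Fin q → ℕ} {T : L.Theory}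

lemma leSpec_of_infOrderAx {R : L.Relations 2} {inf : L.Functions 2} {M : Type} [L.Structure M]
    [(L.sum (opLang ar)).Structure M] [(LHom.sumInl : L →ᴸ L.sum (opLang ar)).IsExpansionOn M]
    [Lattice M] (hT : M ⊨ infOrderAx R inf)
    (hinf : ∀ x y : M, Structure.funMap inf ![x, y] = x ⊓ y) :
    LeSpec (L := L.sum (opLang ar)) (relLe (Sum.inl R)) M :=
  leSpec_relLe fun x y => by
    rw [(realize_infOrderAx R inf).1 hT x y, hinf, inf_eq_left]

/-- Decidability for extensions of finitely axiomatized, locally finite universal theories of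
lattices in a language with a symbol for the order. -/
theorem withLatOps_relLe_decidable (hν : Nonempty (SymbolNumbering L)) {R : L.Relations 2}
    {sup inf : L.Functions 2} {g : ℕ → ℕ} (hfin : T.Finite) (huniv : T.IsUniversal)
    (hlat : latticeAxioms sup inf ⊆ T) (hR : infOrderAx R inf ∈ T) (hg : Computable g)
    (hlf : LocallyFiniteWithBound T g) (c : ∀ k, LatOpCond (ar k)) :
    UniversalConsequencesDecidable (withLatOps T sup inf (relLe (Sum.inl R)) c) := by
  obtain ⟨ν⟩ := hν
  refine withLatOps_decidable huniv (finiteModelsDecidable_of_finite ν hfin huniv) hg hlf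
    (relLe_isQF _) ?_ ?_ c
  · intro M _ hM _
    exact exists_lattice (Theory.Model.mono hM hlat)
  · intro M _ _ _ _ _ hinf
    exact leSpec_of_infOrderAx (Theory.realize_sentence_of_mem T hR) hinf

end Lattices

end OrderedOps

open OrderedOps in
theorem corollary5p2 {q : ℕ} (ar : Fin q → ℕ) :
    -- Boolean algebras
    (∀ c : ∀ k, LatOpCond (ar k), UniversalConsequencesDecidable
      (withLatOps (L := booleanLang) booleanTheory BooleanFun.sup BooleanFun.inf
        (relLe (Sum.inl orderRel.le)) c)) ∧
    -- distributive lattices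
    (∀ c : ∀ k, LatOpCond (ar k), UniversalConsequencesDecidable
      (withLatOps (L := latticeLang) distribLatticeTheory LatticeFun.sup LatticeFun.inf
        (relLe (Sum.inl orderRel.le)) c)) ∧
    -- locally finite universal theories of lattices, with a computable bound
    (∀ (L : FirstOrder.Language.{0, 0}) (ν : SymbolNumbering L) (T : L.Theory)
        (sup inf : L.Functions 2) (g : ℕ → ℕ),
      T.IsUniversal →
      (∀ σ ∈ latticeAxioms sup inf, T ⊨ᵇ σ) →
      ν.FiniteModelsDecidable T →
      Computable g →
      LocallyFiniteWithBound T g →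
      ∀ c : ∀ k, LatOpCond (ar k), UniversalConsequencesDecidable
        (withLatOps T sup inf (infLe (Sum.inl inf)) c)) ∧
    -- partially ordered sets
    (∀ c : ∀ k, OpCond (ar k), UniversalConsequencesDecidable
      (withOps posetTheory (relLe (Sum.inl orderRel.le)) c)) ∧
    -- join semilattices
    (∀ c : ∀ k, OpCond (ar k), UniversalConsequencesDecidable
      (withOps joinSemilatticeTheory (relLe (Sum.inl orderRel.le)) c)) ∧
    -- meet semilattices
    (∀ c : ∀ k, OpCond (ar k), UniversalConsequencesDecidable
      (withOps meetSemilatticeTheory (relLe (Sum.inl orderRel.le)) c)) := by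
  refine ⟨fun c => ?_, fun c => ?_, fun L ν T sup inf g huniv hlat hfmd hg hlf c => ?_,
    fun c => ?_, fun c => ?_, fun c => ?_⟩
  · exact withLatOps_relLe_decidable (L := booleanLang) nonempty_symbolNumbering_boolean
      booleanTheory_finite booleanTheory_isUniversal
      (fun σ h => Or.inl (Or.inl h)) (Or.inl (Or.inr (Or.inr rfl))) computable_two_pow_two_pow
      boolean_locallyFinite c
  · exact withLatOps_relLe_decidable (L := latticeLang) nonempty_symbolNumbering_lattice
      distribLatticeTheory_finite distribLatticeTheory_isUniversal
      (fun σ h => Or.inl h) (Or.inr (Or.inr rfl)) computable_two_pow_two_pow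
      distribLattice_locallyFinite c
  · refine withLatOps_decidable huniv hfmd hg hlf (infLe_isQF _) ?_ ?_ c
    · intro M _ _ _
      exact exists_lattice ((Theory.model_iff _).2 fun σ hσ =>
        (hlat σ hσ).realize_sentence M)
    · intro M _ _ _ _ _ hinf
      exact leSpec_infLe hinf
  · obtain ⟨ν⟩ := nonempty_symbolNumbering_order
    exact withOps_decidable (L := Language.order)
      (finiteModelsDecidable_of_finite ν posetTheory_finite
        (inferInstanceAs Language.order.partialOrderTheory.IsUniversal))
      computable_two_pow_two_pow (fun M => exists_lowerSet_of_poset M) c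
  · obtain ⟨ν⟩ := nonempty_symbolNumbering_semilattice
    exact withOps_decidable (L := semilatticeLang)
      (finiteModelsDecidable_of_finite ν joinSemilatticeTheory_finite
        joinSemilatticeTheory_isUniversal)
      computable_two_pow_two_pow (fun M => exists_upperSet_of_joinSemilattice M) c
  · obtain ⟨ν⟩ := nonempty_symbolNumbering_semilattice
    exact withOps_decidable (L := semilatticeLang)
      (finiteModelsDecidable_of_finite ν meetSemilatticeTheory_finite
        meetSemilatticeTheory_isUniversal)
      computable_two_pow_two_pow (fun M => exists_lowerSet_of_meetSemilattice M) c
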